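/- **Theorem.** Let $s\ge 0$ be real and let $l^2_s$ be the Hilbert space of real sequences $u=(u^j)_{j\ge0}$ with $|u|_s^2=\sum_{j\ge0}(1+j)^{2s}|u^j|^2<\infty$. Let $(\omega_j)_{j\ge0}$ be positive integers with $\omega_j\sim j$, in the sense that $c\,j\le\omega_j\le c'j$ for all large $j$, for some $c,c'>0$. Put $(\mathfrak A u)^j=\omega_j^2u^j$ and let $\Phi^t(\xi)=(\xi^j\cos(\omega_jt))_{j\ge0}$ be the solution of $\ddot u+\mathfrak A u=0$ with initial data $(\xi,0)$. For a map $f$ on sequences put $\langle f\rangle(\xi)=\frac1{2\pi}\int_0^{2\pi}\Phi^t\big(f(\Phi^t(\xi))\big)\,dt$. Let $$\big(\mathfrak f^{(2)}(u)\big)^m=-3\sum_{i,j\ge0}\overline{\mathfrak C}_{ijm}u^iu^j,\qquad \big(\mathfrak f^{(3)}(u)\big)^m=-\sum_{i,j,k\ge0}\mathfrak C_{ijkm}u^iu^ju^k$$ with real coefficients such that $\overline{\mathfrak C}_{ijm}=\overline{\mathfrak C}_{jim}$. Assume that these series converge absolutely for all $u\in l^2_s$, that they define maps $\mathfrak f^{(2)},\mathfrak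 f^{(3)}:l^2_s\to l^2_s$ that are differentiable with differentials that are Lipschitz on bounded sets, and that $\mathfrak f^{(2)}$ is non-resonant: $\langle\mathfrak f^{(2)}\rangle(\xi)=0$ for all $\xi\in l^2_{s+3}$. For each choice of the sign define on $l^2_{s+3}$ $$M_\pm(\xi)=\pm\mathfrak A\xi+\langle\mathfrak f^{(3)}\rangle(\xi)+\mathfrak F_0(\xi),$$ $$\big(\mathfrak F_0(\xi)\big)^m=\frac94\sum_{\tau\in\{-1,1\}}\ \sum_{\kappa,\nu\ge0}\overline{\mathfrak C}_{\kappa\nu m}\sum_{\substack{i,j\ge0\\ \omega_i+\tau\omega_j\ne\pm\omega_\nu}}\frac{\overline{\mathfrak C}_{ij\nu}\;\xi^i\xi^j\xi^\kappa}{\omega_\nu^2-(\omega_i+\tau\omega_j)^2}\;N\big(\omega_i+\tau\omega_j,\kappa,m\big),$$ where $N(l,\kappa,m)$ is the number of pairs of signs $(a,b)\in\{-1,1\}^2$ with $l+a\omega_\kappa+b\omega_m=0$. Let $\xi_0\in l^2_{s+3}$ satisfy $M_\pm(\xi_0)=0$ and $\ker\big(dM_\pm(\xi_0)\big)=\{0\}$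 in $l^2_{s+3}$. Let $0<\alpha<1/3$ and $$\mathcal W_\alpha=\Big\{\omega\in\mathbb R:\ |\omega l-\omega_j|\ge\frac{\alpha}{l}\ \text{ for all integers } l\ge1,\ j\ge0 \text{ with } \omega_j\ne l\Big\}.$$ Then there are a set $\mathcal E_\alpha\subseteq(0,\infty)$ such that $\mathcal E_\alpha\cap(0,\delta)$ is uncountable for every $\delta>0$ (so $\mathcal E_\alpha$ is uncountable and accumulates at $0$), constants $\omega_\star\in(0,1)$ and $K$, frequencies $\omega_\epsilon\in\mathcal W_\alpha$ and functions $u_\epsilon:\mathbb R\to l^2_s$ ($\epsilon\in\mathcal E_\alpha$) such that, for all $\epsilon\in\mathcal E_\alpha$: 1. all coordinates of $u_\epsilon$ are $C^2$ and $\ddot u_\epsilon^j+(\mathfrak A u_\epsilon)^j=\big(\mathfrak f^{(2)}(u_\epsilon)+\mathfrak f^{(3)}(u_\epsilon)\big)^j$ on $\mathbb R$ for all $j\ge0$; $u_\epsilon$ has period $T_\epsilon=2\pi/\omega_\epsilon$; 2. $|1-\omega_\epsilon|\le K\epsilon$; for $M_+$, $\omega_\epsilon\in[1,1+\omega_\star)$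 and $\epsilon\mapsto\omega_\epsilon$ is strictly increasing on $\mathcal E_\alpha$; for $M_-$, $\omega_\epsilon\in(1-\omega_\star,1]$ and $\epsilon\mapsto\omega_\epsilon$ is strictly decreasing on $\mathcal E_\alpha$; 3. $u_\epsilon\in H^1([0,T_\epsilon];l^2_s)$; 4. $\sup_{t\in\mathbb R}\big|u_\epsilon(t)-\Phi^{t\omega_\epsilon}(\epsilon\xi_0)\big|_s\le K\epsilon^2$. -/

import Mathlib

open scoped Real Topology ENNReal NNReal
open Set Filter MeasureTheory

noncomputable section

namespace SeqPDE

/-! ### The weighted sequence spaces -/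

/-- The weight `(1 + j) ^ s`. The shift by one makes the weight positive at `j = 0`; for `j ≥ 1` it
is comparable with `j ^ s`. -/
def wt (s : ℝ) (j : ℕ) : ℝ := ((j : ℝ) + 1) ^ s

theorem wt_pos (s : ℝ) (j : ℕ) : 0 < wt s j := Real.rpow_pos_of_pos (by positivity) s

theorem wt_mono {s s' : ℝ} (h : s ≤ s') (j : ℕ) : wt s j ≤ wt s' j :=
  Real.rpow_le_rpow_of_exponent_le (by linarith [(Nat.cast_nonneg j : (0 : ℝ) ≤ j)]) h

/-- `u` belongs to `l²_s`: the series `∑ ((1 + j) ^ s * u j) ^ 2` converges. -/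
def MemW (s : ℝ) (u : ℕ → ℝ) : Prop := Summable fun j : ℕ => (wt s j * u j) ^ 2

theorem memW_iff_memlp (s : ℝ) (u : ℕ → ℝ) :
    MemW s u ↔ Memℓp (fun j : ℕ => wt s j * u j) 2 := by
  rw [memℓp_gen_iff (by norm_num), MemW]
  simp [mul_pow]

/-- `l²_s` as a linear subspace of all real sequences. -/
def ellWSub (s : ℝ) : Submodule ℝ (ℕ → ℝ) where
  carrier := {u | MemW s u}
  add_mem' := by
    intro u v hu hv
    rw [mem_ofPred_eq, memW_iff_memlp] at *
    have h := hu.add hv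
    convert h using 1
    funext j
    simp [mul_add]
  zero_mem' := by simp [MemW, summable_zero]
  smul_mem' := by
    intro c u hu
    rw [mem_ofPred_eq, memW_iff_memlp] at *
    have h := hu.const_smul c
    convert h using 1
    funext j
    simp [mul_left_comm]

/-- The Hilbert space `l²_s` of real sequences `u` with `∑ (1 + j) ^ (2 * s) * (u j) ^ 2 < ∞`. -/
def ellW (s : ℝ) : Type := ↥(ellWSub s)

instance (s : ℝ) : AddCommGroup (ellW s) := inferInstanceAs (AddCommGroup ↥(ellWSub s))

instance (s : ℝ) : Module ℝ (ellW s) := inferInstanceAs (Module ℝ ↥(ellWSub s))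

/-- The coordinates of an element of `l²_s`. -/
instance (s : ℝ) : CoeFun (ellW s) (fun _ => ℕ → ℝ) := ⟨fun u => u.1⟩

theorem ellW.memW {s : ℝ} (u : ellW s) : MemW s u := u.2

@[ext] theorem ellW.ext {s : ℝ} {u v : ellW s} (h : ∀ j, u j = v j) : u = v :=
  Subtype.ext (funext h)

@[simp] theorem ellW.add_apply {s : ℝ} (u v : ellW s) (j : ℕ) : (u + v) j = u j + v j := rfl

@[simp] theorem ellW.smul_apply {s : ℝ} (c : ℝ) (u : ellW s) (j : ℕ) : (c • u) j = c * u j := rfl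

/-- Multiplication by the weight, a linear bijection of `l²_s` onto `l²`. -/
def toL2 (s : ℝ) : ellW s →ₗ[ℝ] lp (fun _ : ℕ => ℝ) 2 where
  toFun u := ⟨fun j => wt s j * u j, (memW_iff_memlp s u).1 u.2⟩
  map_add' u v := by
    ext j
    exact mul_add _ _ _
  map_smul' c u := by
    ext j
    exact mul_left_comm _ _ _

theorem toL2_injective (s : ℝ) : Function.Injective (toL2 s) := by
  intro u v h
  ext j
  have h1 : wt s j * u j = wt s j * v j := congrFun (congrArg Subtype.val h) j
  exact mul_left_cancel₀ (wt_pos s j).ne' h1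

theorem toL2_surjective (s : ℝ) : Function.Surjective (toL2 s) := by
  intro a
  have ha : (fun j : ℕ => wt s j * ((wt s j)⁻¹ * a.1 j)) = a.1 := by
    funext j
    rw [mul_inv_cancel_left₀ (wt_pos s j).ne']
  refine ⟨⟨fun j => (wt s j)⁻¹ * a.1 j, ?_⟩, Subtype.ext ha⟩
  change MemW s _
  rw [memW_iff_memlp, ha]
  exact a.2

instance (s : ℝ) : NormedAddCommGroup (ellW s) :=
  NormedAddCommGroup.induced (ellW s) (lp (fun _ : ℕ => ℝ) 2) (toL2 s) (toL2_injective s)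

instance (s : ℝ) : NormedSpace ℝ (ellW s) :=
  NormedSpace.induced ℝ (ellW s) (lp (fun _ : ℕ => ℝ) 2) (toL2 s)

/-- The norm of `l²_s` is the one announced. -/
theorem ellW.norm_sq {s : ℝ} (u : ellW s) : ‖u‖ ^ 2 = ∑' j : ℕ, (wt s j * u j) ^ 2 := by
  have h := lp.norm_rpow_eq_tsum (p := 2) (by norm_num) (toL2 s u)
  have h2 : ‖u‖ = ‖toL2 s u‖ := rfl
  rw [h2]
  simpa [toL2, mul_pow] using h

instance (s : ℝ) : CompleteSpace (ellW s) := by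
  have hi : Isometry (toL2 s) := AddMonoidHomClass.isometry_of_norm _ fun _ => rfl
  rw [completeSpace_iff_isComplete_univ, ← hi.isUniformInducing.isComplete_iff, image_univ,
    (toL2_surjective s).range_eq]
  exact isComplete_univ

theorem MemW.mono {s s' : ℝ} (h : s ≤ s') {u : ℕ → ℝ} (hu : MemW s' u) : MemW s u := by
  refine Summable.of_nonneg_of_le (fun j => sq_nonneg _) (fun j => ?_) hu
  rw [mul_pow, mul_pow]
  have := wt_mono h j
  have := (wt_pos s j).le
  gcongr

/-- The inclusion of `l²_{s'}` into `l²_s` for `s ≤ s'`. -/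
def ellW.incl {s s' : ℝ} (h : s ≤ s') : ellW s' →ₗ[ℝ] ellW s where
  toFun u := ⟨u.1, MemW.mono h u.2⟩
  map_add' _ _ := rfl
  map_smul' _ _ := rfl

/-! ### The linear part -/

/-- The multiplication operator with eigenvalues `(ω j) ^ 2`. -/
def mulOp (ω : ℕ → ℕ) (u : ℕ → ℝ) : ℕ → ℝ := fun j => (ω j : ℝ) ^ 2 * u j

/-- The solution at time `t` of the linearized equation with data `(ξ, 0)` at time `0`. -/
def flow (ω : ℕ → ℕ) (t : ℝ) (ξ : ℕ → ℝ) : ℕ → ℝ := fun j => Real.cos (ω j * t) * ξ j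

theorem MemW.flow {s : ℝ} (ω : ℕ → ℕ) (t : ℝ) {u : ℕ → ℝ} (hu : MemW s u) :
    MemW s (flow ω t u) := by
  refine Summable.of_nonneg_of_le (fun j => sq_nonneg _) (fun j => ?_) hu
  have h1 : (wt s j * SeqPDE.flow ω t u j) ^ 2
      = Real.cos (ω j * t) ^ 2 * (wt s j * u j) ^ 2 := by
    simp only [SeqPDE.flow]
    ring
  rw [h1]
  exact mul_le_of_le_one_left (sq_nonneg _) (Real.cos_sq_le_one _)

/-- The linear flow on `l²_s`. -/
def ellW.flow {s : ℝ} (ω : ℕ → ℕ) (t : ℝ) (u : ellW s) : ellW s :=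
  ⟨SeqPDE.flow ω t u, MemW.flow ω t u.2⟩

/-- The average of a map `f` along the linear flow,
`(2π)⁻¹ ∫_0^{2π} Φ^t (f (Φ^t ξ)) dt`, computed coordinate by coordinate. -/
def flowAverage (ω : ℕ → ℕ) (f : (ℕ → ℝ) → (ℕ → ℝ)) (ξ : ℕ → ℝ) : ℕ → ℝ := fun m =>
  (2 * π)⁻¹ * ∫ t in (0 : ℝ)..(2 * π), flow ω t (f (flow ω t ξ)) m

/-- The Diophantine set of frequencies. -/
def diophantine (ω : ℕ → ℕ) (α : ℝ) : Set ℝ :=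
  {w : ℝ | ∀ l j : ℕ, 1 ≤ l → ω j ≠ l → α / l ≤ |w * l - ω j|}

/-! ### The nonlinearity -/

/-- The quadratic term `-3 ∑_{i,j} D i j m * u i * u j`. -/
def quadTerm (D : ℕ → ℕ → ℕ → ℝ) (u : ℕ → ℝ) : ℕ → ℝ := fun m =>
  -3 * ∑' p : ℕ × ℕ, D p.1 p.2 m * u p.1 * u p.2

/-- The cubic term `-∑_{i,j,k} C i j k m * u i * u j * u k`. -/
def cubicTerm (C : ℕ → ℕ → ℕ → ℕ → ℝ) (u : ℕ → ℝ) : ℕ → ℝ := fun m =>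
  -∑' p : ℕ × ℕ × ℕ, C p.1 p.2.1 p.2.2 m * u p.1 * u p.2.1 * u p.2.2

/-- The map `f` on sequences sends `l²_s` into itself and is, as such, Fréchet differentiable with
a differential that is Lipschitz on bounded sets. -/
def IsC11On (s : ℝ) (f : (ℕ → ℝ) → (ℕ → ℝ)) : Prop :=
  ∃ F : ellW s → ellW s, (∀ (u : ellW s) (m : ℕ), F u m = f u m) ∧
    Differentiable ℝ F ∧
    ∀ R : ℝ, ∃ K : ℝ≥0, LipschitzOnWith K (fderiv ℝ F) (Metric.ball 0 R)

/-- The number of choices of the two signs with `l ± ω κ ± ω m = 0`. -/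
def resCount (ω : ℕ → ℕ) (l : ℤ) (κ m : ℕ) : ℝ :=
  ∑ a ∈ ({1, -1} : Finset ℤ), ∑ b ∈ ({1, -1} : Finset ℤ),
    if l + a * (ω κ : ℤ) + b * (ω m : ℤ) = 0 then 1 else 0

/-- `(ω ν ^ 2 - l ^ 2)⁻¹` if `l ≠ ± ω ν`, and `0` otherwise. -/
def nonresInv (ω : ℕ → ℕ) (ν : ℕ) (l : ℤ) : ℝ :=
  if l ≠ (ω ν : ℤ) ∧ l ≠ -(ω ν : ℤ) then ((ω ν : ℝ) ^ 2 - (l : ℝ) ^ 2)⁻¹ else 0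

/-- The cubic backreaction term of the quadratic nonlinearity. -/
def backreaction (ω : ℕ → ℕ) (D : ℕ → ℕ → ℕ → ℝ) (ξ : ℕ → ℝ) : ℕ → ℝ := fun m =>
  9 / 4 * ∑' q : ℕ × ℕ, D q.1 q.2 m * ∑' p : ℕ × ℕ,
      D p.1 p.2 q.2 * nonresInv ω q.2 ((ω p.1 : ℤ) - (ω p.2 : ℤ)) * ξ p.1 * ξ p.2 * ξ q.1 *
        resCount ω ((ω p.1 : ℤ) - (ω p.2 : ℤ)) q.1 m +
  9 / 4 * ∑' q : ℕ × ℕ, D q.1 q.2 m * ∑' p : ℕ × ℕ,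
      D p.1 p.2 q.2 * nonresInv ω q.2 ((ω p.1 : ℤ) + (ω p.2 : ℤ)) * ξ p.1 * ξ p.2 * ξ q.1 *
        resCount ω ((ω p.1 : ℤ) + (ω p.2 : ℤ)) q.1 m

/-- The modified operator `σ A ξ + ⟨f₃⟩(ξ) + F₀(ξ)`, where `σ = ± 1`. -/
def modOp (ω : ℕ → ℕ) (D : ℕ → ℕ → ℕ → ℝ) (C : ℕ → ℕ → ℕ → ℕ → ℝ) (σ : ℝ) (ξ : ℕ → ℝ) : ℕ → ℝ :=
  σ • mulOp ω ξ + flowAverage ω (cubicTerm C) ξ + backreaction ω D ξ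

/-- The differential at `ξ` in the direction `h` of the modified operator on `l²_r`; its `m`-th
coordinate is the Fréchet differential of the `m`-th coordinate of the operator. -/
def modOpDiff (ω : ℕ → ℕ) (D : ℕ → ℕ → ℕ → ℝ) (C : ℕ → ℕ → ℕ → ℕ → ℝ) (σ : ℝ) {r : ℝ}
    (ξ h : ellW r) : ℕ → ℝ := fun m =>
  fderiv ℝ (fun x : ellW r => modOp ω D C σ x m) ξ h

/-! ### Periodic solutions -/

/-- `u ∈ H¹([a, b]; E)`, for the continuous representative: `u` is the primitive of a square
integrable function, its weak derivative. -/
def MemH1 {E : Type*} [NormedAddCommGroup E] [NormedSpace ℝ E] (u : ℝ → E) (a b : ℝ) : Prop :=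
  ∃ v : ℝ → E, MemLp v 2 (volume.restrict (Icc a b)) ∧
    ∀ t ∈ Icc a b, u t = u a + ∫ τ in a..t, v τ

/-- `u` solves `ü^j + (A u)^j = (f₂(u) + f₃(u))^j` for all `j` at all times. -/
def IsSolution (ω : ℕ → ℕ) (D : ℕ → ℕ → ℕ → ℝ) (C : ℕ → ℕ → ℕ → ℕ → ℝ) {s : ℝ}
    (u : ℝ → ellW s) : Prop :=
  ∀ j : ℕ, ContDiff ℝ 2 (fun t => u t j) ∧
    ∀ t : ℝ, iteratedDeriv 2 (fun τ => u τ j) t + mulOp ω (u t) j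
      = quadTerm D (u t) j + cubicTerm C (u t) j

end SeqPDE

end

noncomputable section

namespace SeqPDE

open scoped BoundedContinuousFunction

/-! The proof is a Lyapunov–Schmidt reduction in which the Diophantine condition removes the small
divisors, so that a contraction argument is enough and no Nash–Moser scheme is needed.

Rescale time so that the period is `2π`, put `w² = 1 + 2σε²` and look for `u(t) = ε p(wt)` with `p =
Φξ + εW`, where `Φξ` is the orbit of the linear flow through `ξ`. With `B` the bilinear map of the
quadratic term and `F` the cubic map, the equation becomes `w² W'' + A W = B(p, p) + ε F(p) + 2σε A
Φξ`. The modes `cos(ω_j t)` in the `j`-th coordinate span the kernel. On the other modes the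
multiplier is `ω_j² - w² l²`. Since `|wl - ω_j| ≥ α / l` is multiplied by the large factor `ω_j +
wl`, this multiplier is bounded below, and it grows quadratically away from `l = ± ω_j / w`. Its
inverses are therefore summable in `l`, uniformly in `j` and `w`: the inverse `R_w` on the range is
convolution with a bounded kernel, and it maps bounded continuous `l²_s`-valued functions to such
functions (`Admissible.one_add_sq_le`, `greenKernel`).

The range equation reads `W = R_w B(Φξ, Φξ) + v` with `v = ε R_w n`, where `n` is what remains of
the nonlinearity after `B(Φξ, Φξ)` is removed and a factor `ε` is taken out. The average of `B(Φξ,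
Φξ)` along the flow vanishes by non-resonance, so the kernel equation is `ξ = -σ A⁻¹ ⟨n⟩`. At `ε =
0`, `v = 0` one has `n = 2 B(Φξ, R_1 B(Φξ, Φξ)) + F(Φξ)`, and the kernel equation is exactly `M_±(ξ)
= 0`; the first summand produces the term `𝔉₀` (`Model.backreaction_eq`, `Model.modOp_eq`).

The linearized kernel equation is the identity minus a compact operator, because `A⁻¹` gains two
derivatives. The Fredholm alternative and the trivial kernel of `dM_±(ξ₀)` make it invertible
(`Model.exists_equiv`), and a contraction argument near `(ξ₀, 0)` solves the system
(`Bifurcation.exists_solution`). It runs inside the closed set of even, periodic functions with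
Lipschitz constant `1`, which supplies the cosine series and the `H¹` regularity.

It remains to find uncountably many small `ε` with `√(1 + 2σε²)` Diophantine. Frequencies `1 + σ /
(N + y)` qualify if `y` is badly approximable with a constant above `α` and `N` is large. For every
constant below `1 / 3` there are uncountably many such `y`, given by continued fractions of ones
with sparse pairs of twos (`exists_injective_badlyApproximable`). -/

/-! ### Badly approximable numbers with constant close to `1 / 3` -/

/-- The finite continued fraction `1 / (a 0 + 1 / (a 1 + ⋯))` with `k` partial quotients and
last tail `1 / 2`. -/
def cfTrunc : ℕ → (ℕ → ℕ) → ℝ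
  | 0, _ => 1 / 2
  | k + 1, a => 1 / (a 0 + cfTrunc k fun n => a (n + 1))

theorem cfTrunc_mem (k : ℕ) (a : ℕ → ℕ) (ha : ∀ n, a n = 1 ∨ a n = 2) :
    cfTrunc k a ∈ Icc (1 / 3 : ℝ) 1 := by
  induction k generalizing a with
  | zero => constructor <;> norm_num [cfTrunc]
  | succ k ih =>
    obtain ⟨h1, h2⟩ := ih (fun n => a (n + 1)) fun n => ha _
    simp only [cfTrunc]
    have h3 : (1 : ℝ) ≤ a 0 ∧ (a 0 : ℝ) ≤ 2 := by rcases ha 0 with h | h <;> rw [h] <;> norm_num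
    constructor
    · exact one_div_le_one_div_of_le (by linarith) (by linarith)
    · rw [div_le_one (by linarith)]
      linarith

/-- Both denominators are at least `4 / 3`, and `9 / 16 = (4 / 3)⁻²`. This is the contraction that
makes the truncated fractions converge geometrically. -/
theorem abs_one_div_sub_one_div_le {c x y : ℝ} (hc : 1 ≤ c) (hx : 1 / 3 ≤ x) (hy : 1 / 3 ≤ y) :
    |1 / (c + x) - 1 / (c + y)| ≤ 9 / 16 * |x - y| := by
  have h1 : 1 / (c + x) - 1 / (c + y) = (y - x) / ((c + x) * (c + y)) := by
    field_simp
    ring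
  rw [h1, abs_div, abs_sub_comm, div_le_iff₀ (by positivity)]
  have h2 : (16 / 9 : ℝ) ≤ |(c + x) * (c + y)| := by
    rw [abs_of_pos (by positivity)]
    nlinarith
  nlinarith [abs_nonneg (x - y)]

theorem cfTrunc_sub_le (k : ℕ) (a : ℕ → ℕ) (ha : ∀ n, a n = 1 ∨ a n = 2) :
    dist (cfTrunc k a) (cfTrunc (k + 1) a) ≤ 1 * (9 / 16 : ℝ) ^ k := by
  induction k generalizing a with
  | zero =>
    have h1 := cfTrunc_mem 0 a ha
    have h2 := cfTrunc_mem 1 a ha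
    simp only [Real.dist_eq, pow_zero, mem_Icc] at *
    rw [abs_le]
    constructor <;> linarith [h1.1, h1.2, h2.1, h2.2]
  | succ k ih =>
    have h := ih (fun n => a (n + 1)) fun n => ha _
    have h3 : (1 : ℝ) ≤ a 0 := by rcases ha 0 with h | h <;> rw [h] <;> norm_num
    rw [Real.dist_eq] at *
    refine (abs_one_div_sub_one_div_le h3 (cfTrunc_mem k _ fun n => ha _).1
      (cfTrunc_mem (k + 1) _ fun n => ha _).1).trans ?_
    rw [pow_succ]
    linarith

theorem exists_tendsto_cfTrunc (a : ℕ → ℕ) (ha : ∀ n, a n = 1 ∨ a n = 2) :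
    ∃ y, Tendsto (fun k => cfTrunc k a) atTop (𝓝 y) :=
  cauchySeq_tendsto_of_complete
    (cauchySeq_of_le_geometric (9 / 16) 1 (by norm_num) fun k => cfTrunc_sub_le k a ha)

/-- The continued fraction `[0; a 0, a 1, …]` with partial quotients in `{1, 2}`. -/
def cfVal (a : ℕ → ℕ) : ℝ := limUnder atTop fun k => cfTrunc k a

theorem tendsto_cfVal {a : ℕ → ℕ} (ha : ∀ n, a n = 1 ∨ a n = 2) :
    Tendsto (fun k => cfTrunc k a) atTop (𝓝 (cfVal a)) :=
  tendsto_nhds_limUnder (exists_tendsto_cfTrunc a ha)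

theorem cfVal_mem {a : ℕ → ℕ} (ha : ∀ n, a n = 1 ∨ a n = 2) : cfVal a ∈ Icc (1 / 3 : ℝ) 1 :=
  isClosed_Icc.mem_of_tendsto (tendsto_cfVal ha) (Eventually.of_forall fun k => cfTrunc_mem k a ha)

theorem cfVal_eq {a : ℕ → ℕ} (ha : ∀ n, a n = 1 ∨ a n = 2) :
    cfVal a = 1 / (a 0 + cfVal fun n => a (n + 1)) := by
  have ha' : ∀ n, a (n + 1) = 1 ∨ a (n + 1) = 2 := fun n => ha _
  have h3 : (1 : ℝ) ≤ a 0 := by rcases ha 0 with h | h <;> rw [h] <;> norm_num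
  have h1 := (tendsto_cfVal ha).comp (tendsto_add_atTop_nat 1)
  have h2 : Tendsto (fun k => 1 / ((a 0 : ℝ) + cfTrunc k fun n => a (n + 1))) atTop
      (𝓝 (1 / (a 0 + cfVal fun n => a (n + 1)))) := by
    refine tendsto_const_nhds.div (tendsto_const_nhds.add (tendsto_cfVal ha')) ?_
    have := (cfVal_mem ha').1
    positivity
  exact tendsto_nhds_unique h1 h2

theorem cfVal_lt_one {a : ℕ → ℕ} (ha : ∀ n, a n = 1 ∨ a n = 2) : cfVal a < 1 := by
  rw [cfVal_eq ha]
  have h3 : (1 : ℝ) ≤ a 0 := by rcases ha 0 with h | h <;> rw [h] <;> norm_num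
  have := (cfVal_mem (a := fun n => a (n + 1)) fun n => ha _).1
  rw [div_lt_one (by linarith)]
  linarith

/-- The reciprocal of the value is `a 0` plus a tail in `[1/3, 1]`. This interval is shorter than
`1`, so the reciprocal determines `a 0` and the tail, and one iterates. -/
theorem cfVal_injective {a b : ℕ → ℕ} (ha : ∀ n, a n = 1 ∨ a n = 2)
    (hb : ∀ n, b n = 1 ∨ b n = 2) (h : cfVal a = cfVal b) (n : ℕ) : a n = b n := by
  have key : ∀ {a b : ℕ → ℕ}, (∀ n, a n = 1 ∨ a n = 2) → (∀ n, b n = 1 ∨ b n = 2) →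
      cfVal a = cfVal b → a 0 = b 0 ∧ (cfVal fun n => a (n + 1)) = cfVal fun n => b (n + 1) := by
    intro a b ha hb h
    rw [cfVal_eq ha, cfVal_eq hb] at h
    have ha' := cfVal_mem (a := fun n => a (n + 1)) fun n => ha _
    have hb' := cfVal_mem (a := fun n => b (n + 1)) fun n => hb _
    have ha1 := cfVal_lt_one (a := fun n => a (n + 1)) fun n => ha _
    have hb1 := cfVal_lt_one (a := fun n => b (n + 1)) fun n => hb _
    rw [one_div, one_div, inv_inj] at h
    rcases ha 0 with h1 | h1 <;> rcases hb 0 with h2 | h2 <;> rw [h1, h2] at h ⊢ <;>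
      norm_num at h ⊢
    · exact h
    · linarith [hb'.1]
    · linarith [ha'.1]
    · exact h
  induction n generalizing a b with
  | zero => exact (key ha hb h).1
  | succ n ih =>
    exact ih (a := fun n => a (n + 1)) (b := fun n => b (n + 1)) (fun n => ha _) (fun n => hb _)
      (key ha hb h).2

/-- The backward continued fraction `[0; a (n - 1), …, a 0]`. -/
def cfBack (a : ℕ → ℕ) : ℕ → ℝ
  | 0 => 0
  | n + 1 => 1 / (a n + cfBack a n)

theorem cfBack_mem {a : ℕ → ℕ} (ha : ∀ n, a n = 1 ∨ a n = 2) (n : ℕ) :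
    cfBack a n ∈ Icc (0 : ℝ) 1 := by
  induction n with
  | zero => simp [cfBack]
  | succ n ih =>
    have h3 : (1 : ℝ) ≤ a n := by rcases ha n with h | h <;> rw [h] <;> norm_num
    simp only [cfBack, mem_Icc] at *
    constructor
    · have := ih.1
      positivity
    · rw [div_le_one (by linarith)]
      linarith

/-- The tails of the continued fraction. -/
def cfTail (a : ℕ → ℕ) (n : ℕ) : ℝ := cfVal fun k => a (n + k)

theorem cfTail_mem {a : ℕ → ℕ} (ha : ∀ n, a n = 1 ∨ a n = 2) (n : ℕ) :
    cfTail a n ∈ Icc (1 / 3 : ℝ) 1 := cfVal_mem fun _ => ha _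

theorem cfTail_eq {a : ℕ → ℕ} (ha : ∀ n, a n = 1 ∨ a n = 2) (n : ℕ) :
    cfTail a n = 1 / (a n + cfTail a (n + 1)) := by
  rw [cfTail, cfVal_eq fun _ => ha _, cfTail]
  simp only [add_zero, add_assoc, add_comm 1]

/-- Descent along the continued fraction algorithm for the indefinite binary form
`(q y - p) (q + p z) / (1 + y z)`. -/
theorem le_abs_form_of_cf {a : ℕ → ℕ} (ha : ∀ n, a n = 1 ∨ a n = 2) {c : ℝ} (hc : c ≤ 1 / 2)
    (h : ∀ n, c * (a n + cfTail a (n + 1) + cfBack a n) ≤ 1) (N : ℕ) :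
    ∀ n q p : ℕ, q + p ≤ N → (0 < q ∨ 0 < p ∧ 0 < n) →
      c * (1 + cfTail a n * cfBack a n) ≤
        |q * cfTail a n - p| * (q + p * cfBack a n) := by
  induction N with
  | zero => intro n q p h1 h2; omega
  | succ N ih =>
    intro n q p hN hpos
    have hy := cfTail_eq ha n
    obtain ⟨hy1, hy2⟩ := cfTail_mem ha (n + 1)
    obtain ⟨hz1, hz2⟩ := cfBack_mem ha n
    have ha1 : (1 : ℝ) ≤ a n := by rcases ha n with h | h <;> rw [h] <;> norm_num
    have hd : (0 : ℝ) < a n + cfTail a (n + 1) := by linarith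
    -- With `y = cfTail a n` and `z = cfBack a n`, the normalized form at `p = 0` equals `q² / (a n
    -- + cfTail a (n + 1) + z)`, so `h n` is the required bound.
    rcases Nat.eq_zero_or_pos p with rfl | hp
    · have hq : (1 : ℝ) ≤ q := by exact_mod_cast (show 1 ≤ q by omega)
      have hh := h n
      rw [hy]
      generalize cfTail a (n + 1) = y at *
      generalize cfBack a n = z at *
      have e1 : c * (1 + 1 / (a n + y) * z) = c * (a n + y + z) / (a n + y) := by
        field_simp
      have e2 : |(q : ℝ) * (1 / (a n + y)) - ((0 : ℕ) : ℝ)| * (q + ((0 : ℕ) : ℝ) * z)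
          = q ^ 2 / (a n + y) := by
        rw [Nat.cast_zero, sub_zero, abs_of_nonneg (by positivity)]
        ring
      rw [e1, e2]
      gcongr
      nlinarith
    have hp1 : (1 : ℝ) ≤ p := by exact_mod_cast hp
    rcases Nat.eq_zero_or_pos q with rfl | hq
    -- The mirror case: at `q = 0` the same quantity appears with the index `n - 1`, which is why `0
    -- < n` is assumed there.
    · obtain ⟨m, rfl⟩ : ∃ m, n = m + 1 := ⟨n - 1, by omega⟩
      have hh := h m
      obtain ⟨hm1, hm2⟩ := cfBack_mem ha m
      obtain ⟨ht1, ht2⟩ := cfTail_mem ha (m + 1)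
      have ham : (1 : ℝ) ≤ a m := by rcases ha m with h | h <;> rw [h] <;> norm_num
      have hb : cfBack a (m + 1) = 1 / (a m + cfBack a m) := rfl
      rw [hb]
      generalize cfTail a (m + 1) = y at *
      generalize cfBack a m = z at *
      have e1 : c * (1 + y * (1 / (a m + z))) = c * (a m + y + z) / (a m + z) := by
        field_simp
        ring
      have e2 : |((0 : ℕ) : ℝ) * y - p| * (((0 : ℕ) : ℝ) + p * (1 / (a m + z)))
          = p ^ 2 / (a m + z) := by
        rw [Nat.cast_zero, zero_mul, zero_sub, abs_neg, abs_of_nonneg (by positivity)]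
        ring
      rw [e1, e2]
      gcongr
      nlinarith
    have hq1 : (1 : ℝ) ≤ q := by exact_mod_cast hq
    -- The substitution `(q, p, n) ↦ (p, q - p * a n, n + 1)` multiplies the form and `1 + y z` by a
    -- common factor, up to sign, and lowers `q + p` because `a n ≥ 1`.
    by_cases hle : p * a n ≤ q
    · have h2 := ih (n + 1) p (q - p * a n)
        (by have : 1 ≤ a n := by rcases ha n with h | h <;> omega
            have := Nat.le_mul_of_pos_right p this
            omega) (Or.inl hp)
      rw [Nat.cast_sub hle, Nat.cast_mul] at h2
      have hb : cfBack a (n + 1) = 1 / (a n + cfBack a n) := rfl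
      rw [hb] at h2
      rw [hy]
      generalize cfTail a (n + 1) = y at *
      generalize cfBack a n = z at *
      have e1 : c * (1 + 1 / (a n + y) * z)
          = c * (1 + y * (1 / (a n + z))) * ((a n + z) / (a n + y)) := by
        field_simp
        ring
      have e2 : |(q : ℝ) * (1 / (a n + y)) - p| * (q + p * z)
          = |p * y - (q - p * a n)| * (p + (q - p * a n) * (1 / (a n + z)))
            * ((a n + z) / (a n + y)) := by
        have : (q : ℝ) * (1 / (a n + y)) - p = -(p * y - (q - p * a n)) / (a n + y) := by
          field_simp
          ring
        rw [this, abs_div, abs_neg, abs_of_pos hd]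
        field_simp
        ring
      rw [e1, e2]
      gcongr
    -- No descent is possible here, but `p / q` exceeds `1 / a n`, hence lies well above the tail:
    -- `p - q y ≥ 1 / 2`, while `q + p z ≥ 1 + z`. This uses `c ≤ 1 / 2`.
    · push Not at hle
      have hz3 : (q : ℝ) + p * cfBack a n ≥ 1 + cfBack a n := by nlinarith
      obtain ⟨ht1, ht2⟩ := cfTail_mem ha n
      have hk : 1 / 2 ≤ |q * cfTail a n - p| := by
        rw [abs_sub_comm]
        refine le_trans ?_ (le_abs_self _)
        rcases ha n with h1 | h1
        · rw [h1] at hle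
          have : (q : ℝ) + 1 ≤ p := by exact_mod_cast (show q + 1 ≤ p by omega)
          nlinarith
        · have hy3 : cfTail a n ≤ 1 / 2 := by
            rw [hy, h1]
            apply one_div_le_one_div_of_le <;> push_cast <;> linarith
          rw [h1] at hle
          have : (q : ℝ) + 1 ≤ 2 * p := by exact_mod_cast (show q + 1 ≤ 2 * p by omega)
          nlinarith
      calc c * (1 + cfTail a n * cfBack a n) ≤ 1 / 2 * (1 + cfBack a n) := by
            have : cfTail a n * cfBack a n ≤ cfBack a n := by nlinarith
            have : 0 ≤ cfTail a n * cfBack a n := by positivity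
            nlinarith
        _ ≤ _ := by gcongr

/-- At `n = 0` the backward fraction is `0` and the form reduces to `q (q y - p)`. Negative `p` are
harmless because the value is positive. -/
theorem le_mul_abs_cfVal_sub {a : ℕ → ℕ} (ha : ∀ n, a n = 1 ∨ a n = 2) {c : ℝ} (hc : c ≤ 1 / 2)
    (h : ∀ n, c * (a n + cfTail a (n + 1) + cfBack a n) ≤ 1) (q : ℕ) (hq : 0 < q)
    (p : ℤ) : c ≤ q * |q * cfVal a - p| := by
  have hq1 : (1 : ℝ) ≤ q := by exact_mod_cast hq
  rcases le_or_gt 0 p with hp | hp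
  · lift p to ℕ using hp
    have h1 := le_abs_form_of_cf ha hc h (q + p) 0 q p le_rfl (Or.inl hq)
    have h2 : cfTail a 0 = cfVal a := by simp [cfTail]
    rw [h2] at h1
    simp only [cfBack, mul_zero, add_zero, mul_one] at h1
    rw [mul_comm]
    exact_mod_cast h1
  · have hp1 : (p : ℝ) ≤ -1 := by exact_mod_cast (show p ≤ -1 by omega)
    have := (cfVal_mem ha).1
    have h3 : 1 ≤ |q * cfVal a - p| := le_trans (by nlinarith) (le_abs_self _)
    nlinarith

/-- The partial quotients made of blocks of length `2 K + 2`: ones, with two twos in the middle of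
the `i`-th block if `b i` holds. -/
def blockSeq (K : ℕ) (b : ℕ → Bool) (n : ℕ) : ℕ :=
  if (n % (2 * K + 2) = K ∨ n % (2 * K + 2) = K + 1) ∧ b (n / (2 * K + 2)) = true then 2 else 1

theorem blockSeq_eq (K : ℕ) (b : ℕ → Bool) (n : ℕ) : blockSeq K b n = 1 ∨ blockSeq K b n = 2 := by
  unfold blockSeq
  split_ifs <;> simp

theorem blockSeq_injective (K : ℕ) : Function.Injective (blockSeq K) := by
  intro b b' h
  funext i
  have h1 := congrFun h (i * (2 * K + 2) + K)
  have h2 : (i * (2 * K + 2) + K) % (2 * K + 2) = K := by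
    rw [mul_comm, Nat.mul_add_mod, Nat.mod_eq_of_lt (by omega)]
  have h3 : (i * (2 * K + 2) + K) / (2 * K + 2) = i := by
    rw [mul_comm, Nat.mul_add_div (by omega), Nat.div_eq_of_lt (by omega), add_zero]
  simp only [blockSeq, h2, h3, true_or, true_and] at h1
  cases hb : b i <;> cases hb' : b' i <;> simp_all

/-- The number `g = 1 / (1 + g)` is the fixed point of `y ↦ 1 / (1 + y)`, and the difference to `g`
is multiplied by `-g / (1 + y)`. Each partial quotient `1` thus gains a factor of at most `g`. -/
theorem abs_cfTail_sub_le {a : ℕ → ℕ} (ha : ∀ n, a n = 1 ∨ a n = 2) {g : ℝ} (hg : 0 < g)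
    (hg1 : g ≤ 1) (hgg : g * (1 + g) = 1) (K n : ℕ) (h : ∀ k < K, a (n + k) = 1) :
    |cfTail a n - g| ≤ g ^ K := by
  induction K generalizing n with
  | zero =>
    obtain ⟨h1, h2⟩ := cfTail_mem ha n
    rw [abs_le]
    constructor <;> simp <;> linarith
  | succ K ih =>
    have h1 := ih (n + 1) fun k hk => by
      rw [add_assoc, add_comm 1]
      exact h (k + 1) (by omega)
    have h0 := h 0 (by omega)
    rw [add_zero] at h0
    obtain ⟨hy1, hy2⟩ := cfTail_mem ha (n + 1)
    rw [cfTail_eq ha n, h0]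
    generalize cfTail a (n + 1) = y at *
    have : 1 / (((1 : ℕ) : ℝ) + y) - g = g * ((g - y) / (1 + y)) := by
      push_cast
      field_simp
      linear_combination (-1 : ℝ) * hgg
    rw [this, abs_mul, abs_of_pos hg, pow_succ, mul_comm, abs_div, abs_sub_comm]
    gcongr
    refine le_trans (div_le_self (abs_nonneg _) ?_) h1
    rw [abs_of_pos (by linarith)]
    linarith

theorem abs_cfBack_sub_le {a : ℕ → ℕ} (ha : ∀ n, a n = 1 ∨ a n = 2) {g : ℝ} (hg : 0 < g)
    (hg1 : g ≤ 1) (hgg : g * (1 + g) = 1) (K n : ℕ) (h : ∀ k < K, a (n + k) = 1) :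
    |cfBack a (n + K) - g| ≤ g ^ K := by
  induction K with
  | zero =>
    obtain ⟨h1, h2⟩ := cfBack_mem ha n
    rw [abs_le]
    constructor <;> simp <;> linarith
  | succ K ih =>
    have h1 := ih fun k hk => h k (by omega)
    have h0 := h K (by omega)
    obtain ⟨hy1, hy2⟩ := cfBack_mem ha (n + K)
    have hb : cfBack a (n + (K + 1)) = 1 / (a (n + K) + cfBack a (n + K)) := rfl
    rw [hb, h0]
    generalize cfBack a (n + K) = y at *
    have : 1 / (((1 : ℕ) : ℝ) + y) - g = g * ((g - y) / (1 + y)) := by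
      push_cast
      field_simp
      linear_combination (-1 : ℝ) * hgg
    rw [this, abs_mul, abs_of_pos hg, pow_succ, mul_comm, abs_div, abs_sub_comm]
    gcongr
    refine le_trans (div_le_self (abs_nonneg _) ?_) h1
    rw [abs_of_pos (by linarith)]
    linarith

/-- The identity `(1 - g)(2 + g) = 1` shows that a `2` followed by a golden tail has the value `1 -
g`, and `x ↦ 1 / (2 + x)` does not expand distances. -/
theorem abs_one_div_two_add_sub_le {g x : ℝ} (hg : 0 < g) (hgg : g * (1 + g) = 1) (hx : 0 ≤ x) :
    |1 / (2 + x) - (1 - g)| ≤ |x - g| := by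
  have h1 : (1 - g) = 1 / (2 + g) := by
    field_simp
    linear_combination -hgg
  have h2 : 1 / (2 + x) - 1 / (2 + g) = (g - x) / ((2 + x) * (2 + g)) := by
    field_simp
    ring
  rw [h1, h2, abs_div, abs_sub_comm]
  refine div_le_self (abs_nonneg _) ?_
  rw [abs_of_pos (by positivity)]
  nlinarith

/-- The source of the threshold `1 / 3`. At a `1` the sum is at most `1 + 1 + 1`. At a `2` of an
isolated pair one neighbouring fraction is close to `g` and the other, which starts with the second
`2`, is close to `1 - g`; the sum is `2 + g + (1 - g) = 3` up to `g ^ K` on each side. -/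
theorem blockSeq_sum_le (K : ℕ) (b : ℕ → Bool) {g : ℝ} (hg : 0 < g)
    (hg1 : g ≤ 1) (hgg : g * (1 + g) = 1) (n : ℕ) :
    blockSeq K b n + cfTail (blockSeq K b) (n + 1) + cfBack (blockSeq K b) n
      ≤ 3 + 2 * g ^ K := by
  set a := blockSeq K b with ha'
  have ha : ∀ n, a n = 1 ∨ a n = 2 := blockSeq_eq K b
  have hK : 0 < g ^ K := by positivity
  rcases ha n with h | h
  · rw [h]
    have h1 := (cfTail_mem ha (n + 1)).2
    have h2 := (cfBack_mem ha n).2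
    push_cast
    linarith
  · have hn : (n % (2 * K + 2) = K ∨ n % (2 * K + 2) = K + 1) ∧ b (n / (2 * K + 2)) = true := by
      by_contra hcon
      rw [ha', blockSeq, if_neg hcon] at h
      omega
    have hdm := Nat.div_add_mod n (2 * K + 2)
    obtain ⟨hmod, hb⟩ := hn
    set i := n / (2 * K + 2) with hi
    have val : ∀ r < 2 * K + 2, a ((2 * K + 2) * i + r)
        = if r = K ∨ r = K + 1 then 2 else 1 := by
      intro r hr
      rw [ha', blockSeq, Nat.mul_add_mod, Nat.mod_eq_of_lt hr, Nat.mul_add_div (by omega),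
        Nat.div_eq_of_lt hr, add_zero, hb]
      simp
    have hback : |cfBack a ((2 * K + 2) * i + K) - g| ≤ g ^ K :=
      abs_cfBack_sub_le ha hg hg1 hgg K _ fun k hk => by
        rw [val k (by omega), if_neg (by omega)]
    have htail : |cfTail a ((2 * K + 2) * i + (K + 2)) - g| ≤ g ^ K :=
      abs_cfTail_sub_le ha hg hg1 hgg K _ fun k hk => by
        rw [add_assoc, val _ (by omega), if_neg (by omega)]
    have hv1 := val K (by omega)
    have hv2 := val (K + 1) (by omega)
    rw [if_pos (by simp)] at hv1 hv2
    have hbm := (cfBack_mem ha ((2 * K + 2) * i + K)).1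
    have htm := (cfTail_mem ha ((2 * K + 2) * i + (K + 2))).1
    have e1 := abs_one_div_two_add_sub_le hg hgg hbm
    have e2 := abs_one_div_two_add_sub_le hg hgg (x := cfTail a ((2 * K + 2) * i + (K + 2)))
      (by linarith)
    rw [h]
    rcases hmod with hm | hm <;> rw [hm] at hdm <;> rw [← hdm]
    · have h3 : cfTail a ((2 * K + 2) * i + K + 1)
          = 1 / (2 + cfTail a ((2 * K + 2) * i + (K + 2))) := by
        rw [add_assoc, cfTail_eq ha, hv2]
        rfl
      rw [h3]
      rw [abs_le] at *
      push_cast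
      linarith [e2.2, htail.2, hback.2, le_abs_self (cfTail a ((2 * K + 2) * i + (K + 2)) - g),
        abs_le.2 htail, e2.1]
    · have h3 : cfBack a ((2 * K + 2) * i + (K + 1))
          = 1 / (2 + cfBack a ((2 * K + 2) * i + K)) := by
        have : cfBack a ((2 * K + 2) * i + (K + 1))
          = 1 / (a ((2 * K + 2) * i + K) + cfBack a ((2 * K + 2) * i + K)) := rfl
        rw [this, hv1]
        rfl
      rw [h3]
      have h4 : (2 * K + 2) * i + (K + 1) + 1 = (2 * K + 2) * i + (K + 2) := by omega
      rw [h4]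
      push_cast
      have := e1.trans hback
      rw [abs_le] at this htail
      linarith [this.2, htail.2]

/-- For every `c < 1 / 3` there are uncountably many reals `y` with `|q y - p| ≥ c / q`. -/
theorem exists_injective_badlyApproximable {c : ℝ} (hc0 : 0 < c) (hc : c < 1 / 3) :
    ∃ f : (ℕ → Bool) → ℝ, Function.Injective f ∧ ∀ b, f b ∈ Ioo (0 : ℝ) 1 ∧
      ∀ (q : ℕ) (p : ℤ), 0 < q → c ≤ q * |q * f b - p| := by
  obtain ⟨g, hg, hg1, hgg⟩ : ∃ g : ℝ, 0 < g ∧ g < 1 ∧ g * (1 + g) = 1 := by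
    have h5 : √5 * √5 = 5 := Real.mul_self_sqrt (by norm_num)
    have h50 : 0 ≤ √5 := Real.sqrt_nonneg _
    exact ⟨(√5 - 1) / 2, by nlinarith, by nlinarith, by nlinarith⟩
  obtain ⟨K, hK⟩ : ∃ K : ℕ, g ^ K < (1 / c - 3) / 2 := by
    refine exists_pow_lt_of_lt_one ?_ hg1
    have : 3 < 1 / c := by
      rw [lt_div_iff₀ hc0]
      linarith
    linarith
  have hsum : ∀ b n, c * (blockSeq K b n + cfTail (blockSeq K b) (n + 1)
      + cfBack (blockSeq K b) n) ≤ 1 := by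
    intro b n
    have h1 := blockSeq_sum_le K b hg hg1.le hgg n
    have h2 : 3 + 2 * g ^ K ≤ 1 / c := by linarith
    have h3 := h1.trans h2
    rw [le_div_iff₀ hc0] at h3
    linarith
  refine ⟨fun b => cfVal (blockSeq K b), ?_, fun b => ⟨⟨?_, ?_⟩, fun q p hq => ?_⟩⟩
  · intro b b' h
    exact blockSeq_injective K (funext (cfVal_injective (blockSeq_eq K b) (blockSeq_eq K b') h))
  · have := (cfVal_mem (blockSeq_eq K b)).1
    linarith
  · exact cfVal_lt_one (blockSeq_eq K b)
  · exact le_mul_abs_cfVal_sub (blockSeq_eq K b) (by linarith) (hsum b) q hq p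

/-- With `θ = N + y` and `w = 1 + σ / θ` one has `w l - ω j = σ l / θ - (ω j - l)`, where the
integer `ω j - l` is not zero. The claim becomes `|l - p θ| ≥ α θ / l` for integers `p ≠ 0`, a
statement about rational approximation of `y`. -/
theorem mem_diophantine_of_badlyApproximable {ω : ℕ → ℕ} {α c σ : ℝ} (hα0 : 0 < α)
    (hα : α < 1 / 3) (hαc : α < c) (hσ : σ = 1 ∨ σ = -1) {y : ℝ} {N : ℕ}
    (hy0 : 0 < y) (hN : 1 ≤ N * (1 - α / c))
    (hy : ∀ (q : ℕ) (p : ℤ), 0 < q → c ≤ q * |q * y - p|) :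
    1 + σ / (N + y) ∈ diophantine ω α := by
  have hc0 : 0 < c := hα0.trans hαc
  intro l j hl hne
  set θ : ℝ := N + y with hθ
  have hl1 : (1 : ℝ) ≤ l := by exact_mod_cast hl
  have hρ : 0 < 1 - α / c := by
    rw [sub_pos, div_lt_one hc0]
    exact hαc
  have hN0 : (1 : ℝ) ≤ N := by
    rcases Nat.eq_zero_or_pos N with h | h
    · rw [h] at hN
      norm_num at hN
    · exact_mod_cast h
  have hθ0 : 0 < θ := by linarith
  have hθ1 : 1 ≤ θ * (1 - α / c) := by nlinarith
  have key : ∀ p : ℤ, p ≠ 0 → α / l ≤ |l / θ - p| := by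
    intro p hp
    have e : |l / θ - p| = |l - p * θ| / θ := by
      rw [← abs_of_pos hθ0, ← abs_div, abs_of_pos hθ0]
      congr 1
      field_simp
    rw [e, div_le_div_iff₀ (by linarith) hθ0]
    rcases lt_or_gt_of_ne hp with hp | hp
    · have hp1 : (p : ℝ) ≤ -1 := by exact_mod_cast (show p ≤ -1 by omega)
      have : θ ≤ |l - p * θ| := le_trans (by nlinarith) (le_abs_self _)
      nlinarith
    · lift p to ℕ using hp.le
      have hp1 : (1 : ℝ) ≤ p := by exact_mod_cast hp
      have h1 := hy p (l - p * N) (by exact_mod_cast hp)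
      have e2 : (p : ℝ) * y - ((l - p * N : ℤ) : ℝ) = -(l - p * θ) := by
        push_cast
        rw [hθ]
        ring
      rw [e2, abs_neg] at h1
      push_cast
      -- If `l` is not much smaller than `p θ`, the bound `|l - p θ| ≥ c / p` suffices; the gap
      -- between `α` and `c` pays for the difference. Otherwise `|l - p θ|` is a fixed fraction of
      -- `p θ`, and the choice of `N` makes it at least `1`.
      by_cases hcase : α * θ * p ≤ c * l
      · have : α * θ * p ≤ p * |l - p * θ| * l := by nlinarith
        have h3 : p * (α * θ) ≤ p * (|l - p * θ| * l) := by linarith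
        exact le_of_mul_le_mul_left h3 (by linarith)
      · push Not at hcase
        have hlt : (l : ℝ) < α / c * (p * θ) := by
          rw [div_mul_eq_mul_div, lt_div_iff₀ hc0]
          linarith
        have h2 : p * θ * (1 - α / c) ≤ |l - p * θ| := by
          rw [abs_sub_comm]
          exact le_trans (by linarith) (le_abs_self _)
        by_cases hl2 : (l : ℝ) ≤ θ / 2
        · have h3 : θ / 2 ≤ |l - p * θ| := by
            rw [abs_sub_comm]
            exact le_trans (by nlinarith) (le_abs_self _)
          nlinarith
        · push Not at hl2
          have h3 : 1 ≤ |l - p * θ| := by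
            refine le_trans ?_ h2
            nlinarith
          nlinarith
  rcases hσ with rfl | rfl
  · have := key (ω j - l) (by omega)
    convert this using 2
    push_cast
    ring
  · have := key (l - ω j) (by omega)
    rw [← abs_neg] at this
    convert this using 2
    push_cast
    ring

/-- The set of amplitudes for which the frequency `√(1 + 2 σ ε ^ 2)` is Diophantine is uncountable
near zero. -/
theorem not_countable_amplitudes (ω : ℕ → ℕ) {α σ : ℝ} (hα0 : 0 < α) (hα : α < 1 / 3)
    (hσ : σ = 1 ∨ σ = -1) {δ : ℝ} (hδ : 0 < δ) :
    ¬ ({ε : ℝ | √(1 + 2 * σ * ε ^ 2) ∈ diophantine ω α} ∩ Ioo 0 δ).Countable := by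
  obtain ⟨f, hf, hfb⟩ := exists_injective_badlyApproximable (c := (α + 1 / 3) / 2)
    (by linarith) (by linarith)
  set c := (α + 1 / 3) / 2 with hc
  have hc0 : 0 < c := by linarith
  have hρ : 0 < 1 - α / c := by
    rw [sub_pos, div_lt_one hc0]
    linarith
  -- `N > 2` keeps `1 / (N + f b)` below `1 / 2`, the second bound is the hypothesis `hN` of
  -- `mem_diophantine_of_badlyApproximable`, and the third forces the amplitudes below `δ`.
  obtain ⟨N, hN⟩ := exists_nat_gt (max (max 2 (1 / (1 - α / c))) (2 / δ ^ 2))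
  have hN1 : (2 : ℝ) < N := lt_of_le_of_lt ((le_max_left _ _).trans (le_max_left _ _)) hN
  have hN2 : 1 / (1 - α / c) < N := lt_of_le_of_lt ((le_max_right _ _).trans (le_max_left _ _)) hN
  have hN3 : 2 / δ ^ 2 < N := lt_of_le_of_lt (le_max_right _ _) hN
  rw [div_lt_iff₀ hρ] at hN2
  rw [div_lt_iff₀ (by positivity)] at hN3
  have hσ2 : σ * σ = 1 := by rcases hσ with rfl | rfl <;> norm_num
  have hσ1 : σ ≤ 1 ∧ -1 ≤ σ := by rcases hσ with rfl | rfl <;> norm_num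
  set x : (ℕ → Bool) → ℝ := fun b => 1 / (N + f b) with hx
  have hx0 : ∀ b, 0 < x b := fun b => by
    have := (hfb b).1.1
    positivity
  have hxle : ∀ b, x b < 1 / N := fun b =>
    one_div_lt_one_div_of_lt (by linarith) (by linarith [(hfb b).1.1])
  have hN4 : 1 / (N : ℝ) < 1 / 2 := one_div_lt_one_div_of_lt (by norm_num) hN1
  -- The amplitude is the solution of `1 + 2 σ ε² = (1 + σ x)²`, where `σ² = 1`.
  set e : (ℕ → Bool) → ℝ := fun b => √(x b + σ * x b ^ 2 / 2) with he
  have hpos : ∀ b, 0 < x b + σ * x b ^ 2 / 2 := fun b => by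
    have := hx0 b
    have := hxle b
    nlinarith
  have hesq : ∀ b, e b ^ 2 = x b + σ * x b ^ 2 / 2 := fun b => Real.sq_sqrt (hpos b).le
  have hfreq : ∀ b, √(1 + 2 * σ * e b ^ 2) = 1 + σ / (N + f b) := fun b => by
    have h1 : 1 + 2 * σ * e b ^ 2 = (1 + σ * x b) ^ 2 := by
      rw [hesq]
      ring
    rw [h1, Real.sqrt_sq]
    · rw [hx]
      ring
    · have := hx0 b
      have := hxle b
      nlinarith
  intro hcount
  have hinj : Function.Injective e := by
    intro b b' h
    apply hf
    have h1 := hfreq b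
    rw [h, hfreq b'] at h1
    have h2 : σ / (N + f b') = σ / (N + f b) := by linarith
    have hσ0 : σ ≠ 0 := by
      rintro rfl
      norm_num at hσ2
    have h3 := (hfb b).1.1
    have h4 := (hfb b').1.1
    rw [div_eq_div_iff (by positivity) (by positivity)] at h2
    have := mul_left_cancel₀ hσ0 h2
    linarith
  have hr : (range e).Countable := by
    refine hcount.mono ?_
    rintro _ ⟨b, rfl⟩
    refine ⟨?_, Real.sqrt_pos.2 (hpos b), ?_⟩
    · change √(1 + 2 * σ * e b ^ 2) ∈ diophantine ω α
      rw [hfreq b]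
      exact mem_diophantine_of_badlyApproximable hα0 hα (by linarith) hσ (hfb b).1.1 hN2.le
        (hfb b).2
    · rw [he, Real.sqrt_lt' hδ]
      have h1 := hx0 b
      have h2 := hxle b
      have h3 : 2 * (1 / (N : ℝ)) < δ ^ 2 := by
        rw [mul_one_div, div_lt_iff₀ (by linarith)]
        linarith
      nlinarith
  rw [← image_univ] at hr
  have hu : (univ : Set (ℕ → Bool)).Countable := countable_of_injective_of_countable_image
    hinj.injOn hr
  have : Countable (ℕ → Bool) := countable_univ_iff.1 hu
  -- Cantor's diagonal argument.
  obtain ⟨φ, hφ⟩ := exists_surjective_nat (ℕ → Bool)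
  obtain ⟨n, hn⟩ := hφ fun n => !(φ n n)
  have := congrFun hn n
  simp at this

/-! ### Tools for the weighted spaces -/

theorem memW_of_abs_le {s s' C : ℝ} {u v : ℕ → ℝ} (hv : MemW s' v)
    (h : ∀ j, |wt s j * u j| ≤ C * |wt s' j * v j|) : MemW s u := by
  refine Summable.of_nonneg_of_le (fun j => sq_nonneg _) (fun j => ?_) (hv.mul_left (C ^ 2))
  rw [← mul_pow, sq_le_sq, abs_mul C]
  exact (h j).trans (mul_le_mul_of_nonneg_right (le_abs_self C) (abs_nonneg _))

theorem ellW.norm_le_of_abs_le {s s' C : ℝ} (hC : 0 ≤ C) {u : ellW s} {v : ellW s'}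
    (h : ∀ j, |wt s j * u j| ≤ C * |wt s' j * v j|) : ‖u‖ ≤ C * ‖v‖ := by
  rw [← abs_of_nonneg (norm_nonneg u), ← abs_of_nonneg (mul_nonneg hC (norm_nonneg v)),
    ← sq_le_sq, mul_pow, ellW.norm_sq, ellW.norm_sq, ← tsum_mul_left]
  refine Summable.tsum_le_tsum (fun j => ?_) u.2 (Summable.mul_left _ v.2)
  rw [← mul_pow, sq_le_sq, abs_mul C, abs_of_nonneg hC]
  exact h j

theorem ellW.abs_wt_mul_le {s : ℝ} (u : ellW s) (j : ℕ) : |wt s j * u j| ≤ ‖u‖ := by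
  rw [← abs_of_nonneg (norm_nonneg u), ← sq_le_sq, ellW.norm_sq]
  exact Summable.le_tsum u.2 j fun i _ => sq_nonneg _

@[simp] theorem ellW.sub_apply {s : ℝ} (u v : ellW s) (j : ℕ) : (u - v) j = u j - v j := rfl

/-- The coordinate functionals. -/
def coordL (s : ℝ) (j : ℕ) : ellW s →L[ℝ] ℝ :=
  LinearMap.mkContinuous
    { toFun := fun u => u j, map_add' := fun _ _ => rfl, map_smul' := fun _ _ => rfl }
    ((wt s j)⁻¹) fun u => by
      have h := ellW.abs_wt_mul_le u j
      rw [abs_mul, abs_of_pos (wt_pos s j)] at h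
      rw [← div_eq_inv_mul, le_div_iff₀ (wt_pos s j), mul_comm]
      exact h

theorem ellW.continuous_apply {P : Type*} [TopologicalSpace P] {s : ℝ} {x : P → ellW s}
    (hx : Continuous x) (j : ℕ) : Continuous fun p => x p j :=
  (coordL s j).continuous.comp hx

theorem wt_add (s r : ℝ) (j : ℕ) : wt (s + r) j = wt s j * wt r j :=
  Real.rpow_add (by positivity) s r

theorem wt_one (j : ℕ) : wt 1 j = (j : ℝ) + 1 := Real.rpow_one _

theorem ellW.intervalIntegral_apply {s a b : ℝ} {f : ℝ → ellW s} (hf : Continuous f) (j : ℕ) :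
    (∫ t in a..b, f t) j = ∫ t in a..b, f t j :=
  ((coordL s j).intervalIntegral_comp_comm (hf.intervalIntegrable a b)).symm

/-! ### Families of diagonal operators -/

/-- A family of diagonal operators from `l²_s` to `l²_r`, bounded uniformly in the parameter. -/
structure DiagFamily (P : Type*) (s r : ℝ) where
  /-- the eigenvalues -/
  coef : P → ℕ → ℝ
  /-- the bound of the norms -/
  bd : ℝ
  le_bd : ∀ p j, |coef p j| * wt r j ≤ bd * wt s j

namespace DiagFamily

variable {P : Type*} {s r : ℝ} (F : DiagFamily P s r)

theorem bound (p : P) (u : ℕ → ℝ) (j : ℕ) :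
    |wt r j * (F.coef p j * u j)| ≤ F.bd * |wt s j * u j| := by
  have h := F.le_bd p j
  rw [abs_mul, abs_mul, abs_mul, abs_of_pos (wt_pos r j), abs_of_pos (wt_pos s j)]
  have := mul_le_mul_of_nonneg_right h (abs_nonneg (u j))
  linarith

theorem bd_nonneg [Nonempty P] : 0 ≤ F.bd := by
  have p : P := Classical.arbitrary P
  have h := (mul_nonneg (abs_nonneg (F.coef p 0)) (wt_pos r 0).le).trans (F.le_bd p 0)
  exact nonneg_of_mul_nonneg_left h (wt_pos s 0)

/-- The operators of the family. -/
def op (p : P) : ellW s →L[ℝ] ellW r :=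
  LinearMap.mkContinuous
    { toFun := fun u => ⟨fun j => F.coef p j * u j, memW_of_abs_le u.2 (F.bound p u)⟩
      map_add' := fun _ _ => ellW.ext fun _ => mul_add _ _ _
      map_smul' := fun _ _ => ellW.ext fun _ => mul_left_comm _ _ _ }
    F.bd fun u => ellW.norm_le_of_abs_le (@bd_nonneg _ _ _ F ⟨p⟩) (F.bound p u)

@[simp] theorem op_apply (p : P) (u : ellW s) (j : ℕ) : F.op p u j = F.coef p j * u j := rfl

theorem norm_op_apply_le (p : P) (u : ellW s) : ‖F.op p u‖ ≤ F.bd * ‖u‖ :=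
  ellW.norm_le_of_abs_le (@bd_nonneg _ _ _ F ⟨p⟩) (F.bound p u)

/-- Coordinatewise convergence of uniformly bounded eigenvalues gives strong convergence of the
operators, by dominated convergence in the sum that defines the norm. -/
theorem tendsto_op {ι : Type*} {l : Filter ι} {f : ι → P} {p : P}
    (h : ∀ j, Tendsto (fun i => F.coef (f i) j) l (𝓝 (F.coef p j))) (u : ellW s) :
    Tendsto (fun i => F.op (f i) u) l (𝓝 (F.op p u)) := by
  have hb : 0 ≤ F.bd := @bd_nonneg _ _ _ F ⟨p⟩
  rw [tendsto_iff_norm_sub_tendsto_zero]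
  have h1 : Tendsto (fun i => ‖F.op (f i) u - F.op p u‖ ^ 2) l (𝓝 0) := by
    simp_rw [ellW.norm_sq]
    have h0 : (0 : ℝ) = ∑' _ : ℕ, (0 : ℝ) := by simp
    rw [h0]
    refine tendsto_tsum_of_dominated_convergence
      (bound := fun j => (2 * F.bd) ^ 2 * (wt s j * u j) ^ 2) (Summable.mul_left _ u.2)
      (fun j => ?_) (Eventually.of_forall fun i j => ?_)
    · have h2 : Tendsto (fun i => (wt r j * (F.coef (f i) j * u j - F.coef p j * u j)) ^ 2) l
          (𝓝 ((wt r j * (F.coef p j * u j - F.coef p j * u j)) ^ 2)) :=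
        ((((h j).mul_const _).sub_const _).const_mul _).pow 2
      simpa using h2
    · rw [Real.norm_eq_abs, abs_pow, ← mul_pow, ← sq_abs (2 * F.bd * _)]
      refine pow_le_pow_left₀ (abs_nonneg _) ?_ 2
      rw [abs_mul (2 * F.bd), abs_of_nonneg (by positivity : 0 ≤ 2 * F.bd)]
      have e : wt r j * (F.op (f i) u - F.op p u) j
          = wt r j * (F.coef (f i) j * u j) - wt r j * (F.coef p j * u j) := by
        simp only [ellW.sub_apply, op_apply]
        ring
      rw [e]
      refine (abs_sub _ _).trans ?_
      linarith [F.bound (f i) u j, F.bound p u j]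
  have h2 := (Real.continuous_sqrt.tendsto 0).comp h1
  simpa [Function.comp_def, Real.sqrt_sq] using h2

theorem continuous_op [TopologicalSpace P] {Q : Type*} [TopologicalSpace Q] {f : Q → P}
    (h : ∀ j, Continuous fun q => F.coef (f q) j) {x : Q → ellW s} (hx : Continuous x) :
    Continuous fun q => F.op (f q) (x q) := by
  rw [continuous_iff_continuousAt]
  intro q
  have h1 : Tendsto (fun q' => F.op (f q') (x q)) (𝓝 q) (𝓝 (F.op (f q) (x q))) :=
    F.tendsto_op (fun j => (h j).continuousAt) (x q)
  have h2 : Tendsto (fun q' => F.op (f q') (x q' - x q)) (𝓝 q) (𝓝 0) := by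
    rw [tendsto_zero_iff_norm_tendsto_zero]
    refine squeeze_zero (fun _ => norm_nonneg _) (fun q' => F.norm_op_apply_le (f q') _) ?_
    have := ((hx.tendsto q).sub_const (x q)).norm.const_mul F.bd
    simpa using this
  have h3 := h2.add h1
  simp only [map_sub, sub_add_cancel, zero_add] at h3
  exact h3

end DiagFamily

/-- A family of diagonal operators that depends continuously on a real parameter. -/
structure DiagKernel (s r : ℝ) extends DiagFamily ℝ s r where
  cont : ∀ j, Continuous fun t => coef t j

namespace DiagKernel

variable {s r : ℝ} (F : DiagKernel s r)

theorem bd_nonneg : 0 ≤ F.bd := F.toDiagFamily.bd_nonneg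

theorem continuous_op_comp {Q : Type*} [TopologicalSpace Q] {f : Q → ℝ} (hf : Continuous f)
    {x : Q → ellW s} (hx : Continuous x) : Continuous fun q => F.op (f q) (x q) :=
  F.continuous_op (fun j => (F.cont j).comp hf) hx

/-- The orbits of the family. -/
def orbit : ellW s →L[ℝ] (ℝ →ᵇ ellW r) :=
  LinearMap.mkContinuous
    { toFun := fun u => BoundedContinuousFunction.ofNormedAddCommGroup (fun t => F.op t u)
        (F.continuous_op_comp continuous_id continuous_const) (F.bd * ‖u‖)
        fun t => F.norm_op_apply_le t u
      map_add' := fun u v => by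
        ext t : 1
        exact map_add (F.op t) u v
      map_smul' := fun c u => by
        ext t : 1
        exact map_smul (F.op t) c u }
    F.bd fun u => BoundedContinuousFunction.norm_ofNormedAddCommGroup_le _
      (mul_nonneg F.bd_nonneg (norm_nonneg u)) fun t => F.norm_op_apply_le t u

theorem norm_orbit_apply_le (u : ellW s) : ‖F.orbit u‖ ≤ F.bd * ‖u‖ :=
  (F.orbit.le_opNorm u).trans (mul_le_mul_of_nonneg_right
    (LinearMap.mkContinuous_norm_le _ F.bd_nonneg _) (norm_nonneg u))

/-- The mean `(2π)⁻¹ ∫_0^{2π} F(t) g(t) dt`. -/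
def meanFun (g : ℝ → ellW s) : ellW r := (2 * π)⁻¹ • ∫ t in (0 : ℝ)..(2 * π), F.op t (g t)

theorem meanFun_apply {g : ℝ → ellW s} (hg : Continuous g) (j : ℕ) :
    F.meanFun g j = (2 * π)⁻¹ * ∫ t in (0 : ℝ)..(2 * π), F.coef t j * g t j := by
  rw [meanFun, ellW.smul_apply,
    ellW.intervalIntegral_apply (F.continuous_op_comp (f := fun t => t) continuous_id hg)]
  rfl

theorem norm_meanFun_le {g : ℝ → ellW s} {C : ℝ} (hC : ∀ t, ‖g t‖ ≤ C) :
    ‖F.meanFun g‖ ≤ F.bd * C := by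
  have h : ‖∫ t in (0 : ℝ)..(2 * π), F.op t (g t)‖ ≤ F.bd * C * |2 * π - 0| :=
    intervalIntegral.norm_integral_le_of_norm_le_const fun t _ =>
      (F.norm_op_apply_le t _).trans (mul_le_mul_of_nonneg_left (hC t) F.bd_nonneg)
  rw [sub_zero, abs_of_pos Real.two_pi_pos] at h
  rw [meanFun, norm_smul, Real.norm_of_nonneg (by positivity), inv_mul_le_iff₀ Real.two_pi_pos]
  linarith

theorem meanFun_add {g h : ℝ → ellW s} (hg : Continuous g) (hh : Continuous h) :
    F.meanFun (fun t => g t + h t) = F.meanFun g + F.meanFun h := by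
  simp only [meanFun, map_add]
  rw [intervalIntegral.integral_add, smul_add]
  · exact (F.continuous_op_comp continuous_id hg).intervalIntegrable _ _
  · exact (F.continuous_op_comp continuous_id hh).intervalIntegrable _ _

theorem meanFun_smul (c : ℝ) (g : ℝ → ellW s) :
    F.meanFun (fun t => c • g t) = c • F.meanFun g := by
  simp only [meanFun, map_smul]
  rw [intervalIntegral.integral_smul, smul_comm]

/-- The mean as an operator on bounded continuous functions. -/
def mean : (ℝ →ᵇ ellW s) →L[ℝ] ellW r :=
  LinearMap.mkContinuous
    { toFun := fun g => F.meanFun g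
      map_add' := fun g h => F.meanFun_add g.continuous h.continuous
      map_smul' := fun c g => F.meanFun_smul c g }
    F.bd fun g => F.norm_meanFun_le g.norm_coe_le_norm

theorem mean_apply (g : ℝ →ᵇ ellW s) (j : ℕ) :
    F.mean g j = (2 * π)⁻¹ * ∫ t in (0 : ℝ)..(2 * π), F.coef t j * g t j :=
  F.meanFun_apply g.continuous j

theorem continuous_conv {g : ℝ → ellW s} (hg : Continuous g) :
    Continuous fun t => F.meanFun fun τ => g (t - τ) := by
  refine Continuous.const_smul (c := (2 * π)⁻¹) ?_
  refine intervalIntegral.continuous_parametric_intervalIntegral_of_continuous' ?_ _ _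
  exact F.continuous_op_comp continuous_snd (hg.comp (continuous_fst.sub continuous_snd))

/-- Convolution with the family over the circle of length `2π`. -/
def conv : (ℝ →ᵇ ellW s) →L[ℝ] (ℝ →ᵇ ellW r) :=
  LinearMap.mkContinuous
    { toFun := fun g => BoundedContinuousFunction.ofNormedAddCommGroup
        (fun t => F.meanFun fun τ => g (t - τ)) (F.continuous_conv g.continuous) (F.bd * ‖g‖)
        fun t => F.norm_meanFun_le fun τ => g.norm_coe_le_norm _
      map_add' := fun g h => by
        ext t : 1
        exact F.meanFun_add (g.continuous.comp (by fun_prop)) (h.continuous.comp (by fun_prop))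
      map_smul' := fun c g => by
        ext t : 1
        exact F.meanFun_smul c _ }
    F.bd fun g => BoundedContinuousFunction.norm_ofNormedAddCommGroup_le _
      (mul_nonneg F.bd_nonneg (norm_nonneg g)) fun t =>
        F.norm_meanFun_le fun τ => g.norm_coe_le_norm _

theorem conv_apply_eq (g : ℝ →ᵇ ellW s) (t : ℝ) :
    F.conv g t = F.meanFun fun τ => g (t - τ) := rfl

theorem conv_apply (g : ℝ →ᵇ ellW s) (t : ℝ) (j : ℕ) :
    F.conv g t j = (2 * π)⁻¹ * ∫ τ in (0 : ℝ)..(2 * π), F.coef τ j * g (t - τ) j :=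
  F.meanFun_apply (g := fun τ => g (t - τ)) (g.continuous.comp (by fun_prop)) j

theorem norm_conv_le : ‖F.conv‖ ≤ F.bd := LinearMap.mkContinuous_norm_le _ F.bd_nonneg _

theorem norm_conv_apply_le (g : ℝ →ᵇ ellW s) : ‖F.conv g‖ ≤ F.bd * ‖g‖ :=
  (F.conv.le_opNorm g).trans (mul_le_mul_of_nonneg_right F.norm_conv_le (norm_nonneg g))

/-- Convolution commutes with translations, so it transfers a modulus of continuity with the factor
`bd`. This is how the Lipschitz bound survives the inverse on the range. -/
theorem norm_conv_sub_le (g : ℝ →ᵇ ellW s) {t t' C : ℝ}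
    (h : ∀ τ, ‖g (t - τ) - g (t' - τ)‖ ≤ C) : ‖F.conv g t - F.conv g t'‖ ≤ F.bd * C := by
  have e : F.conv g t - F.conv g t' = F.meanFun fun τ => g (t - τ) - g (t' - τ) := by
    have h1 := F.meanFun_add (g := fun τ => g (t - τ) - g (t' - τ)) (h := fun τ => g (t' - τ))
      ((g.continuous.comp (by fun_prop)).sub (g.continuous.comp (by fun_prop)))
      (g.continuous.comp (by fun_prop))
    simp only [sub_add_cancel] at h1
    rw [conv_apply_eq, conv_apply_eq, h1, add_sub_cancel_right]
  rw [e]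
  exact F.norm_meanFun_le h

end DiagKernel

/-! ### The abstract bifurcation argument -/

/-- Banach's theorem on the intersection of `S` with a ball. The set `S` only has to be preserved;
no Lipschitz estimate outside it is used. The bound by `2 * dist (f c) c` later gives `‖ξ - ξ₀‖ =
O(ε)`. -/
theorem exists_fixedPoint_of_half_lipschitz {E : Type*} [MetricSpace E] [CompleteSpace E]
    {f : E → E} {c : E} {r : ℝ} {S : Set E} (hS : IsClosed S) (hc : c ∈ S) (hr : 0 ≤ r)
    (hmaps : ∀ x ∈ S, dist x c ≤ r → f x ∈ S)
    (hlip : ∀ x ∈ S, ∀ y ∈ S, dist x c ≤ r → dist y c ≤ r →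
      dist (f x) (f y) ≤ 1 / 2 * dist x y)
    (hdisp : dist (f c) c ≤ r / 2) :
    ∃ x ∈ S, dist x c ≤ 2 * dist (f c) c ∧ dist x c ≤ r ∧ f x = x := by
  set s : Set E := S ∩ Metric.closedBall c r with hs
  have hsc : IsComplete s := (hS.inter Metric.isClosed_closedBall).isComplete
  have hcs : c ∈ s := ⟨hc, Metric.mem_closedBall_self hr⟩
  have hm : MapsTo f s s := by
    rintro x ⟨hxS, hx⟩
    refine ⟨hmaps x hxS hx, ?_⟩
    have h1 := hlip x hxS c hc hx (by simpa using hr)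
    have h2 := dist_triangle (f x) (f c) c
    rw [Metric.mem_closedBall] at hx ⊢
    linarith
  have hcon : ContractingWith (1 / 2 : ℝ≥0) (hm.restrict f s s) := by
    refine ⟨?_, LipschitzWith.of_dist_le_mul fun x y => ?_⟩
    · rw [div_lt_one (by norm_num)]
      norm_num
    · have := hlip x.1 x.2.1 y.1 y.2.1 x.2.2 y.2.2
      rw [Subtype.dist_eq, Subtype.dist_eq]
      simpa using this
  obtain ⟨x, hx, hfx, -, -⟩ := hcon.exists_fixedPoint' hsc hm hcs (edist_ne_top _ _)
  refine ⟨x, hx.1, ?_, hx.2, hfx⟩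
  have h1 := hlip x hx.1 c hc hx.2 (by simpa using hr)
  have h2 := dist_triangle (f x) (f c) c
  rw [hfx.eq] at h1 h2
  linarith

/-- The data of a Lyapunov–Schmidt decomposition with a quadratic leading nonlinearity. -/
structure Bifurcation (Y X : Type*) [NormedAddCommGroup Y] [NormedSpace ℝ Y]
    [NormedAddCommGroup X] [NormedSpace ℝ X] where
  /-- the embedding of the kernel -/
  Φ : Y →L[ℝ] X
  /-- the quadratic part -/
  B : X →L[ℝ] X →L[ℝ] X
  /-- the remaining nonlinearity -/
  F : X → X
  /-- the inverse of the linear part on the kernel, composed with the projection -/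
  A : X →L[ℝ] Y
  /-- the limit of the inverses on the range -/
  R₁ : X →L[ℝ] X
  /-- the differential of `F` at the embedded approximate solution -/
  DF : X →L[ℝ] X
  /-- the approximate solution -/
  ξ₀ : Y
  /-- a common bound -/
  M : ℝ
  one_le_M : 1 ≤ M
  Φ_le : ∀ a, ‖Φ a‖ ≤ M * ‖a‖
  B_le : ∀ a b, ‖B a b‖ ≤ M * ‖a‖ * ‖b‖
  R₁_le : ∀ a, ‖R₁ a‖ ≤ M * ‖a‖
  DF_le : ∀ a, ‖DF a‖ ≤ M * ‖a‖
  ξ₀_le : ‖ξ₀‖ + 1 ≤ M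
  B_symm : ∀ a b, B a b = B b a
  F_lip : ∀ ρ₀ : ℝ, ∃ K, 0 ≤ K ∧ ∀ ρ ≤ ρ₀, ∀ p q, ‖p - Φ ξ₀‖ ≤ ρ → ‖q - Φ ξ₀‖ ≤ ρ →
    ‖F p - F q - DF (p - q)‖ ≤ K * ρ * ‖p - q‖

namespace Bifurcation

variable {Y X : Type*} [NormedAddCommGroup Y] [NormedSpace ℝ Y]
    [NormedAddCommGroup X] [NormedSpace ℝ X] (b : Bifurcation Y X)

/-- The second order part of the range component. -/
def second (R : X →L[ℝ] X) (ξ : Y) : X := R (b.B (b.Φ ξ) (b.Φ ξ))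

/-- The nonlinearity after the leading quadratic term has been removed. -/
def nonlin (R : X →L[ℝ] X) (ε : ℝ) (ξ : Y) (w : X) : X :=
  (2 : ℝ) • b.B (b.Φ ξ) (b.second R ξ + w)
    + ε • b.B (b.second R ξ + w) (b.second R ξ + w) + b.F (b.Φ ξ + ε • (b.second R ξ + w))

/-- The differential of the limit of the nonlinearity along the kernel. -/
def lin : Y →L[ℝ] X :=
  (2 : ℝ) • (b.B.flip (b.second b.R₁ b.ξ₀)).comp b.Φ
    + (4 : ℝ) • (b.B (b.Φ b.ξ₀)).comp (b.R₁.comp ((b.B (b.Φ b.ξ₀)).comp b.Φ)) + b.DF.comp b.Φ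

theorem lin_apply (h : Y) : b.lin h = (2 : ℝ) • b.B (b.Φ h) (b.second b.R₁ b.ξ₀)
    + (4 : ℝ) • b.B (b.Φ b.ξ₀) (b.R₁ (b.B (b.Φ b.ξ₀) (b.Φ h))) + b.DF (b.Φ h) := rfl

/-- `R` is `ε`-close to the limit operator on the products of kernel elements. -/
structure IsClose (R : X →L[ℝ] X) (ε : ℝ) : Prop where
  le : ∀ a, ‖R a‖ ≤ b.M * ‖a‖
  sub_le : ∀ x y, ‖R (b.B (b.Φ x) (b.Φ y)) - b.R₁ (b.B (b.Φ x) (b.Φ y))‖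
    ≤ b.M * ε * ‖x‖ * ‖y‖

theorem isClose_self : b.IsClose b.R₁ 0 := ⟨b.R₁_le, fun x y => by simp⟩

theorem norm_Φ_le {a : Y} {α : ℝ} (h : ‖a‖ ≤ α) : ‖b.Φ a‖ ≤ b.M * α :=
  (b.Φ_le a).trans (mul_le_mul_of_nonneg_left h (by linarith [b.one_le_M]))

theorem norm_B_le {x y : X} {α β : ℝ} (hx : ‖x‖ ≤ α) (hy : ‖y‖ ≤ β) :
    ‖b.B x y‖ ≤ b.M * α * β := by
  have := b.one_le_M
  have := (norm_nonneg x).trans hx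
  exact (b.B_le x y).trans (by gcongr)

theorem norm_R₁_le {a : X} {α : ℝ} (h : ‖a‖ ≤ α) : ‖b.R₁ a‖ ≤ b.M * α :=
  (b.R₁_le a).trans (mul_le_mul_of_nonneg_left h (by linarith [b.one_le_M]))

theorem norm_DF_le {a : X} {α : ℝ} (h : ‖a‖ ≤ α) : ‖b.DF a‖ ≤ b.M * α :=
  (b.DF_le a).trans (mul_le_mul_of_nonneg_left h (by linarith [b.one_le_M]))

variable {b}

theorem IsClose.norm_le {R : X →L[ℝ] X} {ε : ℝ} (hR : b.IsClose R ε) {a : X} {α : ℝ}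
    (h : ‖a‖ ≤ α) : ‖R a‖ ≤ b.M * α :=
  (hR.le a).trans (mul_le_mul_of_nonneg_left h (by linarith [b.one_le_M]))

theorem IsClose.norm_sub_le {R : X →L[ℝ] X} {ε t : ℝ} (hR : b.IsClose R ε) (hε : 0 ≤ ε)
    (ht : ε ≤ t) {x y : Y} {α β : ℝ} (hx : ‖x‖ ≤ α) (hy : ‖y‖ ≤ β) :
    ‖R (b.B (b.Φ x) (b.Φ y)) - b.R₁ (b.B (b.Φ x) (b.Φ y))‖ ≤ b.M * t * α * β := by
  have := b.one_le_M
  have := (norm_nonneg x).trans hx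
  have := hε.trans ht
  exact (hR.sub_le x y).trans (by gcongr)

theorem norm_le_M {x : Y} {r : ℝ} (hx : ‖x - b.ξ₀‖ ≤ r) (hr : r ≤ 1) : ‖x‖ ≤ b.M := by
  have h1 := norm_add_le (x - b.ξ₀) b.ξ₀
  rw [sub_add_cancel] at h1
  linarith [b.ξ₀_le]

theorem norm_second_le {R : X →L[ℝ] X} {ε : ℝ} (hR : b.IsClose R ε) {x : Y} {r : ℝ}
    (hx : ‖x - b.ξ₀‖ ≤ r) (hr : r ≤ 1) : ‖b.second R x‖ ≤ b.M ^ 6 := by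
  have h1 := b.norm_Φ_le (norm_le_M hx hr)
  refine (hR.norm_le (b.norm_B_le h1 h1)).trans (le_of_eq ?_)
  ring

theorem norm_second_add_le {R : X →L[ℝ] X} {ε : ℝ} (hR : b.IsClose R ε) {x : Y} {w : X} {r : ℝ}
    (hx : ‖x - b.ξ₀‖ ≤ r) (hw : ‖w‖ ≤ r) (hr : r ≤ 1) :
    ‖b.second R x + w‖ ≤ 2 * b.M ^ 6 := by
  have h1 := norm_second_le hR hx hr
  have h2 := norm_add_le (b.second R x) w
  have h3 := one_le_pow₀ b.one_le_M (n := 6)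
  linarith

theorem norm_second_add_sub_le {R : X →L[ℝ] X} {ε : ℝ} (hR : b.IsClose R ε) {x : Y} {w : X}
    {r t : ℝ} (hx : ‖x - b.ξ₀‖ ≤ r) (hw : ‖w‖ ≤ t) (hr : r ≤ 1) (hrt : r ≤ t) (hε : 0 ≤ ε)
    (ht : ε ≤ t) : ‖b.second R x + w - b.second b.R₁ b.ξ₀‖ ≤ 4 * b.M ^ 5 * t := by
  have hM := b.one_le_M
  have hxM := norm_le_M hx hr
  have e : b.second R x + w - b.second b.R₁ b.ξ₀
      = (R (b.B (b.Φ x) (b.Φ x)) - b.R₁ (b.B (b.Φ x) (b.Φ x)))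
        + b.R₁ (b.B (b.Φ (x - b.ξ₀)) (b.Φ x)) + b.R₁ (b.B (b.Φ b.ξ₀) (b.Φ (x - b.ξ₀))) + w := by
    simp only [second, map_sub, _root_.map_sub, sub_apply]
    abel
  have hξ : ‖b.ξ₀‖ ≤ b.M := by linarith [b.ξ₀_le]
  have h1 := hR.norm_sub_le hε ht hxM hxM
  have h2 := b.norm_R₁_le (b.norm_B_le (b.norm_Φ_le (hx.trans hrt)) (b.norm_Φ_le hxM))
  have h3 := b.norm_R₁_le (b.norm_B_le (b.norm_Φ_le hξ) (b.norm_Φ_le (hx.trans hrt)))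
  rw [e]
  refine (norm_add₃_le.trans (add_le_add (add_le_add (norm_add_le _ _) le_rfl) le_rfl)).trans ?_
  have ht0 : 0 ≤ t := hε.trans ht
  have p3 : b.M ^ 3 * t ≤ b.M ^ 5 * t := by gcongr; norm_num
  have p0 : t ≤ b.M ^ 5 * t := le_mul_of_one_le_left ht0 (one_le_pow₀ hM)
  nlinarith

/-- In `ξ` the nonlinearity is differentiable up to a factor that is small with the radius and `ε`.
In `w` the bound is only Lipschitz; the iteration compensates for this because its range component
carries a factor `ε`. -/
theorem norm_nonlin_sub_le (b : Bifurcation Y X) : ∃ C, 0 ≤ C ∧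
    ∀ (R : X →L[ℝ] X) (ε r : ℝ) (x y : Y) (w v : X), b.IsClose R ε → 0 ≤ ε → ε ≤ 1 → r ≤ 1 →
      ‖x - b.ξ₀‖ ≤ r → ‖y - b.ξ₀‖ ≤ r → ‖w‖ ≤ r → ‖v‖ ≤ r →
      ‖b.nonlin R ε x w - b.nonlin R ε y v - b.lin (x - y)‖
        ≤ C * ((r + ε) * ‖x - y‖ + ‖w - v‖) := by
  obtain ⟨K, hK0, hK⟩ := b.F_lip (3 * b.M ^ 6 * 2)
  refine ⟨150 * b.M ^ 12 * (1 + K), by have := b.one_le_M; positivity, ?_⟩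
  intro R ε r x y w v hR hε0 hε1 hr1 hx hy hw hv
  have hM := b.one_le_M
  have hr0 : 0 ≤ r := (norm_nonneg _).trans hx
  set t := r + ε with ht
  have ht0 : 0 ≤ t := by positivity
  have ht2 : t ≤ 2 := by linarith
  have hrt : r ≤ t := by linarith
  have hεt : ε ≤ t := by linarith
  have hxM := norm_le_M hx hr1
  have hyM := norm_le_M hy hr1
  have hξ : ‖b.ξ₀‖ ≤ b.M := by linarith [b.ξ₀_le]
  set W := b.second R x + w with hW
  set W' := b.second R y + v with hW'
  set h := x - y with hh
  set Q := b.R₁ (b.B (b.Φ b.ξ₀) (b.Φ h)) with hQ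
  have hΦh := b.norm_Φ_le (le_refl ‖h‖)
  have hH0 := norm_nonneg h
  have hD0 := norm_nonneg (w - v)
  have hQn : ‖Q‖ ≤ b.M ^ 5 * ‖h‖ :=
    (b.norm_R₁_le (b.norm_B_le (b.norm_Φ_le hξ) hΦh)).trans (le_of_eq (by ring))
  -- The term `2 Q` is the derivative of `R₁ B(Φξ, Φξ)` at `ξ₀` in the direction `h`. The errors
  -- come from replacing `R` by `R₁`, needed only on products of kernel elements, and from moving
  -- the base point to `ξ₀`.
  have hdW : ‖W - W' - (2 : ℝ) • Q - (w - v)‖ ≤ 4 * b.M ^ 4 * (t * ‖h‖) := by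
    have e : W - W' - (2 : ℝ) • Q - (w - v)
        = (R (b.B (b.Φ h) (b.Φ x)) - b.R₁ (b.B (b.Φ h) (b.Φ x)))
          + (R (b.B (b.Φ h) (b.Φ y)) - b.R₁ (b.B (b.Φ h) (b.Φ y)))
          + (b.R₁ (b.B (b.Φ (x - b.ξ₀)) (b.Φ h)) + b.R₁ (b.B (b.Φ (y - b.ξ₀)) (b.Φ h))) := by
      have s1 := b.B_symm (b.Φ x) (b.Φ y)
      have s2 := b.B_symm (b.Φ b.ξ₀) (b.Φ x)
      have s3 := b.B_symm (b.Φ b.ξ₀) (b.Φ y)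
      simp only [hW, hW', hQ, hh, second, map_sub, sub_apply, two_smul,
        s1, s2, s3]
      abel
    rw [e]
    have h1 := hR.norm_sub_le hε0 hεt (le_refl ‖h‖) hxM
    have h2 := hR.norm_sub_le hε0 hεt (le_refl ‖h‖) hyM
    have h3 := b.norm_R₁_le (b.norm_B_le (b.norm_Φ_le (hx.trans hrt)) hΦh)
    have h4 := b.norm_R₁_le (b.norm_B_le (b.norm_Φ_le (hy.trans hrt)) hΦh)
    refine ((norm_add_le _ _).trans
      (add_le_add (norm_add_le _ _) (norm_add_le _ _))).trans ?_
    have p : b.M ^ 2 * (t * ‖h‖) ≤ b.M ^ 4 * (t * ‖h‖) := by gcongr; norm_num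
    linarith
  have hdW2 : ‖W - W' - (2 : ℝ) • Q‖ ≤ 4 * b.M ^ 4 * (t * ‖h‖) + ‖w - v‖ := by
    have := norm_add_le (W - W' - (2 : ℝ) • Q - (w - v)) (w - v)
    rw [sub_add_cancel] at this
    linarith
  have hdW3 : ‖W - W'‖ ≤ 10 * b.M ^ 5 * ‖h‖ + ‖w - v‖ := by
    have h1 := norm_add_le (W - W' - (2 : ℝ) • Q) ((2 : ℝ) • Q)
    rw [sub_add_cancel, norm_smul, Real.norm_two] at h1
    have p : b.M ^ 4 * (t * ‖h‖) ≤ b.M ^ 5 * (2 * ‖h‖) := by gcongr; norm_num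
    linarith
  have hWn : ‖W‖ ≤ 2 * b.M ^ 6 := norm_second_add_le hR hx hw hr1
  have hWn' : ‖W'‖ ≤ 2 * b.M ^ 6 := norm_second_add_le hR hy hv hr1
  have hW0 := norm_second_add_sub_le hR hx (hw.trans hrt) hr1 hrt hε0 hεt
  rw [← hW] at hW0
  have hpx : ‖b.Φ x + ε • W - b.Φ b.ξ₀‖ ≤ 3 * b.M ^ 6 * t := by
    have h1 : b.Φ x + ε • W - b.Φ b.ξ₀ = b.Φ (x - b.ξ₀) + ε • W := by
      rw [map_sub]; abel
    have h2 := b.norm_Φ_le (hx.trans hrt)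
    have h3 : ‖ε • W‖ ≤ t * (2 * b.M ^ 6) := by
      rw [norm_smul, Real.norm_of_nonneg hε0]
      gcongr
    rw [h1]
    have p : b.M ^ 1 * t ≤ b.M ^ 6 * t := by gcongr; norm_num
    have := norm_add_le (b.Φ (x - b.ξ₀)) (ε • W)
    linarith
  have hpy : ‖b.Φ y + ε • W' - b.Φ b.ξ₀‖ ≤ 3 * b.M ^ 6 * t := by
    have h1 : b.Φ y + ε • W' - b.Φ b.ξ₀ = b.Φ (y - b.ξ₀) + ε • W' := by
      rw [map_sub]; abel
    have h2 := b.norm_Φ_le (hy.trans hrt)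
    have h3 : ‖ε • W'‖ ≤ t * (2 * b.M ^ 6) := by
      rw [norm_smul, Real.norm_of_nonneg hε0]
      gcongr
    rw [h1]
    have p : b.M ^ 1 * t ≤ b.M ^ 6 * t := by gcongr; norm_num
    have := norm_add_le (b.Φ (y - b.ξ₀)) (ε • W')
    linarith
  have hpp : (b.Φ x + ε • W) - (b.Φ y + ε • W') = b.Φ h + ε • (W - W') := by
    rw [hh, map_sub, smul_sub]; abel
  have hεW : ‖ε • (W - W')‖ ≤ t * (10 * b.M ^ 5 * ‖h‖ + ‖w - v‖) := by
    rw [norm_smul, Real.norm_of_nonneg hε0]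
    gcongr
  have hF1 := hK (3 * b.M ^ 6 * t) (by gcongr) _ _ hpx hpy
  rw [hpp] at hF1
  have hF2 : ‖b.Φ h + ε • (W - W')‖ ≤ 21 * b.M ^ 5 * ‖h‖ + 2 * ‖w - v‖ := by
    have h1 := norm_add_le (b.Φ h) (ε • (W - W'))
    have p : b.M ^ 1 * ‖h‖ ≤ b.M ^ 5 * ‖h‖ := by gcongr; norm_num
    have p2 : t * (10 * b.M ^ 5 * ‖h‖ + ‖w - v‖) ≤ 2 * (10 * b.M ^ 5 * ‖h‖ + ‖w - v‖) := by
      gcongr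
    linarith
  -- After `lin h` is subtracted, each summand contains one of: a base point error, a factor `ε`,
  -- the quadratic remainder of `F`, or the difference `w - v` through `W - W' - 2 Q`.
  have e : b.nonlin R ε x w - b.nonlin R ε y v - b.lin h
      = (2 : ℝ) • b.B (b.Φ h) (W - b.second b.R₁ b.ξ₀)
        + (2 : ℝ) • b.B (b.Φ y) (W - W' - (2 : ℝ) • Q)
        + (4 : ℝ) • b.B (b.Φ (y - b.ξ₀)) Q
        + (ε • (b.B (W - W') W + b.B W' (W - W')))
        + (b.F (b.Φ x + ε • W) - b.F (b.Φ y + ε • W') - b.DF (b.Φ h + ε • (W - W')))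
        + b.DF (ε • (W - W')) := by
    have e4 : ∀ z : X, (4 : ℝ) • z = (2 : ℝ) • ((2 : ℝ) • z) := fun z => by
      rw [smul_smul]; norm_num
    simp only [nonlin, ← hW, ← hW', lin_apply, ← hQ, map_sub, map_add, sub_apply,
      smul_sub, smul_add, map_smul, e4]
    simp only [hh, map_sub, sub_apply, smul_sub]
    abel
  have n1 : ‖(2 : ℝ) • b.B (b.Φ h) (W - b.second b.R₁ b.ξ₀)‖ ≤ 8 * b.M ^ 7 * (t * ‖h‖) := by
    rw [norm_smul, Real.norm_two]
    have := b.norm_B_le hΦh hW0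
    linarith
  have n2 : ‖(2 : ℝ) • b.B (b.Φ y) (W - W' - (2 : ℝ) • Q)‖
      ≤ 8 * b.M ^ 7 * (t * ‖h‖) + 2 * b.M ^ 3 * ‖w - v‖ := by
    rw [norm_smul, Real.norm_two]
    have := b.norm_B_le (b.norm_Φ_le hyM) hdW2
    linarith
  have n3 : ‖(4 : ℝ) • b.B (b.Φ (y - b.ξ₀)) Q‖ ≤ 4 * b.M ^ 7 * (t * ‖h‖) := by
    rw [norm_smul, Real.norm_ofNat]
    have := b.norm_B_le (b.norm_Φ_le (hy.trans hrt)) hQn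
    linarith
  have n4 : ‖ε • (b.B (W - W') W + b.B W' (W - W'))‖
      ≤ 40 * b.M ^ 12 * (t * ‖h‖) + 8 * b.M ^ 7 * ‖w - v‖ := by
    rw [norm_smul, Real.norm_of_nonneg hε0]
    have h1 := b.norm_B_le hdW3 hWn
    have h2 := b.norm_B_le hWn' hdW3
    have h3 := norm_add_le (b.B (W - W') W) (b.B W' (W - W'))
    have h4 : ε * ‖b.B (W - W') W + b.B W' (W - W')‖
        ≤ t * (4 * b.M ^ 7 * (10 * b.M ^ 5 * ‖h‖ + ‖w - v‖)) := by
      gcongr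
      linarith
    have h5 : t * (4 * b.M ^ 7 * ‖w - v‖) ≤ 2 * (4 * b.M ^ 7 * ‖w - v‖) := by gcongr
    linarith
  have n5 : ‖b.F (b.Φ x + ε • W) - b.F (b.Φ y + ε • W') - b.DF (b.Φ h + ε • (W - W'))‖
      ≤ K * (63 * b.M ^ 11 * (t * ‖h‖) + 12 * b.M ^ 6 * ‖w - v‖) := by
    refine hF1.trans ((mul_le_mul_of_nonneg_left hF2 (by positivity)).trans ?_)
    have h5 : K * (b.M ^ 6 * (t * ‖w - v‖)) ≤ K * (b.M ^ 6 * (2 * ‖w - v‖)) := by gcongr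
    linarith
  have n6 : ‖b.DF (ε • (W - W'))‖ ≤ 10 * b.M ^ 6 * (t * ‖h‖) + 2 * b.M * ‖w - v‖ := by
    have h1 := b.norm_DF_le hεW
    have h5 : b.M * (t * ‖w - v‖) ≤ b.M * (2 * ‖w - v‖) := by gcongr
    linarith
  rw [e]
  refine ((norm_add_le _ _).trans (add_le_add ((norm_add_le _ _).trans (add_le_add
    ((norm_add_le _ _).trans (add_le_add norm_add₃_le n4)) n5)) n6)).trans ?_
  have pw : ∀ k, k ≤ 12 → b.M ^ k ≤ b.M ^ 12 := fun k hk => pow_le_pow_right₀ hM hk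
  have a1 : b.M ^ 7 * (t * ‖h‖) ≤ b.M ^ 12 * (t * ‖h‖) := by gcongr; norm_num
  have a2 : b.M ^ 6 * (t * ‖h‖) ≤ b.M ^ 12 * (t * ‖h‖) := by gcongr; norm_num
  have a3 : b.M ^ 11 * (t * ‖h‖) ≤ b.M ^ 12 * (t * ‖h‖) := by gcongr; norm_num
  have a4 : b.M ^ 3 * ‖w - v‖ ≤ b.M ^ 12 * ‖w - v‖ := by gcongr; norm_num
  have a5 : b.M ^ 7 * ‖w - v‖ ≤ b.M ^ 12 * ‖w - v‖ := by gcongr; norm_num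
  have a6 : b.M ^ 6 * ‖w - v‖ ≤ b.M ^ 12 * ‖w - v‖ := by gcongr; norm_num
  have a7 : b.M ^ 1 * ‖w - v‖ ≤ b.M ^ 12 * ‖w - v‖ := by gcongr; norm_num
  have a8 := mul_le_mul_of_nonneg_left a3 hK0
  have a9 := mul_le_mul_of_nonneg_left a6 hK0
  have b1 : 0 ≤ b.M ^ 12 * (t * ‖h‖) := by positivity
  have b2 : 0 ≤ b.M ^ 12 * ‖w - v‖ := by positivity
  have b3 : 0 ≤ K * (b.M ^ 12 * (t * ‖h‖)) := by positivity
  have b4 : 0 ≤ K * (b.M ^ 12 * ‖w - v‖) := by positivity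
  linarith

theorem norm_nonlin_sub_limit_le (b : Bifurcation Y X) : ∃ C, 0 ≤ C ∧
    ∀ (R : X →L[ℝ] X) (ε : ℝ) (v : X), b.IsClose R ε → 0 ≤ ε → ε ≤ 1 → ‖v‖ ≤ 1 →
      ‖b.nonlin R ε b.ξ₀ v - b.nonlin b.R₁ 0 b.ξ₀ 0‖ ≤ C * (ε + ‖v‖) := by
  obtain ⟨K, hK0, hK⟩ := b.F_lip (2 * b.M ^ 6)
  refine ⟨b.M ^ 13 * (20 + 4 * K), by have := b.one_le_M; positivity, ?_⟩
  intro R ε v hR hε0 hε1 hv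
  have hM := b.one_le_M
  set W := b.second R b.ξ₀ + v with hW
  have hξ : ‖b.ξ₀‖ ≤ b.M := by linarith [b.ξ₀_le]
  have hv0 := norm_nonneg v
  have hWn : ‖W‖ ≤ 2 * b.M ^ 6 := norm_second_add_le hR (r := 1) (by simp) hv le_rfl
  have hW0 : ‖W - b.second b.R₁ b.ξ₀‖ ≤ 4 * b.M ^ 5 * (ε + ‖v‖) :=
    norm_second_add_sub_le hR (r := 0) (by simp) (by linarith) zero_le_one (by positivity) hε0
      (by linarith)
  have hεW : ‖ε • W‖ ≤ ε * (2 * b.M ^ 6) := by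
    rw [norm_smul, Real.norm_of_nonneg hε0]
    gcongr
  have e : b.nonlin R ε b.ξ₀ v - b.nonlin b.R₁ 0 b.ξ₀ 0
      = (2 : ℝ) • b.B (b.Φ b.ξ₀) (W - b.second b.R₁ b.ξ₀) + ε • b.B W W
        + (b.F (b.Φ b.ξ₀ + ε • W) - b.F (b.Φ b.ξ₀) - b.DF (ε • W)) + b.DF (ε • W) := by
    simp only [nonlin, ← hW, zero_smul, add_zero, map_sub, smul_sub]
    abel
  have n1 : ‖(2 : ℝ) • b.B (b.Φ b.ξ₀) (W - b.second b.R₁ b.ξ₀)‖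
      ≤ 8 * b.M ^ 8 * (ε + ‖v‖) := by
    rw [norm_smul, Real.norm_two]
    have := b.norm_B_le (b.norm_Φ_le hξ) hW0
    linarith
  have n2 : ‖ε • b.B W W‖ ≤ 4 * b.M ^ 13 * ε := by
    rw [norm_smul, Real.norm_of_nonneg hε0]
    have := mul_le_mul_of_nonneg_left (b.norm_B_le hWn hWn) hε0
    linarith
  have n3 : ‖b.F (b.Φ b.ξ₀ + ε • W) - b.F (b.Φ b.ξ₀) - b.DF (ε • W)‖
      ≤ K * (4 * b.M ^ 12 * ε) := by
    have h1 := hK (2 * b.M ^ 6) le_rfl (b.Φ b.ξ₀ + ε • W) (b.Φ b.ξ₀) ?_ ?_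
    · rw [add_sub_cancel_left] at h1
      have := mul_le_mul_of_nonneg_left hεW (by positivity : 0 ≤ K * (2 * b.M ^ 6))
      linarith
    · rw [add_sub_cancel_left]
      exact hεW.trans (mul_le_of_le_one_left (by positivity) hε1)
    · rw [sub_self, norm_zero]
      positivity
  have n4 := b.norm_DF_le hεW
  rw [e]
  refine ((norm_add_le _ _).trans (add_le_add norm_add₃_le le_rfl)).trans ?_
  have a1 : b.M ^ 8 * (ε + ‖v‖) ≤ b.M ^ 13 * (ε + ‖v‖) := by gcongr; norm_num
  have a2 : b.M ^ 13 * ε ≤ b.M ^ 13 * (ε + ‖v‖) := by gcongr; linarith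
  have a3 : b.M ^ 12 * ε ≤ b.M ^ 13 * (ε + ‖v‖) := by gcongr <;> linarith
  have a4 : b.M ^ 7 * ε ≤ b.M ^ 13 * (ε + ‖v‖) := by gcongr <;> linarith
  have a5 := mul_le_mul_of_nonneg_left a3 hK0
  have b1 : 0 ≤ b.M ^ 13 * (ε + ‖v‖) := by positivity
  linarith

/-- A simplified Newton iteration. In the kernel component the derivative `1 - A lin` is frozen at
`ξ₀`; the range component is a plain Picard step, contracting because of its factor `ε`. The
constants do not depend on `R`, so all admissible frequencies are covered at once. -/
theorem exists_solution [CompleteSpace Y] [CompleteSpace X] (b : Bifurcation Y X) (e : Y ≃L[ℝ] Y)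
    (he : ∀ y, e y = y - b.A (b.lin y)) (hξ₀ : b.ξ₀ = b.A (b.nonlin b.R₁ 0 b.ξ₀ 0)) :
    ∃ ε₀ > 0, ∃ K, ∀ ε, 0 < ε → ε < ε₀ → ∀ R, b.IsClose R ε → ∀ S : Set X, IsClosed S → 0 ∈ S →
      (∀ ξ w, ‖ξ - b.ξ₀‖ ≤ 1 → ‖w‖ ≤ 1 → w ∈ S → ε • R (b.nonlin R ε ξ w) ∈ S) →
      ∃ ξ w, w ∈ S ∧ ‖w‖ ≤ 1 ∧ ‖ξ - b.ξ₀‖ ≤ 1 ∧ ‖ξ - b.ξ₀‖ ≤ K * ε ∧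
        ξ = b.A (b.nonlin R ε ξ w) ∧ w = ε • R (b.nonlin R ε ξ w) := by
  obtain ⟨C, hC0, hC⟩ := b.norm_nonlin_sub_le
  obtain ⟨C₂, hC₂0, hC₂⟩ := b.norm_nonlin_sub_limit_le
  have hM := b.one_le_M
  set n₀ := b.nonlin b.R₁ 0 b.ξ₀ 0 with hn₀
  set a := ‖(e.symm : Y →L[ℝ] Y)‖ * ‖b.A‖ with ha
  have ha0 : 0 ≤ a := by positivity
  have hA : ∀ x : X, ‖e.symm (b.A x)‖ ≤ a * ‖x‖ := fun x => by
    have h1 := (e.symm : Y →L[ℝ] Y).le_opNorm (b.A x)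
    refine h1.trans ?_
    rw [ha, mul_assoc]
    exact mul_le_mul_of_nonneg_left (b.A.le_opNorm x) (norm_nonneg _)
  set c₁ := b.M * (3 * C + ‖b.lin‖) with hc₁
  set c₂ := b.M * (‖n₀‖ + C₂) with hc₂
  set c₃ := c₂ + a * (C₂ * (1 + c₂)) with hc₃
  have hc₁0 : 0 ≤ c₁ := by positivity
  have hc₂0 : 0 ≤ c₂ := by positivity
  have hc₃0 : 0 ≤ c₃ := by positivity
  -- The contraction constant of the kernel component is `a C r` plus a multiple of `ε`; each of the
  -- two parts is kept below `1 / 4`. The constant `D` below collects all the smallness conditions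
  -- on `ε`.
  obtain ⟨r, hr0, hr1, hr⟩ : ∃ r : ℝ, 0 < r ∧ r ≤ 1 ∧ a * C * r ≤ 1 / 4 := by
    refine ⟨1 / (4 * (a * C + 1)), by positivity, ?_, ?_⟩
    · rw [div_le_one (by positivity)]
      nlinarith [mul_nonneg ha0 hC0]
    · rw [mul_one_div, div_le_div_iff₀ (by positivity) (by norm_num)]
      nlinarith [mul_nonneg ha0 hC0]
  set D := 4 * (a * C * (1 + 2 * c₁) + 2 * c₁ + c₂ + c₃ + 1) with hD
  have haC : 0 ≤ a * C * (1 + 2 * c₁) := by positivity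
  have hD0 : 0 < D := by positivity
  refine ⟨r / D, by positivity, 2 * c₃, ?_⟩
  intro ε hε0 hεD R hR S hS h0S hmaps
  rw [lt_div_iff₀ hD0] at hεD
  have hexp : ε * D = 4 * (a * C * (1 + 2 * c₁) * ε) + 8 * (c₁ * ε) + 4 * (c₂ * ε)
      + 4 * (c₃ * ε) + 4 * ε := by
    rw [hD]
    ring
  have q1 : 0 ≤ a * C * (1 + 2 * c₁) * ε := by positivity
  have q2 : 0 ≤ c₁ * ε := by positivity
  have q3 : 0 ≤ c₂ * ε := by positivity
  have q4 : 0 ≤ c₃ * ε := by positivity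
  have hε1 : ε ≤ 1 := by linarith
  have hb1 : a * C * (1 + 2 * c₁) * ε ≤ 1 / 4 := by linarith
  have hb2 : 2 * c₁ * ε ≤ 1 / 2 := by linarith
  have hb3 : c₂ * ε ≤ 1 := by linarith
  have hb4 : c₃ * ε ≤ r / 2 := by linarith
  set V : Y → X → X := fun ξ w => ε • R (b.nonlin R ε ξ w) with hV
  -- The kernel component is evaluated at the already updated `V p.1 p.2` instead of `p.2`. Its
  -- dependence on `w` then carries the factor `ε` contained in `V`, whereas the bare Lipschitz
  -- constant in `w` need not be small.
  set f : Y × X → Y × X := fun p =>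
    (p.1 + e.symm (b.A (b.nonlin R ε p.1 (V p.1 p.2)) - p.1), V p.1 p.2) with hf
  have hVnorm : ‖V b.ξ₀ 0‖ ≤ c₂ * ε := by
    have h1 := hC₂ R ε 0 hR hε0.le hε1 (by simp)
    rw [norm_zero, add_zero] at h1
    have h2 : ‖b.nonlin R ε b.ξ₀ 0‖ ≤ ‖n₀‖ + C₂ := by
      have h3 := norm_add_le (b.nonlin R ε b.ξ₀ 0 - n₀) n₀
      rw [sub_add_cancel] at h3
      have h4 := mul_le_mul_of_nonneg_left hε1 hC₂0
      linarith
    simp only [hV]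
    rw [norm_smul, Real.norm_of_nonneg hε0.le]
    have := mul_le_mul_of_nonneg_left (hR.norm_le h2) hε0.le
    linarith
  have hVlip : ∀ x y w v, ‖x - b.ξ₀‖ ≤ r → ‖y - b.ξ₀‖ ≤ r → ‖w‖ ≤ r → ‖v‖ ≤ r →
      ‖V x w - V y v‖ ≤ c₁ * ε * (‖x - y‖ + ‖w - v‖) := by
    intro x y w v hx hy hw hv
    have h1 := hC R ε r x y w v hR hε0.le hε1 hr1 hx hy hw hv
    have h2 := b.lin.le_opNorm (x - y)
    have h3 : ‖b.nonlin R ε x w - b.nonlin R ε y v‖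
        ≤ (3 * C + ‖b.lin‖) * (‖x - y‖ + ‖w - v‖) := by
      have h4 := norm_add_le (b.nonlin R ε x w - b.nonlin R ε y v - b.lin (x - y)) (b.lin (x - y))
      rw [sub_add_cancel] at h4
      have h5 : C * ((r + ε) * ‖x - y‖) ≤ C * (2 * ‖x - y‖) := by
        gcongr
        linarith
      have p1 := mul_nonneg hC0 (norm_nonneg (x - y))
      have p2 := mul_nonneg hC0 (norm_nonneg (w - v))
      have p3 := mul_nonneg (norm_nonneg b.lin) (norm_nonneg (w - v))
      linarith
    have h6 : V x w - V y v = ε • R (b.nonlin R ε x w - b.nonlin R ε y v) := by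
      simp only [hV, map_sub, smul_sub]
    rw [h6, norm_smul, Real.norm_of_nonneg hε0.le]
    have := mul_le_mul_of_nonneg_left (hR.norm_le h3) hε0.le
    linarith
  have hVr : ∀ x w, ‖x - b.ξ₀‖ ≤ r → ‖w‖ ≤ r → ‖V x w‖ ≤ r := by
    intro x w hx hw
    have h1 := hVlip x b.ξ₀ w 0 hx (by simpa using hr0.le) hw (by simpa using hr0.le)
    have h2 := norm_add_le (V x w - V b.ξ₀ 0) (V b.ξ₀ 0)
    rw [sub_add_cancel] at h2
    rw [sub_zero] at h1
    have h3 : c₁ * ε * (‖x - b.ξ₀‖ + ‖w‖) ≤ c₁ * ε * (r + r) := by gcongr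
    have h4 : c₂ * ε ≤ r / 2 := by
      refine le_trans ?_ hb4
      gcongr
      rw [hc₃]
      exact le_add_of_nonneg_right (by positivity)
    have h5 := mul_le_mul_of_nonneg_right hb2 hr0.le
    linarith
  have hdist : ∀ p q : Y × X, dist p q = max ‖p.1 - q.1‖ ‖p.2 - q.2‖ := fun p q => by
    rw [Prod.dist_eq, dist_eq_norm, dist_eq_norm]
  have hmaps' : ∀ p ∈ Prod.snd ⁻¹' S, dist p (b.ξ₀, (0 : X)) ≤ r → f p ∈ Prod.snd ⁻¹' S := by
    rintro ⟨x, w⟩ hw hxw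
    rw [hdist, max_le_iff, sub_zero] at hxw
    exact hmaps x w (hxw.1.trans hr1) (hxw.2.trans hr1) hw
  have hfst : ∀ x y w v, ‖x - b.ξ₀‖ ≤ r → ‖y - b.ξ₀‖ ≤ r → ‖w‖ ≤ r → ‖v‖ ≤ r → ∀ d,
      ‖x - y‖ ≤ d → ‖w - v‖ ≤ d → ‖(f (x, w)).1 - (f (y, v)).1‖ ≤ 1 / 2 * d := by
    intro x y w v hx hy hw hv d hd1 hd2
    have hd0 : 0 ≤ d := (norm_nonneg _).trans hd1
    have h1 := hVlip x y w v hx hy hw hv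
    have h2 : c₁ * ε * (‖x - y‖ + ‖w - v‖) ≤ c₁ * ε * (d + d) := by gcongr
    have h3 := hC R ε r x y (V x w) (V y v) hR hε0.le hε1 hr1 hx hy (hVr x w hx hw)
      (hVr y v hy hv)
    have e1 : (f (x, w)).1 - (f (y, v)).1 = e.symm (b.A (b.nonlin R ε x (V x w)
        - b.nonlin R ε y (V y v) - b.lin (x - y))) := by
      -- This rewriting cancels the linear part, so only the remainder estimated in
      -- `norm_nonlin_sub_le` is left.
      have e2 : x - y = e.symm (x - y - b.A (b.lin (x - y))) := by
        rw [← he, e.symm_apply_apply]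
      have e3 : (f (x, w)).1 - (f (y, v)).1
          = (x - y) + e.symm (b.A (b.nonlin R ε x (V x w)) - b.A (b.nonlin R ε y (V y v))
            - (x - y)) := by
        simp only [hf, map_sub]
        abel
      have e4 : b.A (b.nonlin R ε x (V x w) - b.nonlin R ε y (V y v) - b.lin (x - y))
          = (x - y - b.A (b.lin (x - y))) + (b.A (b.nonlin R ε x (V x w))
            - b.A (b.nonlin R ε y (V y v)) - (x - y)) := by
        rw [map_sub b.A, map_sub b.A]
        abel
      rw [e3, e4, map_add, ← e2]
    rw [e1]
    refine (hA _).trans ((mul_le_mul_of_nonneg_left h3 ha0).trans ?_)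
    have h4 : (r + ε) * ‖x - y‖ + ‖V x w - V y v‖ ≤ (r + ε) * d + c₁ * ε * (d + d) := by
      gcongr
      exact h1.trans h2
    have h5 := mul_le_mul_of_nonneg_left h4 (mul_nonneg ha0 hC0)
    have h6 := mul_le_mul_of_nonneg_right hr hd0
    have h7 := mul_le_mul_of_nonneg_right hb1 hd0
    linarith
  have hlip' : ∀ p ∈ Prod.snd ⁻¹' S, ∀ q ∈ Prod.snd ⁻¹' S, dist p (b.ξ₀, (0 : X)) ≤ r →
      dist q (b.ξ₀, (0 : X)) ≤ r → dist (f p) (f q) ≤ 1 / 2 * dist p q := by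
    rintro ⟨x, w⟩ - ⟨y, v⟩ - hxw hyv
    rw [hdist, max_le_iff, sub_zero] at hxw hyv
    have hd1 : ‖x - y‖ ≤ dist (x, w) (y, v) := by
      rw [hdist]
      exact le_max_left _ _
    have hd2 : ‖w - v‖ ≤ dist (x, w) (y, v) := by
      rw [hdist]
      exact le_max_right _ _
    have h1 := hVlip x y w v hxw.1 hyv.1 hxw.2 hyv.2
    have h2 := hfst x y w v hxw.1 hyv.1 hxw.2 hyv.2 _ hd1 hd2
    generalize dist (x, w) (y, v) = d at *
    have hd0 : 0 ≤ d := (norm_nonneg _).trans hd1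
    rw [hdist, max_le_iff]
    refine ⟨h2, h1.trans ?_⟩
    have h3 : c₁ * ε * (‖x - y‖ + ‖w - v‖) ≤ c₁ * ε * (d + d) := by gcongr
    have h7 := mul_le_mul_of_nonneg_right hb2 hd0
    linarith
  have hdisp : dist (f (b.ξ₀, 0)) (b.ξ₀, (0 : X)) ≤ c₃ * ε := by
    rw [hdist, max_le_iff]
    have h1 := hC₂ R ε (V b.ξ₀ 0) hR hε0.le hε1 (hVnorm.trans hb3)
    constructor
    · have e1 : (f (b.ξ₀, 0)).1 - b.ξ₀
          = e.symm (b.A (b.nonlin R ε b.ξ₀ (V b.ξ₀ 0) - n₀)) := by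
        simp only [hf]
        rw [add_sub_cancel_left, map_sub b.A, ← hξ₀]
      rw [e1]
      refine (hA _).trans ?_
      have h2 : C₂ * (ε + ‖V b.ξ₀ 0‖) ≤ C₂ * (ε + c₂ * ε) := by gcongr
      have h3 := mul_le_mul_of_nonneg_left (h1.trans h2) ha0
      have h4 : 0 ≤ c₂ * ε := by positivity
      rw [hc₃]
      linarith
    · rw [sub_zero]
      refine hVnorm.trans ?_
      gcongr
      rw [hc₃]
      exact le_add_of_nonneg_right (by positivity)
  obtain ⟨⟨ξ, w⟩, hxS, hx2, hxr, hfx⟩ := exists_fixedPoint_of_half_lipschitz (f := f)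
    (c := (b.ξ₀, (0 : X))) (S := Prod.snd ⁻¹' S) (hS.preimage continuous_snd) h0S hr0.le hmaps'
    hlip' (hdisp.trans hb4)
  rw [hdist, max_le_iff, sub_zero] at hxr
  have hw : V ξ w = w := congrArg Prod.snd hfx
  have hξ : ξ + e.symm (b.A (b.nonlin R ε ξ (V ξ w)) - ξ) = ξ := congrArg Prod.fst hfx
  rw [hw, add_eq_left, map_eq_zero_iff e.symm e.symm.injective, sub_eq_zero] at hξ
  refine ⟨ξ, w, hxS, hxr.2.trans hr1, hxr.1.trans hr1, ?_, hξ.symm, hw.symm⟩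
  have h1 : ‖ξ - b.ξ₀‖ ≤ dist (ξ, w) (b.ξ₀, (0 : X)) := by
    rw [hdist]
    exact le_max_left _ _
  linarith

end Bifurcation

/-! ### Fourier series of even periodic functions -/

theorem hasSum_intervalIntegral_mul {ι : Type*} [Countable ι] {c : ι → ℝ} (hc : Summable c)
    {φ : ι → ℝ → ℝ} (hφ : ∀ i, Continuous (φ i)) (hφ1 : ∀ i t, |φ i t| ≤ 1) {ψ : ℝ → ℝ}
    (hψ : Continuous ψ) (a b : ℝ) :
    HasSum (fun i => c i * ∫ t in a..b, φ i t * ψ t)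
      (∫ t in a..b, (∑' i, c i * φ i t) * ψ t) := by
  have hs : ∀ t, Summable fun i => c i * φ i t := fun t =>
    Summable.of_norm_bounded hc.abs fun i => by
      rw [Real.norm_eq_abs, abs_mul]
      exact mul_le_of_le_one_right (abs_nonneg _) (hφ1 i t)
  have h := intervalIntegral.hasSum_integral_of_dominated_convergence (μ := volume) (a := a)
    (b := b) (F := fun i t => c i * (φ i t * ψ t)) (f := fun t => (∑' i, c i * φ i t) * ψ t)
    (fun i t => |c i| * |ψ t|) (fun i => ?_) (fun i => ?_) ?_ ?_ ?_
  · simpa only [intervalIntegral.integral_const_mul] using h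
  · exact (continuous_const.mul ((hφ i).mul hψ)).aestronglyMeasurable
  · refine Eventually.of_forall fun t _ => ?_
    rw [Real.norm_eq_abs, abs_mul, abs_mul]
    gcongr
    exact mul_le_of_le_one_left (abs_nonneg _) (hφ1 i t)
  · exact Eventually.of_forall fun t _ => hc.abs.mul_right _
  · simp_rw [tsum_mul_right]
    exact (continuous_const.mul hψ.abs).intervalIntegrable _ _
  · refine Eventually.of_forall fun t _ => ?_
    simpa only [mul_assoc] using (hs t).hasSum.mul_right (ψ t)

theorem continuous_tsum_mul {ι : Type*} {c : ι → ℝ} (hc : Summable c)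
    {φ : ι → ℝ → ℝ} (hφ : ∀ i, Continuous (φ i)) (hφ1 : ∀ i t, |φ i t| ≤ 1) :
    Continuous fun t => ∑' i, c i * φ i t :=
  continuous_tsum (fun i => continuous_const.mul (hφ i)) hc.abs fun i t => by
    rw [Real.norm_eq_abs, abs_mul]
    exact mul_le_of_le_one_right (abs_nonneg _) (hφ1 i t)

theorem continuous_cos_int_mul (l : ℤ) : Continuous fun t : ℝ => Real.cos (l * t) := by fun_prop

theorem continuous_sin_int_mul (l : ℤ) : Continuous fun t : ℝ => Real.sin (l * t) := by fun_prop

/-- The coefficients of the cosine series. -/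
def cosCoeff (g : ℝ → ℝ) (l : ℤ) : ℝ := (2 * π)⁻¹ * ∫ t in (0 : ℝ)..(2 * π), Real.cos (l * t) * g t

theorem sin_int_mul_two_pi (l : ℤ) : Real.sin (l * (2 * π)) = 0 := by
  have := Real.sin_int_mul_pi (l * 2)
  push_cast at this
  rw [← this]
  ring_nf

theorem cos_int_mul_periodic (l : ℤ) : Function.Periodic (fun t : ℝ => Real.cos (l * t)) (2 * π) := by
  intro t
  have := Real.cos_add_int_mul_two_pi (l * t) l
  rw [← mul_add] at this
  exact this

theorem sin_int_mul_periodic (l : ℤ) : Function.Periodic (fun t : ℝ => Real.sin (l * t)) (2 * π) := by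
  intro t
  have := Real.sin_add_int_mul_two_pi (l * t) l
  rw [← mul_add] at this
  exact this

theorem integral_cos_int_mul (l : ℤ) :
    (2 * π)⁻¹ * ∫ t in (0 : ℝ)..(2 * π), Real.cos (l * t) = if l = 0 then 1 else 0 := by
  have hpi := Real.pi_pos
  split_ifs with h
  · simp [h]
    field_simp
  · have hl : (l : ℝ) ≠ 0 := by exact_mod_cast h
    rw [intervalIntegral.integral_comp_mul_left _ hl, integral_cos, sin_int_mul_two_pi]
    simp

theorem integral_cos_mul_cos (k l : ℤ) :
    (2 * π)⁻¹ * ∫ t in (0 : ℝ)..(2 * π), Real.cos (k * t) * Real.cos (l * t)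
      = ((if k + l = 0 then 1 else 0) + if k - l = 0 then 1 else 0) / 2 := by
  have h : ∀ t : ℝ, Real.cos (k * t) * Real.cos (l * t)
      = (1 / 2) * (Real.cos ((k + l : ℤ) * t) + Real.cos ((k - l : ℤ) * t)) := fun t => by
    push_cast
    rw [add_mul, sub_mul, Real.cos_add, Real.cos_sub]
    ring
  simp_rw [h]
  rw [intervalIntegral.integral_const_mul, intervalIntegral.integral_add, ← integral_cos_int_mul,
    ← integral_cos_int_mul]
  · ring
  · exact (continuous_cos_int_mul _).intervalIntegrable _ _
  · exact (continuous_cos_int_mul _).intervalIntegrable _ _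

theorem integral_cos_mul_of_hasDerivAt {f f' : ℝ → ℝ} (hf : ∀ t, HasDerivAt f (f' t) t)
    (hf' : Continuous f') {l : ℤ} (hl : l ≠ 0) :
    ∫ t in (0 : ℝ)..(2 * π), Real.cos (l * t) * f t
      = -(1 / l) * ∫ t in (0 : ℝ)..(2 * π), Real.sin (l * t) * f' t := by
  have hl' : (l : ℝ) ≠ 0 := by exact_mod_cast hl
  have hfc : Continuous f := continuous_iff_continuousAt.2 fun t => (hf t).continuousAt
  have hd : ∀ t ∈ uIcc 0 (2 * π), HasDerivAt (fun t => 1 / l * Real.sin (l * t) * f t)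
      (Real.cos (l * t) * f t + 1 / l * (Real.sin (l * t) * f' t)) t := by
    intro t _
    have h1 : HasDerivAt (fun t : ℝ => Real.sin (l * t)) (Real.cos (l * t) * l) t := by
      simpa using ((hasDerivAt_id t).const_mul (l : ℝ)).sin
    refine ((h1.const_mul (1 / (l : ℝ))).mul (hf t)).congr_deriv ?_
    field_simp
  have h := intervalIntegral.integral_eq_sub_of_hasDerivAt hd
    (Continuous.intervalIntegrable (by fun_prop) _ _)
  rw [intervalIntegral.integral_add (Continuous.intervalIntegrable (by fun_prop) _ _)
    (Continuous.intervalIntegrable (by fun_prop) _ _), intervalIntegral.integral_const_mul,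
    sin_int_mul_two_pi] at h
  simp only [mul_zero, Real.sin_zero, zero_mul, sub_zero] at h
  linarith

theorem integral_sin_mul_of_hasDerivAt {f f' : ℝ → ℝ} (hf : ∀ t, HasDerivAt f (f' t) t)
    (hf' : Continuous f') (hper : f (2 * π) = f 0) {l : ℤ} (hl : l ≠ 0) :
    ∫ t in (0 : ℝ)..(2 * π), Real.sin (l * t) * f t
      = (1 / l) * ∫ t in (0 : ℝ)..(2 * π), Real.cos (l * t) * f' t := by
  have hl' : (l : ℝ) ≠ 0 := by exact_mod_cast hl
  have hfc : Continuous f := continuous_iff_continuousAt.2 fun t => (hf t).continuousAt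
  have hd : ∀ t ∈ uIcc 0 (2 * π), HasDerivAt (fun t => -(1 / l * Real.cos (l * t) * f t))
      (Real.sin (l * t) * f t - 1 / l * (Real.cos (l * t) * f' t)) t := by
    intro t _
    have h1 : HasDerivAt (fun t : ℝ => Real.cos (l * t)) (-Real.sin (l * t) * l) t := by
      simpa only [mul_one, id_eq] using ((hasDerivAt_id t).const_mul (l : ℝ)).cos
    refine ((h1.const_mul (1 / (l : ℝ))).mul (hf t)).neg.congr_deriv ?_
    field_simp
    ring
  have h := intervalIntegral.integral_eq_sub_of_hasDerivAt hd
    (Continuous.intervalIntegrable (by fun_prop) _ _)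
  have hc : Real.cos (l * (2 * π)) = 1 := by
    simpa only [zero_add, mul_zero, Real.cos_zero] using cos_int_mul_periodic l 0
  rw [intervalIntegral.integral_sub (Continuous.intervalIntegrable (by fun_prop) _ _)
    (Continuous.intervalIntegrable (by fun_prop) _ _), intervalIntegral.integral_const_mul,
    hc, hper] at h
  simp only [mul_zero, Real.cos_zero] at h
  linarith

theorem integral_eq_zero_of_odd_of_periodic {f : ℝ → ℝ} (hodd : ∀ t, f (-t) = -f t)
    (hper : Function.Periodic f (2 * π)) : ∫ t in (0 : ℝ)..(2 * π), f t = 0 := by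
  have h1 := hper.intervalIntegral_add_eq 0 (-π)
  have h2 : -π + 2 * π = π := by ring
  rw [zero_add, h2] at h1
  have h3 := intervalIntegral.integral_comp_neg (a := -π) (b := π) f
  simp only [hodd, intervalIntegral.integral_neg, neg_neg] at h3
  rw [h1]
  linarith

/-- An even periodic continuous function without nonconstant Fourier modes is constant. -/
theorem eq_of_integral_cos_mul_eq_zero {f : ℝ → ℝ} (hf : Continuous f) (heven : ∀ t, f (-t) = f t)
    (hper : Function.Periodic f (2 * π))
    (h : ∀ l : ℤ, l ≠ 0 → ∫ t in (0 : ℝ)..(2 * π), Real.cos (l * t) * f t = 0) (t : ℝ) :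
    f t = f 0 := by
  have : Fact (0 < 2 * π) := ⟨Real.two_pi_pos⟩
  have hperC : Function.Periodic (fun t => (f t : ℂ)) (2 * π) := fun t => by
    simp only [hper t]
  have hcont : Continuous hperC.lift :=
    Continuous.quotient_lift (Complex.continuous_ofReal.comp hf) _
  set F : C(AddCircle (2 * π), ℂ) := ⟨hperC.lift, hcont⟩ with hF
  have hsin : ∀ l : ℤ, ∫ t in (0 : ℝ)..(2 * π), Real.sin (l * t) * f t = 0 := fun l =>
    integral_eq_zero_of_odd_of_periodic
      (fun t => by rw [heven, mul_neg, Real.sin_neg, neg_mul])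
      ((sin_int_mul_periodic l).mul hper)
  have hcoef : ∀ l : ℤ, l ≠ 0 → fourierCoeff F l = 0 := by
    intro l hl
    rw [fourierCoeff_eq_intervalIntegral _ l 0, zero_add]
    have e : ∀ t : ℝ, fourier (-l) (t : AddCircle (2 * π)) • F t
        = ((Real.cos (l * t) * f t : ℝ) : ℂ) - Complex.I * ((Real.sin (l * t) * f t : ℝ) : ℂ) := by
      intro t
      rw [fourier_coe_apply, smul_eq_mul]
      have e1 : F (t : AddCircle (2 * π)) = f t := rfl
      have e2 : 2 * (π : ℂ) * Complex.I * ((-l : ℤ) : ℂ) * t / ((2 * π : ℝ) : ℂ)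
          = ((-(l * t) : ℝ) : ℂ) * Complex.I := by
        have : (π : ℂ) ≠ 0 := by exact_mod_cast Real.pi_ne_zero
        push_cast
        field_simp
      rw [e1, e2, Complex.exp_mul_I, ← Complex.ofReal_cos, ← Complex.ofReal_sin, Real.cos_neg,
        Real.sin_neg]
      push_cast
      ring
    simp_rw [e]
    rw [intervalIntegral.integral_sub, intervalIntegral.integral_const_mul,
      intervalIntegral.integral_ofReal, intervalIntegral.integral_ofReal, h l hl, hsin l]
    · simp
    · exact Continuous.intervalIntegrable (by fun_prop) _ _
    · exact Continuous.intervalIntegrable (by fun_prop) _ _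
  have hsum : HasSum (fourierCoeff F) (fourierCoeff F 0) :=
    hasSum_single 0 fun l hl => hcoef l hl
  have key : ∀ x : ℝ, (f x : ℂ) = fourierCoeff F 0 := by
    intro x
    have h1 := has_pointwise_sum_fourier_series_of_summable hsum.summable (x : AddCircle (2 * π))
    have h2 : HasSum (fun i => fourierCoeff F i • fourier i (x : AddCircle (2 * π)))
        (fourierCoeff F 0 • fourier 0 (x : AddCircle (2 * π))) :=
      hasSum_single 0 fun l hl => by rw [hcoef l hl, zero_smul]
    have h3 := h1.unique h2
    rw [fourier_zero, smul_eq_mul, mul_one] at h3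
    exact h3
  exact_mod_cast (key t).trans (key 0).symm

theorem cosCoeff_tsum {c : ℤ → ℝ} (hc : Summable c) (hsymm : ∀ l, c (-l) = c l) (k : ℤ) :
    cosCoeff (fun t => ∑' l : ℤ, c l * Real.cos (l * t)) k = c k := by
  have h := hasSum_intervalIntegral_mul hc (fun l => continuous_cos_int_mul l)
    (fun l t => Real.abs_cos_le_one _) (continuous_cos_int_mul k) 0 (2 * π)
  have h2 := h.mul_left ((2 * π)⁻¹)
  have e : ∀ l : ℤ, (2 * π)⁻¹ * (c l * ∫ t in (0 : ℝ)..(2 * π), Real.cos (l * t) * Real.cos (k * t))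
      = (if l = -k then c k / 2 else 0) + (if l = k then c k / 2 else 0) := by
    intro l
    rw [mul_left_comm, integral_cos_mul_cos]
    have i1 : l + k = 0 ↔ l = -k := by omega
    have i2 : l - k = 0 ↔ l = k := by omega
    simp only [i1, i2]
    split_ifs with h1 h2 h2
    · rw [← h2]; ring
    · rw [h1, hsymm]; ring
    · rw [h2]; ring
    · ring
  simp_rw [e] at h2
  have h3 : HasSum (fun l : ℤ => (if l = -k then c k / 2 else 0) + (if l = k then c k / 2 else 0))
      (c k / 2 + c k / 2) := (hasSum_ite_eq _ _).add (hasSum_ite_eq _ _)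
  rw [add_halves] at h3
  simp_rw [cosCoeff, mul_comm (Real.cos (k * _))]
  exact h2.unique h3

/-- Convolution of a cosine series with an even periodic function. -/
theorem conv_eq_tsum {m : ℤ → ℝ} (hm : Summable m) {g : ℝ → ℝ} (hg : Continuous g)
    (heven : ∀ t, g (-t) = g t) (hper : Function.Periodic g (2 * π)) (t : ℝ) :
    (2 * π)⁻¹ * ∫ τ in (0 : ℝ)..(2 * π), (∑' l : ℤ, m l * Real.cos (l * τ)) * g (t - τ)
      = ∑' l : ℤ, m l * cosCoeff g l * Real.cos (l * t) := by
  have h := (hasSum_intervalIntegral_mul hm (fun l => continuous_cos_int_mul l)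
    (fun l t => Real.abs_cos_le_one _) (ψ := fun τ => g (t - τ)) (by fun_prop) 0
    (2 * π)).mul_left ((2 * π)⁻¹)
  rw [← h.tsum_eq]
  congr 1
  funext l
  -- Substitution and periodicity move the shift onto the cosine; the sine part of the addition
  -- formula then integrates to zero because `g` is even.
  have e1 : ∫ τ in (0 : ℝ)..(2 * π), Real.cos (l * τ) * g (t - τ)
      = ∫ τ in (0 : ℝ)..(2 * π), Real.cos (l * (t - τ)) * g τ := by
    have h1 := intervalIntegral.integral_comp_sub_left (a := 0) (b := 2 * π)
      (fun τ => Real.cos (l * (t - τ)) * g τ) t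
    simp only [sub_sub_cancel, sub_zero] at h1
    rw [h1]
    have hp : Function.Periodic (fun τ => Real.cos (l * (t - τ)) * g τ) (2 * π) := by
      intro τ
      have h2 := cos_int_mul_periodic l (t - (τ + 2 * π))
      have h3 : t - (τ + 2 * π) + 2 * π = t - τ := by ring
      simp only [h3] at h2
      simp only
      rw [hper τ, h2]
    have h4 := hp.intervalIntegral_add_eq (t - 2 * π) 0
    rw [sub_add_cancel, zero_add] at h4
    exact h4
  have e2 : ∀ τ : ℝ, Real.cos (l * (t - τ)) * g τ
      = Real.cos (l * t) * (Real.cos (l * τ) * g τ)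
        + Real.sin (l * t) * (Real.sin (l * τ) * g τ) := fun τ => by
    rw [mul_sub, Real.cos_sub]
    ring
  have e3 : ∫ τ in (0 : ℝ)..(2 * π), Real.sin (l * τ) * g τ = 0 :=
    integral_eq_zero_of_odd_of_periodic
      (fun τ => by rw [heven, mul_neg, Real.sin_neg, neg_mul])
      ((sin_int_mul_periodic l).mul hper)
  rw [e1]
  simp_rw [e2]
  rw [intervalIntegral.integral_add (Continuous.intervalIntegrable (by fun_prop) _ _)
    (Continuous.intervalIntegrable (by fun_prop) _ _), intervalIntegral.integral_const_mul,
    intervalIntegral.integral_const_mul, e3, cosCoeff]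
  ring

theorem abs_cosCoeff_le {g : ℝ → ℝ} {C : ℝ} (hC : ∀ t, |g t| ≤ C) (l : ℤ) :
    |cosCoeff g l| ≤ C := by
  have h : ‖∫ t in (0 : ℝ)..(2 * π), Real.cos (l * t) * g t‖ ≤ C * |2 * π - 0| :=
    intervalIntegral.norm_integral_le_of_norm_le_const fun t _ => by
      rw [Real.norm_eq_abs, abs_mul]
      exact (mul_le_of_le_one_left (abs_nonneg _) (Real.abs_cos_le_one _)).trans (hC t)
  rw [sub_zero, abs_of_pos Real.two_pi_pos, Real.norm_eq_abs] at h
  rw [cosCoeff, abs_mul, abs_of_pos (by positivity), inv_mul_le_iff₀ Real.two_pi_pos]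
  linarith

/-- The series `∑ m l * ĝ l * cos (l t)`, where `m` inverts `n² + w² ∂²` off its kernel, is a
classical solution. -/
theorem hasDerivAt_of_multiplier {g : ℝ → ℝ} (hg : Continuous g)
    (heven : ∀ t, g (-t) = g t) (hper : Function.Periodic g (2 * π)) {C : ℝ}
    (hC : ∀ t, |g t| ≤ C) {n : ℕ} (hn : 0 < n) {w : ℝ} (hw : 0 < w) {m : ℤ → ℝ} (hm : Summable m)
    (hmn : m n = 0 ∧ m (-n) = 0)
    (hml : ∀ l : ℤ, l ≠ n → l ≠ -n → ((n : ℝ) ^ 2 - w ^ 2 * (l : ℝ) ^ 2) * m l = 1)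
    {W : ℝ → ℝ} (hW : ∀ t, W t = ∑' l : ℤ, m l * cosCoeff g l * Real.cos (l * t)) :
    ∃ W' h : ℝ → ℝ, Continuous h ∧ (∀ t, HasDerivAt W (W' t) t) ∧ (∀ t, HasDerivAt W' (h t) t) ∧
      ∀ t, w ^ 2 * h t + (n : ℝ) ^ 2 * W t = g t - 2 * cosCoeff g n * Real.cos (n * t) := by
  set c : ℤ → ℝ := fun l => m l * cosCoeff g l with hc
  have hcs : Summable c := Summable.of_norm_bounded (hm.abs.mul_right C) fun l => by
    rw [Real.norm_eq_abs, hc, abs_mul]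
    gcongr
    exact abs_cosCoeff_le hC l
  have hgsymm : ∀ l, cosCoeff g (-l) = cosCoeff g l := fun l => by
    simp [cosCoeff]
  have hmsymm : ∀ l, m (-l) = m l := by
    intro l
    by_cases h1 : l = n
    · rw [h1, hmn.1, hmn.2]
    by_cases h2 : l = -n
    · rw [h2, neg_neg, hmn.1, hmn.2]
    have h3 := hml l h1 h2
    have h4 := hml (-l) (by omega) (by omega)
    push_cast at h4
    rw [neg_sq] at h4
    have h5 : (n : ℝ) ^ 2 - w ^ 2 * (l : ℝ) ^ 2 ≠ 0 := by
      intro h0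
      rw [h0, zero_mul] at h3
      exact zero_ne_one h3
    exact mul_left_cancel₀ h5 (h4.trans h3.symm)
  have hcsymm : ∀ l, c (-l) = c l := fun l => by
    simp only [hc, hmsymm, hgsymm]
  have hWfun : W = fun t => ∑' l : ℤ, c l * Real.cos (l * t) := funext hW
  have hWc : Continuous W := by
    rw [hWfun]
    exact continuous_tsum_mul hcs (fun l => continuous_cos_int_mul l)
      fun l t => Real.abs_cos_le_one _
  have hWe : ∀ t, W (-t) = W t := fun t => by
    simp only [hW, mul_neg, Real.cos_neg]
  have hWp : Function.Periodic W (2 * π) := fun t => by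
    simp only [hW]
    congr 1
    funext l
    have := cos_int_mul_periodic l t
    simp only at this
    rw [this]
  have hWcoef : ∀ l, cosCoeff W l = c l := fun l => by
    rw [hWfun]
    exact cosCoeff_tsum hcs hcsymm l
  -- Since `g` is only continuous, differentiating the series of `W` term by term twice is not
  -- justified. The candidate second derivative is instead defined by the equation, and its Fourier
  -- coefficients turn out to be `-l² c l`.
  set h : ℝ → ℝ := fun t =>
    (g t - 2 * cosCoeff g n * Real.cos ((n : ℤ) * t) - (n : ℝ) ^ 2 * W t) / w ^ 2 with hh
  have hw2 : w ^ 2 ≠ 0 := by positivity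
  have hhc : Continuous h := by fun_prop
  have hhe : ∀ t, h (-t) = h t := fun t => by
    simp only [hh, heven, hWe, mul_neg, Real.cos_neg]
  have hhp : Function.Periodic h (2 * π) := fun t => by
    have := cos_int_mul_periodic n t
    simp only at this
    simp only [hh, hper t, hWp t, this]
  have hhcoef : ∀ l : ℤ, cosCoeff h l = -(l : ℝ) ^ 2 * c l := by
    intro l
    have e1 : cosCoeff h l = (cosCoeff g l - 2 * cosCoeff g n *
        (((if l + (n : ℤ) = 0 then 1 else 0) + if l - (n : ℤ) = 0 then 1 else 0) / 2)
        - (n : ℝ) ^ 2 * c l) / w ^ 2 := by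
      rw [← hWcoef, ← integral_cos_mul_cos]
      simp only [cosCoeff, hh]
      have e2 : ∀ t : ℝ, Real.cos (l * t) * ((g t - 2 * ((2 * π)⁻¹ * ∫ t in (0 : ℝ)..(2 * π),
          Real.cos ((n : ℤ) * t) * g t) * Real.cos ((n : ℤ) * t) - (n : ℝ) ^ 2 * W t) / w ^ 2)
          = 1 / w ^ 2 * (Real.cos (l * t) * g t) - (1 / w ^ 2 * (2 * ((2 * π)⁻¹ *
            ∫ t in (0 : ℝ)..(2 * π), Real.cos ((n : ℤ) * t) * g t))) *
            (Real.cos (l * t) * Real.cos ((n : ℤ) * t))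
            - (n : ℝ) ^ 2 / w ^ 2 * (Real.cos (l * t) * W t) := fun t => by
        field_simp
      simp_rw [e2]
      rw [intervalIntegral.integral_sub (Continuous.intervalIntegrable (by fun_prop) _ _)
        (Continuous.intervalIntegrable (by fun_prop) _ _),
        intervalIntegral.integral_sub (Continuous.intervalIntegrable (by fun_prop) _ _)
        (Continuous.intervalIntegrable (by fun_prop) _ _), intervalIntegral.integral_const_mul,
        intervalIntegral.integral_const_mul, intervalIntegral.integral_const_mul]
      field_simp
    rw [e1, div_eq_iff hw2]
    by_cases h1 : l = n
    · have i1 : ¬ (l + (n : ℤ) = 0) := by omega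
      have i2 : l - (n : ℤ) = 0 := by omega
      rw [if_neg i1, if_pos i2]
      simp only [hc, h1, hmn.1]
      ring
    by_cases h2 : l = -n
    · have i1 : l + (n : ℤ) = 0 := by omega
      have i2 : ¬ (l - (n : ℤ) = 0) := by omega
      rw [if_pos i1, if_neg i2]
      simp only [hc, h2, hmn.2, hgsymm]
      ring
    · have i1 : ¬ (l + (n : ℤ) = 0) := by omega
      have i2 : ¬ (l - (n : ℤ) = 0) := by omega
      rw [if_neg i1, if_neg i2]
      simp only [hc]
      linear_combination (-cosCoeff g l) * hml l h1 h2
  set H : ℝ → ℝ := fun t => ∫ s in (0 : ℝ)..t, h s with hH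
  have hHd : ∀ t, HasDerivAt H (h t) t := fun t =>
    intervalIntegral.integral_hasDerivAt_right (hhc.intervalIntegrable _ _)
      (hhc.stronglyMeasurableAtFilter _ _) hhc.continuousAt
  have hHc : Continuous H := continuous_iff_continuousAt.2 fun t => (hHd t).continuousAt
  -- The zero mode `l = 0` of `h` vanishes, so the primitive `H` is periodic. As `H` is odd, its own
  -- primitive is periodic too.
  have hh0 : ∫ s in (0 : ℝ)..(2 * π), h s = 0 := by
    have h1 := hhcoef 0
    rw [cosCoeff] at h1
    simp only [Int.cast_zero, zero_mul, Real.cos_zero, one_mul] at h1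
    have h2 : (2 * π)⁻¹ ≠ 0 := by positivity
    rw [sq, zero_mul, neg_zero, zero_mul] at h1
    exact (mul_eq_zero.1 h1).resolve_left h2
  have hHp : Function.Periodic H (2 * π) := by
    intro t
    simp only [hH]
    rw [← intervalIntegral.integral_add_adjacent_intervals (b := t)
      (hhc.intervalIntegrable _ _) (hhc.intervalIntegrable _ _),
      hhp.intervalIntegral_add_eq t 0, zero_add, hh0, add_zero]
  have hHo : ∀ t, H (-t) = -H t := by
    intro t
    simp only [hH]
    have h1 := intervalIntegral.integral_comp_neg (a := 0) (b := t) h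
    simp only [hhe, neg_zero] at h1
    rw [h1]
    exact intervalIntegral.integral_symm _ _
  set P : ℝ → ℝ := fun t => W 0 + ∫ s in (0 : ℝ)..t, H s with hP
  have hPd : ∀ t, HasDerivAt P (H t) t := fun t =>
    (intervalIntegral.integral_hasDerivAt_right (hHc.intervalIntegrable _ _)
      (hHc.stronglyMeasurableAtFilter _ _) hHc.continuousAt).const_add _
  have hPc : Continuous P := continuous_iff_continuousAt.2 fun t => (hPd t).continuousAt
  have hPp : Function.Periodic P (2 * π) := by
    intro t
    simp only [hP]
    rw [← intervalIntegral.integral_add_adjacent_intervals (b := t)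
      (hHc.intervalIntegrable _ _) (hHc.intervalIntegrable _ _),
      hHp.intervalIntegral_add_eq t 0, zero_add, integral_eq_zero_of_odd_of_periodic hHo hHp,
      add_zero]
  have hPe : ∀ t, P (-t) = P t := by
    intro t
    simp only [hP]
    have h1 := intervalIntegral.integral_comp_neg (a := 0) (b := t) H
    simp only [hHo, neg_zero, intervalIntegral.integral_neg] at h1
    rw [intervalIntegral.integral_symm, ← h1, neg_neg]
  -- Two integrations by parts. Hence `P` and `W` share all nonconstant modes as well as the value
  -- at `0`, so they coincide.
  have hPcoef : ∀ l : ℤ, l ≠ 0 → ∫ t in (0 : ℝ)..(2 * π), Real.cos (l * t) * P t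
      = ∫ t in (0 : ℝ)..(2 * π), Real.cos (l * t) * W t := by
    intro l hl
    have hl' : (l : ℝ) ≠ 0 := by exact_mod_cast hl
    have h2 : (2 * π)⁻¹ ≠ 0 := by positivity
    rw [integral_cos_mul_of_hasDerivAt hPd hHc hl,
      integral_sin_mul_of_hasDerivAt hHd hhc (by simpa only [zero_add] using hHp 0) hl]
    refine mul_left_cancel₀ h2 ?_
    have h3 := hhcoef l
    have h4 := hWcoef l
    rw [cosCoeff] at h3 h4
    rw [h4]
    have e : (2 * π)⁻¹ * (-(1 / (l : ℝ)) * (1 / l * ∫ t in (0 : ℝ)..(2 * π), Real.cos (l * t) * h t))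
        = -(1 / (l : ℝ) ^ 2) * ((2 * π)⁻¹ * ∫ t in (0 : ℝ)..(2 * π), Real.cos (l * t) * h t) := by
      field_simp
    rw [e, h3]
    field_simp
  have hPW : P = W := by
    funext t
    have h1 := eq_of_integral_cos_mul_eq_zero (f := fun t => P t - W t) (hPc.sub hWc)
      (fun t => by rw [hPe, hWe]) (hPp.sub hWp) (fun l hl => by
        simp_rw [mul_sub]
        rw [intervalIntegral.integral_sub (Continuous.intervalIntegrable (by fun_prop) _ _)
          (Continuous.intervalIntegrable (by fun_prop) _ _), hPcoef l hl, sub_self]) t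
    have h2 : P 0 = W 0 := by simp [hP]
    rw [h2, sub_self, sub_eq_zero] at h1
    exact h1
  refine ⟨H, h, hhc, fun t => hPW ▸ hPd t, hHd, fun t => ?_⟩
  simp only [hh]
  rw [mul_div_cancel₀ _ hw2]
  push_cast
  ring

/-! ### The inverse of the linearized operator on its range -/

theorem summable_one_div_one_add_sq : Summable fun k : ℤ => 1 / (1 + (k : ℝ) ^ 2) := by
  have h : Summable fun k : ℤ => 1 / (k : ℝ) ^ 2 := Real.summable_one_div_int_pow.2 one_lt_two
  refine Summable.of_norm_bounded_eventually h ?_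
  refine (Set.finite_singleton (0 : ℤ)).subset fun k hk => ?_
  by_contra hne
  have hk0 : (k : ℝ) ≠ 0 := by exact_mod_cast hne
  apply hk
  have : 0 < (k : ℝ) ^ 2 := by positivity
  change ‖1 / (1 + (k : ℝ) ^ 2)‖ ≤ 1 / (k : ℝ) ^ 2
  rw [Real.norm_of_nonneg (by positivity)]
  exact one_div_le_one_div_of_le this (by linarith)

/-- A summable profile with two peaks, at `c` and `-c`. -/
def peak (c l : ℤ) : ℝ := 1 / (1 + ((l - c : ℤ) : ℝ) ^ 2) + 1 / (1 + ((l + c : ℤ) : ℝ) ^ 2)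

/-- The mass of every profile. -/
def peakMass : ℝ := 2 * ∑' k : ℤ, 1 / (1 + (k : ℝ) ^ 2)

theorem hasSum_peak (c : ℤ) : HasSum (peak c) peakMass := by
  have h := summable_one_div_one_add_sq.hasSum
  have h1 := (Equiv.subRight c).hasSum_iff.2 h
  have h2 := (Equiv.addRight c).hasSum_iff.2 h
  have h3 := h1.add h2
  rw [← two_mul] at h3
  exact h3

theorem peakMass_nonneg : 0 ≤ peakMass :=
  mul_nonneg zero_le_two (tsum_nonneg fun _ => by positivity)

/-- The diagonal family with the coefficients `∑ l, c j l * φ l t`. -/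
def DiagKernel.ofSeries (s : ℝ) (φ : ℤ → ℝ → ℝ) (hφ : ∀ l, Continuous (φ l))
    (hφ1 : ∀ l t, |φ l t| ≤ 1) (c : ℕ → ℤ → ℝ) (M : ℝ) (k : ℕ → ℤ)
    (h : ∀ j l, |c j l| ≤ M * peak (k j) l) : DiagKernel s s where
  coef t j := ∑' l, c j l * φ l t
  bd := M * peakMass
  le_bd t j := by
    refine mul_le_mul_of_nonneg_right ?_ (wt_pos s j).le
    rw [← Real.norm_eq_abs]
    refine tsum_of_norm_bounded ((hasSum_peak (k j)).mul_left M) fun l => ?_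
    rw [Real.norm_eq_abs, abs_mul]
    exact (mul_le_of_le_one_right (abs_nonneg _) (hφ1 l t)).trans (h j l)
  cont j := continuous_tsum_mul
    (Summable.of_norm_bounded ((hasSum_peak (k j)).summable.mul_left M) (h j)) hφ hφ1

/-- The inverse of `ω_j² - w² l²`, and zero on the kernel modes `l = ± ω_j`. -/
def rangeInv (ω : ℕ → ℕ) (w : ℝ) (j : ℕ) (l : ℤ) : ℝ :=
  if l ≠ (ω j : ℤ) ∧ l ≠ -(ω j : ℤ) then ((ω j : ℝ) ^ 2 - w ^ 2 * (l : ℝ) ^ 2)⁻¹ else 0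

theorem rangeInv_one (ω : ℕ → ℕ) (j : ℕ) (l : ℤ) : rangeInv ω 1 j l = nonresInv ω j l := by
  simp [rangeInv, nonresInv]

/-- The frequencies for which the operator is uniformly invertible on its range. -/
structure Admissible (ω : ℕ → ℕ) (α w : ℝ) : Prop where
  pos : ∀ j, 0 < ω j
  α_pos : 0 < α
  half_le : 1 / 2 ≤ w
  le_two : w ≤ 2
  mem : w ∈ diophantine ω α

theorem admissible_one {ω : ℕ → ℕ} (hω : ∀ j, 0 < ω j) {α : ℝ} (hα : 0 < α) (hα1 : α ≤ 1) :
    Admissible ω α 1 := by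
  refine ⟨hω, hα, by norm_num, by norm_num, fun l j hl hne => ?_⟩
  have h1 : (1 : ℝ) ≤ l := by exact_mod_cast hl
  have h2 : (1 : ℝ) ≤ |1 * (l : ℝ) - ω j| := by
    have : (1 : ℤ) ≤ |(l : ℤ) - ω j| := Int.one_le_abs (by omega)
    rw [one_mul]
    exact_mod_cast this
  refine le_trans ?_ h2
  rw [div_le_one (by linarith)]
  linarith

/-- The small divisor estimate; factor the divisor as `(ω j - w k)(ω j + w k)`. For `k ≥ 1` equal to
the nearest integer to `ω j / w`, the Diophantine bound gives at least `(α / k)(w k) = α w`; for `k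
= 0` the divisor is `(ω j)² ≥ 1`. For another `k` at distance `d` from that integer, `|ω j - w k| ≥
|d| / 4` and the second factor is no smaller than the first, so the product is at least `d² / 16`.
-/
theorem Admissible.one_add_sq_le {ω : ℕ → ℕ} {α w : ℝ} (h : Admissible ω α w) (j k : ℕ)
    (hk : k ≠ ω j) :
    1 + (((k : ℤ) - round ((ω j : ℝ) / w) : ℤ) : ℝ) ^ 2
      ≤ (32 + 2 / α) * |(ω j : ℝ) ^ 2 - w ^ 2 * (k : ℝ) ^ 2| := by
  have hw : 0 < w := by linarith [h.half_le]
  have hα := h.α_pos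
  have hn : (1 : ℝ) ≤ ω j := by exact_mod_cast h.pos j
  have hk0 : (0 : ℝ) ≤ k := Nat.cast_nonneg k
  set n : ℝ := (ω j : ℝ) with hn'
  set c := round (n / w) with hc
  have hcr : |n / w - c| ≤ 1 / 2 := abs_sub_round _
  have e : |n ^ 2 - w ^ 2 * (k : ℝ) ^ 2| = |n - w * k| * (n + w * k) := by
    rw [← abs_of_nonneg (by positivity : 0 ≤ n + w * k), ← abs_mul]
    congr 1
    ring
  rw [e]
  have hα2 : 0 < 2 / α := by positivity
  by_cases hkc : (k : ℤ) = c
  · rw [hkc, sub_self]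
    simp only [Int.cast_zero, ne_eq, OfNat.ofNat_ne_zero, not_false_eq_true, zero_pow, add_zero]
    rcases Nat.eq_zero_or_pos k with hk1 | hk1
    · rw [hk1]
      simp only [Nat.cast_zero, mul_zero, sub_zero, add_zero]
      rw [abs_of_pos (by linarith)]
      nlinarith
    · have hk2 : (1 : ℝ) ≤ k := by exact_mod_cast hk1
      have h1 := h.mem k j hk1 (Ne.symm hk)
      rw [abs_sub_comm] at h1
      have h2 : α / k * (w * k) ≤ |n - w * k| * (n + w * k) := by
        gcongr
        linarith
      have h3 : α / k * (w * k) = α * w := by field_simp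
      have h4 : 2 / α * (α * w) = 2 * w := by field_simp
      have h5 : 0 ≤ |n - w * k| * (n + w * k) := by positivity
      have h6 := mul_le_mul_of_nonneg_left (h3 ▸ h2) hα2.le
      have := h.half_le
      nlinarith
  · have hne : (1 : ℝ) ≤ |((k : ℤ) - c : ℤ)| := by
      exact_mod_cast Int.one_le_abs (sub_ne_zero.2 hkc)
    set d : ℝ := (((k : ℤ) - c : ℤ) : ℝ) with hd
    have hne' : (1 : ℝ) ≤ |d| := by
      rw [hd]
      exact_mod_cast hne
    have h1 : |d| / 2 ≤ |n / w - k| := by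
      have h2 : d = -(n / w - k) + (n / w - c) := by
        rw [hd]
        push_cast
        ring
      have h3 := abs_add_le (-(n / w - k)) (n / w - c)
      rw [← h2, abs_neg] at h3
      linarith
    have h4 : |n - w * k| = w * |n / w - k| := by
      rw [← abs_of_pos hw, ← abs_mul, abs_of_pos hw]
      congr 1
      field_simp
    have h5 : |d| / 4 ≤ |n - w * k| := by
      rw [h4]
      have := h.half_le
      nlinarith [abs_nonneg (n / w - k)]
    have h6 : |n - w * k| ≤ n + w * k := by
      rw [abs_le]
      constructor <;> nlinarith
    have h7 : |d| / 4 * (|d| / 4) ≤ |n - w * k| * (n + w * k) := by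
      gcongr
      exact h5.trans h6
    have h8 : d ^ 2 = |d| * |d| := by rw [← sq, sq_abs]
    have h9 : 0 ≤ 2 / α * (|n - w * k| * (n + w * k)) := by positivity
    rw [h8]
    nlinarith

theorem Admissible.abs_rangeInv_le {ω : ℕ → ℕ} {α w : ℝ} (h : Admissible ω α w) (j : ℕ) (l : ℤ) :
    |rangeInv ω w j l| ≤ (32 + 2 / α) * peak (round ((ω j : ℝ) / w)) l := by
  have hα := h.α_pos
  have hα2 : 0 < 2 / α := by positivity
  set c := round ((ω j : ℝ) / w) with hc
  have p1 : 0 ≤ 1 / (1 + ((l - c : ℤ) : ℝ) ^ 2) := by positivity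
  have p2 : 0 ≤ 1 / (1 + ((l + c : ℤ) : ℝ) ^ 2) := by positivity
  unfold rangeInv
  split_ifs with hl
  · have hk : l.natAbs ≠ ω j := by omega
    have h1 := h.one_add_sq_le j l.natAbs hk
    rw [← hc] at h1
    have h2 : ((l.natAbs : ℕ) : ℝ) ^ 2 = (l : ℝ) ^ 2 := by
      rw [Nat.cast_natAbs, Int.cast_abs, sq_abs]
    rw [h2] at h1
    set A := |(ω j : ℝ) ^ 2 - w ^ 2 * (l : ℝ) ^ 2| with hA
    have h3 : 0 < 1 + (((l.natAbs : ℤ) - c : ℤ) : ℝ) ^ 2 := by positivity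
    have hA0 : 0 < A := by
      by_contra hcon
      push Not at hcon
      have := mul_nonpos_of_nonneg_of_nonpos (by positivity : 0 ≤ 32 + 2 / α) hcon
      linarith
    have h4 : A⁻¹ ≤ (32 + 2 / α) * (1 / (1 + (((l.natAbs : ℤ) - c : ℤ) : ℝ) ^ 2)) := by
      rw [mul_one_div, inv_le_iff_one_le_mul₀ hA0, div_mul_eq_mul_div, one_le_div h3]
      exact h1
    rw [abs_inv, ← hA]
    refine h4.trans (mul_le_mul_of_nonneg_left ?_ (by positivity))
    rcases Int.natAbs_eq l with h5 | h5
    · rw [← h5]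
      exact le_add_of_nonneg_right p2
    · have h6 : (((l.natAbs : ℤ) - c : ℤ) : ℝ) ^ 2 = ((l + c : ℤ) : ℝ) ^ 2 := by
        have : (l.natAbs : ℤ) - c = -(l + c) := by omega
        rw [this, Int.cast_neg, neg_sq]
      rw [h6]
      exact le_add_of_nonneg_left p1
  · rw [abs_zero]
    exact mul_nonneg (by positivity) (add_nonneg p1 p2)

theorem Admissible.mul_rangeInv {ω : ℕ → ℕ} {α w : ℝ} (h : Admissible ω α w) (j : ℕ) (l : ℤ)
    (hl : l ≠ ω j) (hl' : l ≠ -ω j) :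
    ((ω j : ℝ) ^ 2 - w ^ 2 * (l : ℝ) ^ 2) * rangeInv ω w j l = 1 := by
  have h1 := h.one_add_sq_le j l.natAbs (by omega)
  have h2 : ((l.natAbs : ℕ) : ℝ) ^ 2 = (l : ℝ) ^ 2 := by
    rw [Nat.cast_natAbs, Int.cast_abs, sq_abs]
  rw [h2] at h1
  rw [rangeInv, if_pos ⟨hl, hl'⟩]
  refine mul_inv_cancel₀ fun h0 => ?_
  rw [h0, abs_zero, mul_zero] at h1
  have : 0 ≤ (((l.natAbs : ℤ) - round ((ω j : ℝ) / w) : ℤ) : ℝ) ^ 2 := sq_nonneg _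
  linarith

/-- At `w = 1` the divisor is a product of integers: `|ω j - |l|| ≥ 1` and `ω j + |l| ≥ |l|`. -/
theorem abs_mul_rangeInv_one_le (ω : ℕ → ℕ) (j : ℕ) (l : ℤ) :
    |(l : ℝ)| * |rangeInv ω 1 j l| ≤ 1 := by
  unfold rangeInv
  split_ifs with hl
  · have h1 : |l| ≤ |(ω j : ℤ) ^ 2 - l ^ 2| := by
      have e : (ω j : ℤ) ^ 2 - l ^ 2 = (ω j - |l|) * (ω j + |l|) := by
        rw [← sq_abs l]
        ring
      have h0 := abs_nonneg l
      have h2 : 1 ≤ abs ((ω j : ℤ) - |l|) := Int.one_le_abs (by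
        rcases abs_choice l with h | h <;> rw [h] <;> omega)
      rw [e, abs_mul]
      have h3 : |l| ≤ 1 * abs ((ω j : ℤ) + |l|) := by
        have h4 : (0 : ℤ) ≤ ω j := Int.natCast_nonneg _
        rw [one_mul]
        exact (le_add_of_nonneg_left h4).trans (le_abs_self _)
      exact h3.trans (mul_le_mul_of_nonneg_right h2 (abs_nonneg _))
    have h2 : |(l : ℝ)| ≤ |(ω j : ℝ) ^ 2 - 1 ^ 2 * (l : ℝ) ^ 2| := by
      rw [one_pow, one_mul]
      exact_mod_cast h1
    rw [abs_inv]
    exact mul_inv_le_one_of_le₀ h2 (abs_nonneg _)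
  · simp

/-- The resolvent identity `a - b = (w² - 1) l² a b`, in which one factor `l` is absorbed by `b`,
the inverse at frequency `1`. -/
theorem Admissible.abs_rangeInv_sub_le {ω : ℕ → ℕ} {α w : ℝ} (h : Admissible ω α w)
    (hα1 : α ≤ 1) (j : ℕ) (l : ℤ) :
    |rangeInv ω w j l - rangeInv ω 1 j l|
      ≤ |w ^ 2 - 1| * |(l : ℝ)| * |rangeInv ω w j l| := by
  by_cases hl : l ≠ (ω j : ℤ) ∧ l ≠ -(ω j : ℤ)
  · have h1 := h.mul_rangeInv j l hl.1 hl.2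
    have h2 := (admissible_one h.pos h.α_pos hα1).mul_rangeInv j l hl.1 hl.2
    have h3 := abs_mul_rangeInv_one_le ω j l
    set a := rangeInv ω w j l
    set b := rangeInv ω 1 j l
    have e : a - b = (w ^ 2 - 1) * l * a * (l * b) := by
      linear_combination b * h1 - a * h2
    rw [e, abs_mul, abs_mul, abs_mul, abs_mul]
    exact mul_le_of_le_one_right (by positivity) h3
  · simp [rangeInv, hl]

/-- The Green kernels of the operators `ω_j² + w² ∂²` on their ranges. -/
def greenKernel (s : ℝ) {ω : ℕ → ℕ} {α w : ℝ} (h : Admissible ω α w) : DiagKernel s s :=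
  DiagKernel.ofSeries s (fun l t => Real.cos (l * t)) continuous_cos_int_mul
    (fun _ _ => Real.abs_cos_le_one _) (rangeInv ω w) (32 + 2 / α)
    (fun j => round ((ω j : ℝ) / w)) h.abs_rangeInv_le

theorem greenKernel_coef {s : ℝ} {ω : ℕ → ℕ} {α w : ℝ} (h : Admissible ω α w) (t : ℝ) (j : ℕ) :
    (greenKernel s h).coef t j = ∑' l : ℤ, rangeInv ω w j l * Real.cos (l * t) := rfl

theorem Admissible.summable_rangeInv {ω : ℕ → ℕ} {α w : ℝ} (h : Admissible ω α w) (j : ℕ) :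
    Summable (rangeInv ω w j) :=
  Summable.of_norm_bounded ((hasSum_peak _).summable.mul_left _) (h.abs_rangeInv_le j)

theorem greenKernel_coef_neg {s : ℝ} {ω : ℕ → ℕ} {α w : ℝ} (h : Admissible ω α w) (t : ℝ)
    (j : ℕ) : (greenKernel s h).coef (-t) j = (greenKernel s h).coef t j := by
  simp only [greenKernel_coef, mul_neg, Real.cos_neg]

theorem greenKernel_coef_periodic {s : ℝ} {ω : ℕ → ℕ} {α w : ℝ} (h : Admissible ω α w) (j : ℕ) :
    Function.Periodic (fun t => (greenKernel s h).coef t j) (2 * π) := fun t => by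
  simp only [greenKernel_coef]
  congr 1
  funext l
  have := cos_int_mul_periodic l t
  simp only at this
  rw [this]

theorem DiagKernel.conv_periodic {s r : ℝ} (F : DiagKernel s r) {g : ℝ →ᵇ ellW s}
    (hper : Function.Periodic g (2 * π)) : Function.Periodic (F.conv g) (2 * π) := fun t => by
  rw [F.conv_apply_eq, F.conv_apply_eq]
  congr 1
  funext τ
  rw [← hper (t - τ)]
  ring_nf

theorem ellW.periodic_apply {s : ℝ} {g : ℝ → ellW s} {T : ℝ} (h : Function.Periodic g T) (j : ℕ) :
    Function.Periodic (fun t => g t j) T := fun t => by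
  simp only [h t]

/-- The kernel is even and periodic, so `τ ↦ -τ` turns the convolution at `-t` into the one at `t`.
-/
theorem greenKernel_conv_even {s : ℝ} {ω : ℕ → ℕ} {α w : ℝ} (h : Admissible ω α w)
    {g : ℝ →ᵇ ellW s} (hper : Function.Periodic g (2 * π)) (heven : ∀ t, g (-t) = g t) (t : ℝ) :
    (greenKernel s h).conv g (-t) = (greenKernel s h).conv g t := by
  refine ellW.ext fun j => ?_
  rw [DiagKernel.conv_apply, DiagKernel.conv_apply]
  congr 1
  have hp : Function.Periodic (fun τ => (greenKernel s h).coef τ j * g (t - τ) j) (2 * π) := by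
    refine (greenKernel_coef_periodic h j).mul fun τ => ?_
    have := hper (t - (τ + 2 * π))
    rw [← this]
    ring_nf
  have h1 := hp.intervalIntegral_add_eq (-(2 * π)) 0
  rw [neg_add_cancel, zero_add] at h1
  have h2 := intervalIntegral.integral_comp_neg (a := 0) (b := 2 * π)
    (fun τ => (greenKernel s h).coef τ j * g (t - τ) j)
  rw [neg_zero, h1] at h2
  rw [← h2]
  congr 1
  funext τ
  rw [greenKernel_coef_neg, ← heven (-t - τ)]
  ring_nf

theorem greenKernel_conv_eq_tsum {s : ℝ} {ω : ℕ → ℕ} {α w : ℝ} (h : Admissible ω α w)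
    {g : ℝ →ᵇ ellW s} (hper : Function.Periodic g (2 * π)) (heven : ∀ t, g (-t) = g t) (t : ℝ)
    (j : ℕ) : (greenKernel s h).conv g t j
      = ∑' l : ℤ, rangeInv ω w j l * cosCoeff (fun t => g t j) l * Real.cos (l * t) := by
  rw [DiagKernel.conv_apply]
  exact conv_eq_tsum (h.summable_rangeInv j) (ellW.continuous_apply g.continuous j)
    (fun t => by rw [heven]) (ellW.periodic_apply hper j) t

/-- The convolution with the Green kernel solves the equation on the range. -/
theorem greenKernel_conv_hasDerivAt {s : ℝ} {ω : ℕ → ℕ} {α w : ℝ} (h : Admissible ω α w)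
    {g : ℝ →ᵇ ellW s} (hper : Function.Periodic g (2 * π)) (heven : ∀ t, g (-t) = g t) (j : ℕ) :
    ∃ W' H : ℝ → ℝ, Continuous H ∧
      (∀ t, HasDerivAt (fun t => (greenKernel s h).conv g t j) (W' t) t) ∧
      (∀ t, HasDerivAt W' (H t) t) ∧
      ∀ t, w ^ 2 * H t + (ω j : ℝ) ^ 2 * (greenKernel s h).conv g t j
        = g t j - 2 * cosCoeff (fun t => g t j) (ω j) * Real.cos (ω j * t) := by
  refine hasDerivAt_of_multiplier (g := fun t => g t j) (C := ‖coordL s j‖ * ‖g‖)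
    (ellW.continuous_apply g.continuous j)
    (fun t => by rw [heven]) (ellW.periodic_apply hper j) (fun t => ?_) (h.pos j)
    (by linarith [h.half_le]) (h.summable_rangeInv j) ⟨by simp [rangeInv], by simp [rangeInv]⟩
    (h.mul_rangeInv j) fun t => greenKernel_conv_eq_tsum h hper heven t j
  exact ((coordL s j).le_opNorm (g t)).trans
    (mul_le_mul_of_nonneg_left (g.norm_coe_le_norm t) (norm_nonneg _))

/-- Dependence of the inverse on the frequency. The difference of multipliers still grows by a
factor `l` relative to a summable one; integration by parts trades this factor for a time derivative
of `g` and turns the cosine kernel into a sine kernel. The estimate therefore requires `g` to be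
differentiable. -/
theorem norm_greenKernel_conv_sub_le {s : ℝ} {ω : ℕ → ℕ} {α w : ℝ} (h : Admissible ω α w)
    (h1 : Admissible ω α 1) (hα1 : α ≤ 1) {g g' : ℝ →ᵇ ellW s}
    (hg : ∀ t, HasDerivAt g (g' t) t) :
    ‖(greenKernel s h).conv g - (greenKernel s h1).conv g‖
      ≤ |w ^ 2 - 1| * ((32 + 2 / α) * peakMass) * ‖g'‖ := by
  set d : ℕ → ℤ → ℝ := fun j l => rangeInv ω w j l - rangeInv ω 1 j l with hd
  have hd0 : ∀ j l, |d j l / l| ≤ |w ^ 2 - 1| * (32 + 2 / α) * peak (round ((ω j : ℝ) / w)) l := by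
    intro j l
    have h2 := h.abs_rangeInv_sub_le hα1 j l
    have h3 := mul_le_mul_of_nonneg_left (h.abs_rangeInv_le j l) (abs_nonneg (w ^ 2 - 1))
    rw [← mul_assoc] at h3
    refine le_trans ?_ h3
    rcases eq_or_ne (l : ℝ) 0 with h0 | h0
    · rw [h0, div_zero, abs_zero]
      positivity
    · rw [abs_div, div_le_iff₀ (abs_pos.2 h0)]
      linarith
  set K : DiagKernel s s := DiagKernel.ofSeries s (fun l t => Real.sin (l * t))
    continuous_sin_int_mul (fun _ _ => Real.abs_sin_le_one _) (fun j l => d j l / l)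
    (|w ^ 2 - 1| * (32 + 2 / α)) (fun j => round ((ω j : ℝ) / w)) hd0 with hK
  have key : (greenKernel s h).conv g - (greenKernel s h1).conv g = K.conv g' := by
    ext t : 1
    refine ellW.ext fun j => ?_
    have hgj : ∀ τ, HasDerivAt (fun t => g t j) (g' τ j) τ := fun τ =>
      (coordL s j).hasFDerivAt.comp_hasDerivAt τ (hg τ)
    have hgt : ∀ τ, HasDerivAt (fun τ => g (t - τ) j) (-g' (t - τ) j) τ := fun τ => by
      have := (hgj (t - τ)).scomp τ ((hasDerivAt_id τ).const_sub t)
      simpa [Function.comp_def] using this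
    have hg'c : Continuous fun τ => g' (t - τ) j :=
      ellW.continuous_apply (g'.continuous.comp (by fun_prop)) j
    have hgc : Continuous fun τ => g (t - τ) j :=
      ellW.continuous_apply (g.continuous.comp (by fun_prop)) j
    have s1 := (hasSum_intervalIntegral_mul (h.summable_rangeInv j) continuous_cos_int_mul
      (fun _ _ => Real.abs_cos_le_one _) hgc 0 (2 * π)).sub
      (hasSum_intervalIntegral_mul (h1.summable_rangeInv j) continuous_cos_int_mul
      (fun _ _ => Real.abs_cos_le_one _) hgc 0 (2 * π))
    have hds : Summable fun l : ℤ => d j l / l :=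
      Summable.of_norm_bounded ((hasSum_peak _).summable.mul_left _) (hd0 j)
    have s2 := hasSum_intervalIntegral_mul hds continuous_sin_int_mul
      (fun _ _ => Real.abs_sin_le_one _) hg'c 0 (2 * π)
    have e : ∀ l : ℤ, rangeInv ω w j l * (∫ τ in (0 : ℝ)..(2 * π), Real.cos (l * τ) * g (t - τ) j)
        - rangeInv ω 1 j l * (∫ τ in (0 : ℝ)..(2 * π), Real.cos (l * τ) * g (t - τ) j)
        = d j l / l * ∫ τ in (0 : ℝ)..(2 * π), Real.sin (l * τ) * g' (t - τ) j := by
      intro l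
      -- The multiplier at `l = 0` does not depend on `w`, which agrees with the convention `x / 0 =
      -- 0` on the right.
      rcases eq_or_ne l 0 with rfl | hl
      · simp [rangeInv]
      · rw [integral_cos_mul_of_hasDerivAt hgt hg'c.neg hl]
        simp only [mul_neg, intervalIntegral.integral_neg, hd]
        ring
    simp_rw [e] at s1
    have s3 := s1.unique s2
    have e1 : ((greenKernel s h).conv g - (greenKernel s h1).conv g) t j
        = (greenKernel s h).conv g t j - (greenKernel s h1).conv g t j := rfl
    rw [e1, DiagKernel.conv_apply, DiagKernel.conv_apply, DiagKernel.conv_apply, ← mul_sub]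
    congr 1
  rw [key]
  refine (K.norm_conv_apply_le g').trans (le_of_eq ?_)
  change |w ^ 2 - 1| * (32 + 2 / α) * peakMass * ‖g'‖ = _
  ring

/-! ### Absolute values in the weighted spaces -/

/-- The sequence of the absolute values. -/
def ellW.absVal {s : ℝ} (u : ellW s) : ellW s :=
  ⟨fun j => |u j|, memW_of_abs_le u.2 (C := 1) fun j => by simp [abs_mul]⟩

@[simp] theorem ellW.absVal_apply {s : ℝ} (u : ellW s) (j : ℕ) : u.absVal j = |u j| := rfl

theorem ellW.continuous_absVal {s : ℝ} : Continuous (ellW.absVal (s := s)) := by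
  refine (LipschitzWith.of_dist_le_mul (K := 1) fun u v => ?_).continuous
  rw [dist_eq_norm, dist_eq_norm]
  refine ellW.norm_le_of_abs_le (NNReal.coe_nonneg 1) fun j => ?_
  rw [abs_mul, abs_mul, NNReal.coe_one, one_mul]
  exact mul_le_mul_of_nonneg_left (abs_abs_sub_abs_le _ _) (abs_nonneg _)

/-! ### The quadratic and the cubic nonlinearity -/

/-- A bound on a small ball is propagated to the whole space by scaling, as for linear maps. -/
theorem exists_norm_le_of_homogeneous {E F : Type*} [NormedAddCommGroup E] [NormedSpace ℝ E]
    [NormedAddCommGroup F] [NormedSpace ℝ F] {f : E → F} (hf : ContinuousAt f 0) {k : ℕ}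
    (hk : k ≠ 0) (hom : ∀ (c : ℝ) u, f (c • u) = c ^ k • f u) :
    ∃ K, 0 ≤ K ∧ ∀ u, ‖f u‖ ≤ K * ‖u‖ ^ k := by
  have h0 : f 0 = 0 := by
    have := hom 0 0
    rwa [zero_smul, zero_pow hk, zero_smul] at this
  rw [Metric.continuousAt_iff] at hf
  obtain ⟨δ, hδ, h⟩ := hf 1 one_pos
  refine ⟨((δ / 2) ^ k)⁻¹, by positivity, fun u => ?_⟩
  rcases eq_or_ne u 0 with rfl | hu
  · rw [h0, norm_zero, norm_zero, zero_pow hk, mul_zero]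
  have hu' : 0 < ‖u‖ := norm_pos_iff.2 hu
  set c := δ / 2 / ‖u‖ with hc
  have hc0 : 0 < c := by positivity
  have h1 : ‖c • u‖ = δ / 2 := by
    rw [norm_smul, Real.norm_of_nonneg hc0.le, hc]
    field_simp
  have h2 := h (x := c • u) (by rw [dist_zero_right, h1]; linarith)
  rw [h0, dist_zero_right, hom, norm_smul, Real.norm_of_nonneg (by positivity)] at h2
  have h3 : ((δ / 2) ^ k)⁻¹ * ‖u‖ ^ k = (c ^ k)⁻¹ := by
    rw [hc, div_pow _ ‖u‖, inv_div, inv_mul_eq_div]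
  rw [h3, ← one_div, le_div_iff₀ (by positivity)]
  linarith

theorem quadTerm_smul (D : ℕ → ℕ → ℕ → ℝ) (c : ℝ) (u : ℕ → ℝ) (m : ℕ) :
    quadTerm D (fun j => c * u j) m = c ^ 2 * quadTerm D u m := by
  have h : ∀ p : ℕ × ℕ, D p.1 p.2 m * (c * u p.1) * (c * u p.2)
      = c ^ 2 * (D p.1 p.2 m * u p.1 * u p.2) := fun p => by ring
  simp only [quadTerm, h, tsum_mul_left]
  ring

theorem cubicTerm_smul (C : ℕ → ℕ → ℕ → ℕ → ℝ) (c : ℝ) (u : ℕ → ℝ) (m : ℕ) :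
    cubicTerm C (fun j => c * u j) m = c ^ 3 * cubicTerm C u m := by
  have h : ∀ p : ℕ × ℕ × ℕ, C p.1 p.2.1 p.2.2 m * (c * u p.1) * (c * u p.2.1) * (c * u p.2.2)
      = c ^ 3 * (C p.1 p.2.1 p.2.2 m * u p.1 * u p.2.1 * u p.2.2) := fun p => by ring
  simp only [cubicTerm, h, tsum_mul_left]
  ring

section Quadratic

variable {s : ℝ} {D : ℕ → ℕ → ℕ → ℝ}

/-- Absolute convergence on the diagonal, applied to the sequence `|u| + |v|`, dominates the mixed
terms. -/
theorem summable_bilinear (hDsum : ∀ (u : ellW s) (m : ℕ),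
      Summable fun p : ℕ × ℕ => D p.1 p.2 m * u p.1 * u p.2) (u v : ellW s) (m : ℕ) :
    Summable fun p : ℕ × ℕ => D p.1 p.2 m * u p.1 * v p.2 := by
  refine Summable.of_norm_bounded (hDsum (u.absVal + v.absVal) m).abs fun p => ?_
  simp only [ellW.add_apply, ellW.absVal_apply]
  rw [Real.norm_eq_abs, abs_mul, abs_mul, abs_mul, abs_mul,
    abs_of_nonneg (by positivity : 0 ≤ |u p.1| + |v p.1|),
    abs_of_nonneg (by positivity : 0 ≤ |u p.2| + |v p.2|)]
  gcongr
  · exact le_add_of_nonneg_right (abs_nonneg _)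
  · exact le_add_of_nonneg_left (abs_nonneg _)

/-- The quadratic term comes from a bounded symmetric bilinear map. -/
theorem exists_bilinear (hDsymm : ∀ i j m, D i j m = D j i m)
    (hDsum : ∀ (u : ellW s) (m : ℕ), Summable fun p : ℕ × ℕ => D p.1 p.2 m * u p.1 * u p.2)
    (hf : IsC11On s (quadTerm D)) :
    ∃ B : ellW s →L[ℝ] ellW s →L[ℝ] ellW s,
      (∀ u v m, B u v m = -3 * ∑' p : ℕ × ℕ, D p.1 p.2 m * u p.1 * v p.2) ∧
      ∀ u v, B u v = B v u := by
  obtain ⟨F, hF, hFd, -⟩ := hf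
  have hs := summable_bilinear hDsum
  have hsymm : ∀ (u v : ellW s) (m : ℕ), ∑' p : ℕ × ℕ, D p.1 p.2 m * u p.1 * v p.2
      = ∑' p : ℕ × ℕ, D p.1 p.2 m * v p.1 * u p.2 := by
    intro u v m
    rw [← (Equiv.prodComm ℕ ℕ).tsum_eq]
    congr 1
    funext p
    simp only [Equiv.prodComm_apply, Prod.fst_swap, Prod.snd_swap]
    rw [hDsymm]
    ring
  -- Polarization. Its coordinates are the mixed series because `D` is symmetric. On unit vectors
  -- the norm is at most `(4 K + K + K) / 2 = 3 K`.
  set b : ellW s → ellW s → ellW s := fun u v => (1 / 2 : ℝ) • (F (u + v) - F u - F v) with hb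
  have hbm : ∀ u v m, b u v m = -3 * ∑' p : ℕ × ℕ, D p.1 p.2 m * u p.1 * v p.2 := by
    intro u v m
    have e : ∀ p : ℕ × ℕ, D p.1 p.2 m * (u + v) p.1 * (u + v) p.2
        = D p.1 p.2 m * u p.1 * u p.2 + D p.1 p.2 m * u p.1 * v p.2
          + D p.1 p.2 m * v p.1 * u p.2 + D p.1 p.2 m * v p.1 * v p.2 := fun p => by
      simp only [ellW.add_apply]
      ring
    simp only [hb, ellW.smul_apply, ellW.sub_apply, hF, quadTerm]
    simp_rw [e]
    rw [Summable.tsum_add (((hs u u m).add (hs u v m)).add (hs v u m)) (hs v v m),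
      Summable.tsum_add ((hs u u m).add (hs u v m)) (hs v u m),
      Summable.tsum_add (hs u u m) (hs u v m), hsymm v u m]
    ring
  have hsw : ∀ u v, b u v = b v u := fun u v => ellW.ext fun m => by
    rw [hbm, hbm, hsymm]
  have hadd : ∀ u v w, b (u + v) w = b u w + b v w := fun u v w => ellW.ext fun m => by
    refine (hbm (u + v) w m).trans (Eq.trans ?_
      (congrArg₂ (· + ·) (hbm u w m) (hbm v w m)).symm)
    rw [← mul_add, ← Summable.tsum_add (hs u w m) (hs v w m)]
    congr 2
    funext p
    rw [ellW.add_apply]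
    ring
  have hsmul : ∀ (c : ℝ) u w, b (c • u) w = c • b u w := fun c u w => ellW.ext fun m => by
    refine (hbm (c • u) w m).trans (Eq.trans ?_ (congrArg (c * ·) (hbm u w m)).symm)
    rw [mul_left_comm c, ← tsum_mul_left (a := c)]
    congr 2
    funext p
    rw [ellW.smul_apply]
    ring
  obtain ⟨K, hK0, hK⟩ := exists_norm_le_of_homogeneous (f := F) (hFd 0).continuousAt two_ne_zero
    (fun c u => ellW.ext fun m => by
      rw [hF, ellW.smul_apply, hF]
      exact quadTerm_smul D c u m)
  have h1 : ∀ u v, ‖u‖ = 1 → ‖v‖ = 1 → ‖b u v‖ ≤ 3 * K := by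
    intro u v hu hv
    have n1 := hK (u + v)
    have n2 := hK u
    have n3 := hK v
    have n4 := norm_add_le u v
    rw [hu, hv] at n4
    have n5 : ‖u + v‖ ^ 2 ≤ 4 := by nlinarith [norm_nonneg (u + v)]
    have n6 := mul_le_mul_of_nonneg_left n5 hK0
    rw [hu, one_pow] at n2
    rw [hv, one_pow] at n3
    have n7 := norm_sub_le (F (u + v) - F u) (F v)
    have n8 := norm_sub_le (F (u + v)) (F u)
    simp only [hb]
    rw [norm_smul, Real.norm_of_nonneg (by norm_num)]
    linarith
  have hbd : ∀ u v, ‖b u v‖ ≤ 3 * K * ‖u‖ * ‖v‖ := by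
    intro u v
    rcases eq_or_ne u 0 with rfl | hu
    · have := hsmul 0 0 v
      rw [zero_smul, zero_smul] at this
      rw [this]
      simp
    rcases eq_or_ne v 0 with rfl | hv
    · have := hsmul 0 0 u
      rw [zero_smul, zero_smul] at this
      rw [hsw, this]
      simp
    have hu' := norm_pos_iff.2 hu
    have hv' := norm_pos_iff.2 hv
    have e : b u v = (‖u‖ * ‖v‖) • b (‖u‖⁻¹ • u) (‖v‖⁻¹ • v) := by
      rw [hsmul ‖u‖⁻¹ u, hsw u (‖v‖⁻¹ • v), hsmul ‖v‖⁻¹ v u, hsw v u, smul_smul, smul_smul]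
      have : ‖u‖ * ‖v‖ * ‖u‖⁻¹ * ‖v‖⁻¹ = 1 := by field_simp
      rw [this, one_smul]
    rw [e, norm_smul, Real.norm_of_nonneg (by positivity)]
    have := h1 (‖u‖⁻¹ • u) (‖v‖⁻¹ • v)
      (by rw [norm_smul, norm_inv, norm_norm, inv_mul_cancel₀ hu'.ne'])
      (by rw [norm_smul, norm_inv, norm_norm, inv_mul_cancel₀ hv'.ne'])
    have := mul_le_mul_of_nonneg_left this (mul_nonneg hu'.le hv'.le)
    linarith
  refine ⟨LinearMap.mkContinuous₂ (LinearMap.mk₂ ℝ b hadd hsmul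
    (fun u v w => by rw [hsw, hadd, hsw v u, hsw w u]) fun c u v => by
      rw [hsw, hsmul, hsw]) (3 * K) hbd, hbm, hsw⟩

end Quadratic

/-- The properties of the cubic term that are used. -/
structure IsCubicMap {s : ℝ} (C : ℕ → ℕ → ℕ → ℕ → ℝ) (F : ellW s → ellW s) : Prop where
  apply : ∀ (u : ellW s) (m : ℕ), F u m = cubicTerm C u m
  differentiable : Differentiable ℝ F
  smul : ∀ (c : ℝ) u, F (c • u) = c ^ 3 • F u
  exists_norm_le : ∃ K, 0 ≤ K ∧ ∀ u, ‖F u‖ ≤ K * ‖u‖ ^ 3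
  lipschitz : ∀ R : ℝ, ∃ K : ℝ, 0 ≤ K ∧ ∀ u v : ellW s, ‖u‖ < R → ‖v‖ < R →
    ‖fderiv ℝ F u - fderiv ℝ F v‖ ≤ K * ‖u - v‖

theorem exists_isCubicMap {s : ℝ} {C : ℕ → ℕ → ℕ → ℕ → ℝ} (hf : IsC11On s (cubicTerm C)) :
    ∃ F : ellW s → ellW s, IsCubicMap C F := by
  obtain ⟨F, hF, hFd, hL⟩ := hf
  have hom : ∀ (c : ℝ) u, F (c • u) = c ^ 3 • F u := fun c u => ellW.ext fun m => by
    rw [hF, ellW.smul_apply, hF]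
    exact cubicTerm_smul C c u m
  refine ⟨F, hF, hFd, hom, exists_norm_le_of_homogeneous (hFd 0).continuousAt three_ne_zero hom,
    fun R => ?_⟩
  obtain ⟨K, hK⟩ := hL R
  refine ⟨K, K.2, fun u v hu hv => ?_⟩
  have := hK.dist_le_mul u (by simpa using hu) v (by simpa using hv)
  rwa [dist_eq_norm, dist_eq_norm] at this

namespace IsCubicMap

variable {s : ℝ} {C : ℕ → ℕ → ℕ → ℕ → ℝ} {F : ellW s → ellW s} (hF : IsCubicMap C F)
include hF

theorem norm_sub_sub_le (R : ℝ) : ∃ K : ℝ, 0 ≤ K ∧ ∀ (a u v : ellW s) (ρ : ℝ), ‖a‖ + ρ < R →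
    ‖u - a‖ ≤ ρ → ‖v - a‖ ≤ ρ → ‖F u - F v - fderiv ℝ F a (u - v)‖ ≤ K * ρ * ‖u - v‖ := by
  obtain ⟨K, hK0, hK⟩ := hF.lipschitz R
  refine ⟨K, hK0, fun a u v ρ hR hu hv => ?_⟩
  have hρ : 0 ≤ ρ := (norm_nonneg _).trans hu
  refine Convex.norm_image_sub_le_of_norm_fderiv_le' (s := Metric.closedBall a ρ)
    (fun x _ => hF.differentiable x) (fun x hx => ?_) (convex_closedBall a ρ)
    (by simpa [dist_eq_norm] using hv) (by simpa [dist_eq_norm] using hu)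
  rw [Metric.mem_closedBall, dist_eq_norm] at hx
  have h1 : ‖x‖ ≤ ‖a‖ + ‖x - a‖ := by
    have := norm_add_le a (x - a)
    rwa [add_sub_cancel] at this
  refine (hK x a (by linarith) (by linarith)).trans ?_
  gcongr

theorem continuous_fderiv : Continuous (fderiv ℝ F) := by
  rw [continuous_iff_continuousAt]
  intro u
  obtain ⟨K, hK0, hK⟩ := hF.lipschitz (‖u‖ + 1)
  rw [ContinuousAt, tendsto_iff_norm_sub_tendsto_zero]
  have h1 : Tendsto (fun x => K * ‖x - u‖) (𝓝 u) (𝓝 0) := by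
    have : Continuous fun x => K * ‖x - u‖ := by fun_prop
    have := this.tendsto u
    simpa using this
  refine squeeze_zero' (Eventually.of_forall fun _ => norm_nonneg _) ?_ h1
  filter_upwards [Metric.ball_mem_nhds u one_pos] with x hx
  rw [Metric.mem_ball, dist_eq_norm] at hx
  have h2 : ‖x‖ ≤ ‖u‖ + ‖x - u‖ := by
    have := norm_add_le u (x - u)
    rwa [add_sub_cancel] at this
  exact hK x u (by linarith) (by linarith)

theorem exists_norm_fderiv_le (R : ℝ) : ∃ K, 0 ≤ K ∧ ∀ u, ‖u‖ ≤ R → ‖fderiv ℝ F u‖ ≤ K := by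
  obtain ⟨K, hK0, hK⟩ := hF.lipschitz (|R| + 1)
  refine ⟨K * |R| + ‖fderiv ℝ F 0‖, by positivity, fun u hu => ?_⟩
  have hR := hu.trans (le_abs_self R)
  have h1 := hK u 0 (by linarith) (by rw [norm_zero]; positivity)
  have h2 := norm_add_le (fderiv ℝ F u - fderiv ℝ F 0) (fderiv ℝ F 0)
  rw [sub_add_cancel] at h2
  rw [sub_zero] at h1
  have h3 := mul_le_mul_of_nonneg_left hR hK0
  linarith

theorem exists_lipschitz (R : ℝ) : ∃ K, 0 ≤ K ∧ ∀ u v, ‖u‖ ≤ R → ‖v‖ ≤ R →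
    ‖F u - F v‖ ≤ K * ‖u - v‖ := by
  obtain ⟨K, hK0, hK⟩ := hF.exists_norm_fderiv_le R
  refine ⟨K, hK0, fun u v hu hv => ?_⟩
  exact Convex.norm_image_sub_le_of_norm_fderiv_le (s := Metric.closedBall 0 R)
    (fun x _ => hF.differentiable x) (fun x hx => hK x (by simpa using hx))
    (convex_closedBall 0 R) (by simpa using hv) (by simpa using hu)

end IsCubicMap

/-! ### Superposition operators on bounded continuous functions -/

section Superposition

variable {s : ℝ}

/-- A bilinear map applied pointwise. -/
def bilinX (B : ellW s →L[ℝ] ellW s →L[ℝ] ellW s) :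
    (ℝ →ᵇ ellW s) →L[ℝ] (ℝ →ᵇ ellW s) →L[ℝ] (ℝ →ᵇ ellW s) :=
  LinearMap.mkContinuous₂
    (LinearMap.mk₂ ℝ (fun u v => BoundedContinuousFunction.ofNormedAddCommGroup
        (fun t => B (u t) (v t)) ((B.continuous.comp u.continuous).clm_apply v.continuous)
        (‖B‖ * ‖u‖ * ‖v‖) fun t => (B.le_opNorm₂ _ _).trans (by
          gcongr
          exacts [u.norm_coe_le_norm t, v.norm_coe_le_norm t]))
      (fun u v w => by ext t : 1; simp) (fun c u v => by ext t : 1; simp)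
      (fun u v w => by ext t : 1; simp) (fun c u v => by ext t : 1; simp))
    ‖B‖ fun u v => BoundedContinuousFunction.norm_ofNormedAddCommGroup_le _ (by positivity)
      fun t => (B.le_opNorm₂ _ _).trans (by
          gcongr
          exacts [u.norm_coe_le_norm t, v.norm_coe_le_norm t])

@[simp] theorem bilinX_apply (B : ellW s →L[ℝ] ellW s →L[ℝ] ellW s) (u v : ℝ →ᵇ ellW s) (t : ℝ) :
    bilinX B u v t = B (u t) (v t) := rfl

theorem norm_bilinX_le (B : ellW s →L[ℝ] ellW s →L[ℝ] ellW s) (u v : ℝ →ᵇ ellW s) :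
    ‖bilinX B u v‖ ≤ ‖B‖ * ‖u‖ * ‖v‖ :=
  (BoundedContinuousFunction.norm_le (by positivity)).2 fun t => (B.le_opNorm₂ _ _).trans (by
    gcongr
    exacts [u.norm_coe_le_norm t, v.norm_coe_le_norm t])

variable {C : ℕ → ℕ → ℕ → ℕ → ℝ} {F : ellW s → ellW s}

/-- The cubic map applied pointwise. -/
def IsCubicMap.superpos (hF : IsCubicMap C F) (u : ℝ →ᵇ ellW s) : ℝ →ᵇ ellW s :=
  BoundedContinuousFunction.ofNormedAddCommGroup (fun t => F (u t))
    (hF.differentiable.continuous.comp u.continuous)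
    (Classical.choose hF.exists_norm_le * ‖u‖ ^ 3) fun t =>
      ((Classical.choose_spec hF.exists_norm_le).2 _).trans
        (mul_le_mul_of_nonneg_left (pow_le_pow_left₀ (norm_nonneg _) (u.norm_coe_le_norm t) 3)
          (Classical.choose_spec hF.exists_norm_le).1)

/-- The differential of the cubic map applied pointwise. -/
def IsCubicMap.diffX (hF : IsCubicMap C F) (p : ℝ →ᵇ ellW s) :
    (ℝ →ᵇ ellW s) →L[ℝ] (ℝ →ᵇ ellW s) :=
  have hb := fun (t : ℝ) (u : ℝ →ᵇ ellW s) => ((fderiv ℝ F (p t)).le_opNorm (u t)).trans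
    (mul_le_mul ((Classical.choose_spec (hF.exists_norm_fderiv_le ‖p‖)).2 _
        (p.norm_coe_le_norm t)) (u.norm_coe_le_norm t) (norm_nonneg _)
      (Classical.choose_spec (hF.exists_norm_fderiv_le ‖p‖)).1)
  LinearMap.mkContinuous
    { toFun := fun u => BoundedContinuousFunction.ofNormedAddCommGroup
        (fun t => fderiv ℝ F (p t) (u t))
        ((hF.continuous_fderiv.comp p.continuous).clm_apply u.continuous)
        (Classical.choose (hF.exists_norm_fderiv_le ‖p‖) * ‖u‖) fun t => hb t u
      map_add' := fun u v => by ext t : 1; simp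
      map_smul' := fun c u => by ext t : 1; simp }
    (Classical.choose (hF.exists_norm_fderiv_le ‖p‖)) fun u =>
      BoundedContinuousFunction.norm_ofNormedAddCommGroup_le _
        (mul_nonneg (Classical.choose_spec (hF.exists_norm_fderiv_le ‖p‖)).1 (norm_nonneg _))
        fun t => hb t u

@[simp] theorem IsCubicMap.diffX_apply (hF : IsCubicMap C F) (p u : ℝ →ᵇ ellW s) (t : ℝ) :
    hF.diffX p u t = fderiv ℝ F (p t) (u t) := rfl

theorem IsCubicMap.superpos_sub_le (hF : IsCubicMap C F) (p : ℝ →ᵇ ellW s) (ρ₀ : ℝ) :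
    ∃ K, 0 ≤ K ∧ ∀ ρ ≤ ρ₀, ∀ u v, ‖u - p‖ ≤ ρ → ‖v - p‖ ≤ ρ →
      ‖hF.superpos u - hF.superpos v - hF.diffX p (u - v)‖ ≤ K * ρ * ‖u - v‖ := by
  obtain ⟨K, hK0, hK⟩ := hF.norm_sub_sub_le (‖p‖ + ρ₀ + 1)
  refine ⟨K, hK0, fun ρ hρ u v hu hv => ?_⟩
  have hρ0 : 0 ≤ ρ := (norm_nonneg _).trans hu
  refine (BoundedContinuousFunction.norm_le (by positivity)).2 fun t => ?_
  refine (hK (p t) (u t) (v t) ρ (by linarith [p.norm_coe_le_norm t])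
    (((u - p).norm_coe_le_norm t).trans hu) (((v - p).norm_coe_le_norm t).trans hv)).trans ?_
  gcongr
  exact (u - v).norm_coe_le_norm t

end Superposition

/-! ### The linear flow -/

/-- The sequence `ω` of positive integers grows linearly. -/
structure Growth (ω : ℕ → ℕ) (a b : ℝ) : Prop where
  pos : ∀ j, 0 < ω j
  a_pos : 0 < a
  lower : ∀ j : ℕ, a * ((j : ℝ) + 1) ≤ ω j
  upper : ∀ j : ℕ, (ω j : ℝ) ≤ b * ((j : ℝ) + 1)

theorem exists_growth {ω : ℕ → ℕ} (hωpos : ∀ j, 0 < ω j)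
    (hω : (fun j : ℕ => (ω j : ℝ)) =Θ[atTop] (fun j : ℕ => (j : ℝ))) : ∃ a b, Growth ω a b := by
  obtain ⟨b, hb, hub⟩ := hω.1.exists_pos
  obtain ⟨c, hc, hlb⟩ := hω.2.exists_pos
  obtain ⟨N, hN⟩ := eventually_atTop.1 (hub.bound.and hlb.bound)
  have hpos1 : ∀ j, (1 : ℝ) ≤ ω j := fun j => by exact_mod_cast hωpos j
  have hcN : 0 < c + N + 1 := by positivity
  refine ⟨(c + N + 1)⁻¹, b + ∑ j ∈ Finset.range N, (ω j : ℝ), hωpos, inv_pos.2 hcN, fun j => ?_,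
    fun j => ?_⟩
  · rw [inv_mul_le_iff₀ hcN]
    have h1 := hpos1 j
    rcases le_or_gt N j with h | h
    · have h2 := (hN j h).2
      rw [Real.norm_natCast, Real.norm_natCast] at h2
      have : (0 : ℝ) ≤ N * ω j := by positivity
      nlinarith
    · have h2 : (j : ℝ) + 1 ≤ N := by exact_mod_cast h
      have h3 : (0 : ℝ) ≤ (c + 1) * ω j := by positivity
      nlinarith
  · have hS : (0 : ℝ) ≤ ∑ j ∈ Finset.range N, (ω j : ℝ) := Finset.sum_nonneg fun _ _ => by positivity
    rcases le_or_gt N j with h | h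
    · have h2 := (hN j h).1
      rw [Real.norm_natCast, Real.norm_natCast] at h2
      have : 0 ≤ (∑ j ∈ Finset.range N, (ω j : ℝ)) * (j + 1) := by positivity
      nlinarith
    · have h2 : (ω j : ℝ) ≤ ∑ j ∈ Finset.range N, (ω j : ℝ) :=
        Finset.single_le_sum (f := fun j => (ω j : ℝ)) (fun _ _ => by positivity)
          (Finset.mem_range.2 h)
      have h3 : 0 ≤ (∑ j ∈ Finset.range N, (ω j : ℝ)) * j := by positivity
      have h4 : 0 ≤ b * ((j : ℝ) + 1) := by positivity
      nlinarith

theorem Growth.b_pos {ω : ℕ → ℕ} {a b : ℝ} (G : Growth ω a b) : 0 < b := by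
  have h1 := G.lower 0
  have h2 := G.upper 0
  have h3 := G.a_pos
  norm_num at h1 h2
  linarith

/-- The cosine flow from `l²_s` to `l²_r`, where `r ≤ s`. -/
def cosFlow (ω : ℕ → ℕ) {s r : ℝ} (h : r ≤ s) : DiagKernel s r where
  coef t j := Real.cos (ω j * t)
  bd := 1
  le_bd t j := mul_le_mul (Real.abs_cos_le_one _) (wt_mono h j) (wt_pos r j).le zero_le_one
  cont j := by fun_prop

/-- The sine flow from `l²_s` to `l²_r`, where `r ≤ s`. -/
def sinFlow (ω : ℕ → ℕ) {s r : ℝ} (h : r ≤ s) : DiagKernel s r where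
  coef t j := Real.sin (ω j * t)
  bd := 1
  le_bd t j := mul_le_mul (Real.abs_sin_le_one _) (wt_mono h j) (wt_pos r j).le zero_le_one
  cont j := by fun_prop

/-- The time derivative of the cosine flow. -/
def velFlow {ω : ℕ → ℕ} {a b : ℝ} (G : Growth ω a b) (s : ℝ) : DiagKernel (s + 1) s where
  coef t j := -(ω j * Real.sin (ω j * t))
  bd := b
  le_bd t j := by
    rw [abs_neg, abs_mul, wt_add, wt_one, Nat.abs_cast, mul_comm (wt s j), ← mul_assoc]
    refine mul_le_mul_of_nonneg_right ?_ (wt_pos s j).le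
    exact (mul_le_of_le_one_right (by positivity) (Real.abs_sin_le_one _)).trans (G.upper j)
  cont j := by fun_prop

theorem le_add_one_self (s : ℝ) : s ≤ s + 1 := by linarith

/-- The velocity costs one derivative, which is why the kernel component lives in `l²_{s+1}`.
Differentiability in norm follows from the coordinates by writing the orbit as the primitive of its
norm-continuous velocity. -/
theorem hasDerivAt_cosFlow {ω : ℕ → ℕ} {a b : ℝ} (G : Growth ω a b) {s : ℝ} (ξ : ellW (s + 1))
    (t : ℝ) : HasDerivAt ((cosFlow ω (le_add_one_self s)).orbit ξ) ((velFlow G s).orbit ξ t) t := by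
  have hc : Continuous ((velFlow G s).orbit ξ) := ((velFlow G s).orbit ξ).continuous
  have e : ((cosFlow ω (le_add_one_self s)).orbit ξ : ℝ → ellW s)
      = fun t => (∫ τ in (0 : ℝ)..t, (velFlow G s).orbit ξ τ)
        + (cosFlow ω (le_add_one_self s)).orbit ξ 0 := by
    funext t
    refine ellW.ext fun j => ?_
    rw [ellW.add_apply, ellW.intervalIntegral_apply hc]
    have h1 : ∀ τ ∈ uIcc 0 t, HasDerivAt (fun τ => (cosFlow ω (le_add_one_self s)).orbit ξ τ j)
        ((velFlow G s).orbit ξ τ j) τ := fun τ _ => by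
      change HasDerivAt (fun τ => Real.cos (ω j * τ) * ξ j) (-(ω j * Real.sin (ω j * τ)) * ξ j) τ
      have h2 : HasDerivAt (fun t : ℝ => Real.cos (ω j * t)) (-Real.sin (ω j * τ) * ω j) τ := by
        simpa only [mul_one, id_eq] using ((hasDerivAt_id τ).const_mul (ω j : ℝ)).cos
      refine (h2.mul_const (ξ j)).congr_deriv ?_
      ring
    rw [intervalIntegral.integral_eq_sub_of_hasDerivAt h1
      ((ellW.continuous_apply hc j).intervalIntegrable _ _), sub_add_cancel]
  rw [e]
  exact ((hc.integral_hasStrictDerivAt 0 t).hasDerivAt).add_const _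

/-! ### Even periodic Lipschitz functions -/

/-- `g` is `2π`-periodic, even and Lipschitz. -/
structure IsReg {s : ℝ} (L : ℝ) (g : ℝ →ᵇ ellW s) : Prop where
  per : Function.Periodic g (2 * π)
  even : ∀ t, g (-t) = g t
  lip : ∀ t t', ‖g t - g t'‖ ≤ L * |t - t'|

namespace IsReg

variable {s L L' : ℝ} {g h : ℝ →ᵇ ellW s}

theorem mono (hg : IsReg L g) (hL : L ≤ L') : IsReg L' g :=
  ⟨hg.per, hg.even, fun t t' => (hg.lip t t').trans
    (mul_le_mul_of_nonneg_right hL (abs_nonneg _))⟩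

theorem nonneg (hg : IsReg L g) : 0 ≤ L := by
  have := (norm_nonneg _).trans (hg.lip 1 0)
  simpa using this

theorem zero : IsReg 0 (0 : ℝ →ᵇ ellW s) := ⟨fun _ => rfl, fun _ => rfl, fun t t' => by simp⟩

theorem add (hg : IsReg L g) (hh : IsReg L' h) : IsReg (L + L') (g + h) :=
  ⟨hg.per.add hh.per, fun t => congrArg₂ (· + ·) (hg.even t) (hh.even t), fun t t' => by
    rw [BoundedContinuousFunction.add_apply, BoundedContinuousFunction.add_apply,
      add_sub_add_comm, add_mul]
    exact (norm_add_le _ _).trans (add_le_add (hg.lip t t') (hh.lip t t'))⟩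

theorem smul (c : ℝ) (hg : IsReg L g) : IsReg (|c| * L) (c • g) :=
  ⟨fun t => congrArg (c • ·) (hg.per t), fun t => congrArg (c • ·) (hg.even t), fun t t' => by
    rw [BoundedContinuousFunction.smul_apply, BoundedContinuousFunction.smul_apply, ← smul_sub,
      norm_smul, Real.norm_eq_abs, mul_assoc]
    exact mul_le_mul_of_nonneg_left (hg.lip t t') (abs_nonneg c)⟩

theorem bilin (B : ellW s →L[ℝ] ellW s →L[ℝ] ellW s) (hg : IsReg L g) (hh : IsReg L' h) :
    IsReg (‖B‖ * (L * ‖h‖ + ‖g‖ * L')) (bilinX B g h) :=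
  ⟨fun t => congrArg₂ (fun x y => B x y) (hg.per t) (hh.per t),
    fun t => congrArg₂ (fun x y => B x y) (hg.even t) (hh.even t), fun t t' => by
    have e : bilinX B g h t - bilinX B g h t'
        = B (g t - g t') (h t) + B (g t') (h t - h t') := by
      simp only [bilinX_apply, map_sub, sub_apply]
      abel
    have h1 : ‖B (g t - g t') (h t)‖ ≤ ‖B‖ * (L * |t - t'|) * ‖h‖ :=
      (B.le_opNorm₂ _ _).trans (by
        have := mul_nonneg hg.nonneg (abs_nonneg (t - t'))
        gcongr
        exacts [hg.lip t t', h.norm_coe_le_norm t])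
    have h2 : ‖B (g t') (h t - h t')‖ ≤ ‖B‖ * ‖g‖ * (L' * |t - t'|) :=
      (B.le_opNorm₂ _ _).trans (by
        gcongr
        exacts [g.norm_coe_le_norm t', hh.lip t t'])
    rw [e]
    refine (norm_add_le _ _).trans ((add_le_add h1 h2).trans (le_of_eq ?_))
    ring⟩

theorem conv_greenKernel {ω : ℕ → ℕ} {α w : ℝ} (ha : Admissible ω α w) (hg : IsReg L g) :
    IsReg ((greenKernel s ha).bd * L) ((greenKernel s ha).conv g) :=
  ⟨DiagKernel.conv_periodic _ hg.per, greenKernel_conv_even ha hg.per hg.even, fun t t' => by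
    rw [mul_assoc]
    refine DiagKernel.norm_conv_sub_le _ _ fun τ => (hg.lip _ _).trans (le_of_eq ?_)
    rw [sub_sub_sub_cancel_right]⟩

theorem isClosed (L : ℝ) : IsClosed {g : ℝ →ᵇ ellW s | IsReg L g} := by
  have hc : ∀ t : ℝ, Continuous fun g : ℝ →ᵇ ellW s => g t := fun t =>
    continuous_eval_const t
  have e : {g : ℝ →ᵇ ellW s | IsReg L g} = (⋂ t, {g | g (t + 2 * π) = g t})
      ∩ (⋂ t, {g | g (-t) = g t}) ∩ ⋂ t, ⋂ t', {g | ‖g t - g t'‖ ≤ L * |t - t'|} := by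
    ext g
    simp only [mem_inter_iff, mem_iInter, mem_ofPred_eq]
    exact ⟨fun h => ⟨⟨h.per, h.even⟩, h.lip⟩, fun h => ⟨h.1.1, h.1.2, h.2⟩⟩
  rw [e]
  refine IsClosed.inter (IsClosed.inter ?_ ?_) ?_
  · exact isClosed_iInter fun t => isClosed_eq (hc _) (hc _)
  · exact isClosed_iInter fun t => isClosed_eq (hc _) (hc _)
  · exact isClosed_iInter fun t => isClosed_iInter fun t' =>
      isClosed_le ((hc t).sub (hc t')).norm continuous_const

theorem orbit_cosFlow {ω : ℕ → ℕ} {a b : ℝ} (G : Growth ω a b) (ξ : ellW (s + 1)) :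
    IsReg (b * ‖ξ‖) ((cosFlow ω (le_add_one_self s)).orbit ξ) :=
  ⟨fun t => ellW.ext fun j => by
      have := cos_int_mul_periodic (ω j) t
      simp only [Int.cast_natCast] at this
      change Real.cos _ * ξ j = Real.cos _ * ξ j
      rw [this],
    fun t => ellW.ext fun j => by
      change Real.cos _ * ξ j = Real.cos _ * ξ j
      rw [mul_neg, Real.cos_neg],
    fun t t' => by
      have := Convex.norm_image_sub_le_of_norm_hasDerivWithin_le (s := univ)
        (f := ((cosFlow ω (le_add_one_self s)).orbit ξ : ℝ → ellW s))
        (fun x _ => (hasDerivAt_cosFlow G ξ x).hasDerivWithinAt)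
        (fun x _ => (velFlow G s).norm_op_apply_le x ξ) convex_univ (mem_univ t') (mem_univ t)
      rwa [Real.norm_eq_abs] at this⟩

variable {C : ℕ → ℕ → ℕ → ℕ → ℝ} {F : ellW s → ellW s}

theorem superpos (hF : IsCubicMap C F) (R : ℝ) : ∃ K, 0 ≤ K ∧ ∀ (L : ℝ) (g : ℝ →ᵇ ellW s),
    ‖g‖ ≤ R → IsReg L g → IsReg (K * L) (hF.superpos g) := by
  obtain ⟨K, hK0, hK⟩ := hF.exists_lipschitz R
  refine ⟨K, hK0, fun L g hR hg => ⟨fun t => congrArg F (hg.per t), fun t => congrArg F (hg.even t),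
    fun t t' => ?_⟩⟩
  rw [mul_assoc]
  exact (hK _ _ ((g.norm_coe_le_norm t).trans hR) ((g.norm_coe_le_norm t').trans hR)).trans
    (mul_le_mul_of_nonneg_left (hg.lip t t') hK0)

theorem diffX (hF : IsCubicMap C F) (hg : IsReg L g) (hh : IsReg L' h) :
    ∃ K, IsReg K (hF.diffX g h) := by
  obtain ⟨K₁, hK₁0, hK₁⟩ := hF.lipschitz (‖g‖ + 1)
  obtain ⟨K₂, hK₂0, hK₂⟩ := hF.exists_norm_fderiv_le ‖g‖
  refine ⟨K₁ * L * ‖h‖ + K₂ * L', fun t => ?_, fun t => ?_, fun t t' => ?_⟩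
  · rw [IsCubicMap.diffX_apply, hg.per, hh.per]
    rfl
  · rw [IsCubicMap.diffX_apply, hg.even, hh.even]
    rfl
  · have e : hF.diffX g h t - hF.diffX g h t' = (fderiv ℝ F (g t) - fderiv ℝ F (g t')) (h t)
        + fderiv ℝ F (g t') (h t - h t') := by
      simp only [IsCubicMap.diffX_apply, map_sub, sub_apply]
      abel
    have h1 : ‖(fderiv ℝ F (g t) - fderiv ℝ F (g t')) (h t)‖ ≤ K₁ * (L * |t - t'|) * ‖h‖ := by
      refine (ContinuousLinearMap.le_opNorm _ _).trans ?_
      have h2 := hK₁ (g t) (g t') (by linarith [g.norm_coe_le_norm t])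
        (by linarith [g.norm_coe_le_norm t'])
      have h3 := mul_le_mul_of_nonneg_left (hg.lip t t') hK₁0
      exact mul_le_mul (h2.trans h3) (h.norm_coe_le_norm t) (norm_nonneg _)
        ((norm_nonneg _).trans (h2.trans h3))
    have h2 : ‖fderiv ℝ F (g t') (h t - h t')‖ ≤ K₂ * (L' * |t - t'|) :=
      (ContinuousLinearMap.le_opNorm _ _).trans (mul_le_mul (hK₂ _ (g.norm_coe_le_norm t'))
        (hh.lip t t') (norm_nonneg _) hK₂0)
    rw [e]
    refine (norm_add_le _ _).trans ((add_le_add h1 h2).trans (le_of_eq ?_))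
    ring

end IsReg

/-! ### The average -/

theorem cosFlow_mean_apply (ω : ℕ → ℕ) {s : ℝ} (g : ℝ →ᵇ ellW s) (m : ℕ) :
    (cosFlow ω le_rfl).mean g m = cosCoeff (fun t => g t m) (ω m) := by
  rw [DiagKernel.mean_apply, cosCoeff, Int.cast_natCast]
  rfl

/-- The average of a regular function gains one derivative. -/
theorem IsReg.memW_mean {ω : ℕ → ℕ} {a b : ℝ} (G : Growth ω a b) {s L : ℝ} {g : ℝ →ᵇ ellW s}
    (hg : IsReg L g) : MemW (s + 1) ((cosFlow ω (le_refl s)).mean g) := by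
  set c := (cosFlow ω (le_refl s)).mean g with hc
  have hcm : ∀ m, c m = (2 * π)⁻¹ * ∫ t in (0 : ℝ)..(2 * π), Real.cos (ω m * t) * g t m :=
    fun m => DiagKernel.mean_apply _ g m
  have hgc : ∀ m, Continuous fun t => g t m := fun m => ellW.continuous_apply g.continuous m
  have hsin0 : ∀ m, ∫ t in (0 : ℝ)..(2 * π), Real.sin (ω m * t) * g t m = 0 := fun m =>
    integral_eq_zero_of_odd_of_periodic (fun t => by rw [hg.even, mul_neg, Real.sin_neg, neg_mul])
      (by
        have := (sin_int_mul_periodic (ω m)).mul (ellW.periodic_apply hg.per m)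
        simp only [Int.cast_natCast] at this
        exact this)
  -- The sine mean of the increment `g (t + h) - g t` recovers the cosine coefficient times `-sin (ω
  -- m h)`, since the sine coefficients of the even function `g` vanish. Difference quotients
  -- replace the derivative, which a Lipschitz function need not have everywhere.
  have key : ∀ h : ℝ, ∀ m,
      (sinFlow ω (le_refl s)).meanFun (fun t => g (t + h) - g t) m = -(Real.sin (ω m * h) * c m) := by
    intro h m
    have hgh : Continuous fun t => g (t + h) := g.continuous.comp (by fun_prop)
    refine (DiagKernel.meanFun_apply _ (hgh.sub g.continuous) m).trans ?_
    change (2 * π)⁻¹ * ∫ t in (0 : ℝ)..(2 * π), Real.sin (ω m * t) * (g (t + h) m - g t m) = _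
    have hc1 : Continuous fun t => g (t + h) m :=
      ellW.continuous_apply (g.continuous.comp (by fun_prop)) m
    have hc2 := hgc m
    simp_rw [mul_sub]
    rw [intervalIntegral.integral_sub (Continuous.intervalIntegrable (by fun_prop) _ _)
      (Continuous.intervalIntegrable (by fun_prop) _ _), hsin0, sub_zero]
    have hp : Function.Periodic (fun t => Real.sin (ω m * (t - h)) * g t m) (2 * π) := by
      intro t
      have h2 := sin_int_mul_periodic (ω m) (t - h)
      have h3 : t + 2 * π - h = t - h + 2 * π := by ring
      simp only [Int.cast_natCast] at h2
      simp only
      rw [hg.per t, h3, h2]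
    have h1 := intervalIntegral.integral_comp_add_right (a := 0) (b := 2 * π)
      (fun t => Real.sin (ω m * (t - h)) * g t m) h
    simp only [add_sub_cancel_right, zero_add] at h1
    have h4 := hp.intervalIntegral_add_eq h 0
    rw [zero_add, add_comm] at h4
    rw [h1, h4]
    have e2 : ∀ t : ℝ, Real.sin (ω m * (t - h)) * g t m
        = Real.cos (ω m * h) * (Real.sin (ω m * t) * g t m)
          - Real.sin (ω m * h) * (Real.cos (ω m * t) * g t m) := fun t => by
      rw [mul_sub, Real.sin_sub]
      ring
    simp_rw [e2]
    rw [intervalIntegral.integral_sub (Continuous.intervalIntegrable (by fun_prop) _ _)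
      (Continuous.intervalIntegrable (by fun_prop) _ _), intervalIntegral.integral_const_mul,
      intervalIntegral.integral_const_mul, hsin0, hcm]
    ring
  -- Finite sums are bounded uniformly in `h`. As `h → 0` the quotient `sin (ω m h) / h` tends to `ω
  -- m`, and the growth of `ω` converts this factor into one more weight.
  have hfin : ∀ S : Finset ℕ, ∀ h : ℝ, h ≠ 0 →
      ∑ m ∈ S, (wt s m * (Real.sin (ω m * h) / h * c m)) ^ 2 ≤ L ^ 2 := by
    intro S h hh
    have h1 : ‖(sinFlow ω (le_refl s)).meanFun (fun t => g (t + h) - g t)‖ ≤ 1 * (L * |h|) :=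
      DiagKernel.norm_meanFun_le _ fun t => by
        have := hg.lip (t + h) t
        rwa [add_sub_cancel_left] at this
    rw [one_mul] at h1
    have h2 := pow_le_pow_left₀ (norm_nonneg _) h1 2
    rw [ellW.norm_sq, mul_pow, sq_abs] at h2
    have h3 := (Summable.sum_le_tsum S (fun m _ => sq_nonneg _)
      ((sinFlow ω (le_refl s)).meanFun (fun t => g (t + h) - g t)).2).trans h2
    have h4 : ∀ m, (wt s m * (Real.sin (ω m * h) / h * c m)) ^ 2
        = (wt s m * (sinFlow ω (le_refl s)).meanFun (fun t => g (t + h) - g t) m) ^ 2 / h ^ 2 := by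
      intro m
      rw [key]
      field_simp
    simp_rw [h4]
    rw [← Finset.sum_div, div_le_iff₀ (by positivity)]
    exact h3
  have hlim : ∀ m, Tendsto (fun h : ℝ => Real.sin (ω m * h) / h) (𝓝[≠] 0) (𝓝 (ω m : ℝ)) := by
    intro m
    have h2 : HasDerivAt (fun h : ℝ => Real.sin (ω m * h)) (ω m : ℝ) 0 := by
      simpa using ((hasDerivAt_id (0 : ℝ)).const_mul (ω m : ℝ)).sin
    have := h2.tendsto_slope
    refine this.congr fun h => ?_
    simp [slope, div_eq_inv_mul]
  have hsum : Summable fun m => (wt s m * (ω m * c m)) ^ 2 := by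
    refine summable_of_sum_le (c := L ^ 2) (fun m => sq_nonneg _) fun S => ?_
    refine le_of_tendsto (f := fun h : ℝ => ∑ m ∈ S, (wt s m * (Real.sin (ω m * h) / h * c m)) ^ 2)
      (x := 𝓝[≠] 0) ?_ (eventually_nhdsWithin_of_forall fun h hh => hfin S h hh)
    exact tendsto_finsetSum _ fun m _ => (((hlim m).mul_const _).const_mul _).pow 2
  refine memW_of_abs_le (s' := s) (v := fun m => ω m * c m) hsum (C := a⁻¹) fun m => ?_
  rw [wt_add, wt_one, abs_mul, abs_mul, abs_mul, abs_mul, abs_of_pos (wt_pos s m), Nat.abs_cast,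
    abs_of_nonneg (by positivity : (0 : ℝ) ≤ (m : ℝ) + 1), ← div_eq_inv_mul, le_div_iff₀ G.a_pos]
  have := mul_le_mul_of_nonneg_left (G.lower m) (mul_nonneg (wt_pos s m).le (abs_nonneg (c m)))
  linarith

/-! ### The inverse of the linear part -/

/-- The operators `A⁻¹ χ_S`, where `χ_S` restricts to the set `S` of indices. -/
def invOp {ω : ℕ → ℕ} {a b : ℝ} (G : Growth ω a b) {s r : ℝ} (h : r ≤ s + 2) :
    DiagFamily (Set ℕ) s r where
  coef S j := S.indicator (fun j => ((ω j : ℝ) ^ 2)⁻¹) j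
  bd := (a ^ 2)⁻¹
  le_bd S j := by
    have hω : (0 : ℝ) < ω j := by exact_mod_cast G.pos j
    have ha := G.a_pos
    have h1 : |S.indicator (fun j => ((ω j : ℝ) ^ 2)⁻¹) j| ≤ ((ω j : ℝ) ^ 2)⁻¹ := by
      by_cases hj : j ∈ S
      · rw [indicator_of_mem hj, abs_of_pos (by positivity)]
      · rw [indicator_of_notMem hj, abs_zero]
        positivity
    have h2 := wt_mono h j
    have h3 : wt (s + 2) j = wt s j * ((j : ℝ) + 1) ^ 2 := by
      rw [wt_add, wt, wt, Real.rpow_two]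
    have h4 : a ^ 2 * ((j : ℝ) + 1) ^ 2 ≤ (ω j : ℝ) ^ 2 := by
      rw [← mul_pow]
      exact pow_le_pow_left₀ (by positivity) (G.lower j) 2
    refine (mul_le_mul h1 (h2.trans_eq h3) (wt_pos r j).le (by positivity)).trans ?_
    rw [inv_mul_le_iff₀ (by positivity), mul_left_comm, ← div_eq_inv_mul,
      le_div_iff₀ (by positivity)]
    have := mul_le_mul_of_nonneg_left h4 (wt_pos s j).le
    linarith

theorem invOp_univ_apply {ω : ℕ → ℕ} {a b : ℝ} (G : Growth ω a b) {s r : ℝ} (h : r ≤ s + 2)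
    (u : ellW s) (j : ℕ) : (invOp G h).op univ u j = ((ω j : ℝ) ^ 2)⁻¹ * u j := by
  rw [DiagFamily.op_apply]
  simp [invOp]

/-- The operators of restriction to sets of indices. -/
def restrictOp (s : ℝ) : DiagFamily (Set ℕ) s s where
  coef S j := S.indicator (fun _ => 1) j
  bd := 1
  le_bd S j := by
    refine mul_le_mul_of_nonneg_right ?_ (wt_pos s j).le
    by_cases hj : j ∈ S
    · rw [indicator_of_mem hj, abs_one]
    · rw [indicator_of_notMem hj, abs_zero]
      exact zero_le_one

theorem restrictOp_univ (s : ℝ) (u : ellW s) : (restrictOp s).op univ u = u :=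
  ellW.ext fun j => by
    rw [DiagFamily.op_apply]
    simp [restrictOp]

theorem tendsto_restrictOp (s : ℝ) (u : ellW s) :
    Tendsto (fun N : ℕ => (restrictOp s).op (Iio N) u) atTop (𝓝 u) := by
  have := (restrictOp s).tendsto_op (l := atTop) (f := fun N : ℕ => Iio N) (p := univ)
    (fun j => tendsto_const_nhds.congr' (by
      filter_upwards [eventually_gt_atTop j] with N hN
      simp [restrictOp, indicator_of_mem, mem_Iio.2 hN])) u
  rwa [restrictOp_univ] at this

theorem memW_restrictOp (s r : ℝ) (u : ellW s) (N : ℕ) : MemW r ((restrictOp s).op (Iio N) u) := by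
  refine summable_of_hasFiniteSupport ((finite_Iio N).subset fun j hj => ?_)
  by_contra h
  refine hj ?_
  simp only
  rw [DiagFamily.op_apply]
  simp [restrictOp, indicator_of_notMem h]

/-- Non-resonance is assumed on `l²_{s+3}` but needed on `l²_{s+1}`. Finite truncations lie in every
weighted space and are dense, and the average is continuous. -/
theorem mean_bilin_eq_zero {ω : ℕ → ℕ} {s : ℝ} {D : ℕ → ℕ → ℕ → ℝ}
    {B : ellW s →L[ℝ] ellW s →L[ℝ] ellW s}
    (hB : ∀ u v m, B u v m = -3 * ∑' p : ℕ × ℕ, D p.1 p.2 m * u p.1 * v p.2)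
    (hnonres : ∀ x : ellW (s + 3), flowAverage ω (quadTerm D) x = 0) (ξ : ellW (s + 1)) :
    (cosFlow ω le_rfl).mean (bilinX B ((cosFlow ω (le_add_one_self s)).orbit ξ)
      ((cosFlow ω (le_add_one_self s)).orbit ξ)) = 0 := by
  set f : ellW (s + 1) → ellW s := fun ξ => (cosFlow ω le_rfl).mean
    (bilinX B ((cosFlow ω (le_add_one_self s)).orbit ξ)
      ((cosFlow ω (le_add_one_self s)).orbit ξ)) with hf
  have hfc : Continuous f := by
    refine (cosFlow ω le_rfl).mean.continuous.comp ?_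
    have h1 := (cosFlow ω (le_add_one_self s)).orbit.continuous
    exact ((bilinX B).continuous.comp h1).clm_apply h1
  have h0 : ∀ N : ℕ, f ((restrictOp (s + 1)).op (Iio N) ξ) = 0 := by
    intro N
    refine ellW.ext fun m => ?_
    have h1 := congrFun (hnonres ⟨(restrictOp (s + 1)).op (Iio N) ξ, memW_restrictOp _ _ ξ N⟩) m
    rw [hf]
    simp only
    rw [DiagKernel.mean_apply]
    refine Eq.trans ?_ h1
    rw [flowAverage]
    congr 2
    funext t
    rw [bilinX_apply, hB]
    rfl
  have h2 := (hfc.tendsto ξ).comp (tendsto_restrictOp (s + 1) ξ)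
  have h3 : (f ∘ fun N : ℕ => (restrictOp (s + 1)).op (Iio N) ξ) = fun _ => 0 := funext h0
  rw [h3] at h2
  exact tendsto_nhds_unique h2 tendsto_const_nhds

/-! ### The functional equation -/

/-- The inclusion of `l²_s` into `l²_r` as a bounded operator. -/
def inclL {s r : ℝ} (h : r ≤ s) : ellW s →L[ℝ] ellW r :=
  LinearMap.mkContinuous (ellW.incl h) 1 fun u => ellW.norm_le_of_abs_le zero_le_one fun j => by
    rw [one_mul, abs_mul, abs_mul, abs_of_pos (wt_pos r j), abs_of_pos (wt_pos s j)]
    exact mul_le_mul_of_nonneg_right (wt_mono h j) (abs_nonneg _)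

@[simp] theorem inclL_apply {s r : ℝ} (h : r ≤ s) (u : ellW s) (j : ℕ) : inclL h u j = u j := rfl

theorem inclL_coe {s r : ℝ} (h : r ≤ s) (u : ellW s) : (inclL h u).1 = u.1 :=
  funext (inclL_apply h u)

/-- The extension of a vector by zeros. -/
def ofFin (s : ℝ) (N : ℕ) : (Fin N → ℝ) →L[ℝ] ellW s :=
  LinearMap.toContinuousLinearMap
    { toFun := fun x => ⟨fun j => if h : j < N then x ⟨j, h⟩ else 0, by
        refine summable_of_hasFiniteSupport ((finite_Iio N).subset fun j hj => ?_)
        by_contra h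
        refine hj ?_
        simp only
        rw [dif_neg (fun hj => h (mem_Iio.2 hj))]
        simp⟩
      map_add' := fun x y => ellW.ext fun j => by
        change (if h : j < N then x ⟨j, h⟩ + y ⟨j, h⟩ else 0)
          = (if h : j < N then x ⟨j, h⟩ else 0) + if h : j < N then y ⟨j, h⟩ else 0
        split_ifs <;> simp
      map_smul' := fun c x => ellW.ext fun j => by
        change (if h : j < N then c * x ⟨j, h⟩ else 0) = c * if h : j < N then x ⟨j, h⟩ else 0
        split_ifs <;> simp }

theorem restrictOp_eq_ofFin {s : ℝ} (N : ℕ) (u : ellW s) :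
    (restrictOp s).op (Iio N) u = ofFin s N fun i => u i := by
  refine ellW.ext fun j => ?_
  change (Iio N).indicator (fun _ => (1 : ℝ)) j * u j = if h : j < N then u j else 0
  split_ifs with h
  · rw [indicator_of_mem (mem_Iio.2 h), one_mul]
  · rw [indicator_of_notMem (fun hj => h (mem_Iio.1 hj)), zero_mul]

theorem isCompactOperator_restrictOp (s : ℝ) (N : ℕ) :
    IsCompactOperator ((restrictOp s).op (Iio N)) := by
  have e : (restrictOp s).op (Iio N)
      = (ofFin s N).comp (ContinuousLinearMap.pi fun i : Fin N => coordL s i) := by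
    ext u : 1
    exact restrictOp_eq_ofFin N u
  rw [e]
  exact (isCompactOperator_of_locallyCompactSpace_dom
    (ContinuousLinearMap.pi fun i : Fin N => coordL s i)).clm_comp (ofFin s N)

/-- `A⁻¹` gains two weights and only one is used; the spare one makes the error of the truncation at
`N` of order `1 / (N + 1)`, so `A⁻¹` is a norm limit of finite rank operators. -/
theorem isCompactOperator_invOp {ω : ℕ → ℕ} {a b : ℝ} (G : Growth ω a b) (s : ℝ) :
    IsCompactOperator ((invOp G (by linarith : s + 1 ≤ s + 2)).op univ) := by
  set T := (invOp G (by linarith : s + 1 ≤ s + 2)).op univ with hT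
  have ha := G.a_pos
  refine isCompactOperator_of_tendsto (l := atTop)
    (F := fun N : ℕ => T.comp ((restrictOp s).op (Iio N))) (f := T) ?_
    (Eventually.of_forall fun N => (isCompactOperator_restrictOp s N).clm_comp T)
  rw [tendsto_iff_norm_sub_tendsto_zero]
  have h0 : Tendsto (fun N : ℕ => (a ^ 2)⁻¹ * (1 / ((N : ℝ) + 1))) atTop (𝓝 0) := by
    simpa using tendsto_one_div_add_atTop_nhds_zero_nat.const_mul ((a ^ 2)⁻¹)
  refine squeeze_zero (fun _ => norm_nonneg _) (fun N => ?_) h0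
  refine ContinuousLinearMap.opNorm_le_bound _ (by positivity) fun u =>
    ellW.norm_le_of_abs_le (by positivity) fun j => ?_
  have e : (T.comp ((restrictOp s).op (Iio N)) - T) u j
      = ((ω j : ℝ) ^ 2)⁻¹ * ((Iio N).indicator (fun _ => (1 : ℝ)) j * u j)
        - ((ω j : ℝ) ^ 2)⁻¹ * u j := by
    have h1 := invOp_univ_apply G (by linarith : s + 1 ≤ s + 2) u j
    have h2 := invOp_univ_apply G (by linarith : s + 1 ≤ s + 2) ((restrictOp s).op (Iio N) u) j
    exact congrArg₂ (· - ·) h2 h1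
  rw [e]
  by_cases hj : j ∈ Iio N
  · rw [indicator_of_mem hj, one_mul, sub_self, mul_zero, abs_zero]
    positivity
  · have hj' : (N : ℝ) ≤ j := by exact_mod_cast not_lt.1 hj
    have hω : (0 : ℝ) < ω j := by exact_mod_cast G.pos j
    rw [indicator_of_notMem hj, zero_mul, mul_zero, zero_sub, mul_neg, abs_neg, abs_mul, abs_mul,
      abs_mul, wt_add, wt_one, abs_mul (wt s j), abs_of_pos (wt_pos s j), abs_of_pos (by positivity : (0 : ℝ) < ((ω j : ℝ) ^ 2)⁻¹),
      abs_of_pos (by positivity : (0 : ℝ) < (j : ℝ) + 1)]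
    have h4 : a ^ 2 * ((j : ℝ) + 1) ^ 2 ≤ (ω j : ℝ) ^ 2 := by
      rw [← mul_pow]
      exact pow_le_pow_left₀ (by positivity) (G.lower j) 2
    have h5 : ((ω j : ℝ) ^ 2)⁻¹ ≤ (a ^ 2 * ((j : ℝ) + 1) ^ 2)⁻¹ :=
      inv_anti₀ (by positivity) h4
    have h6 : ((j : ℝ) + 1) * ((ω j : ℝ) ^ 2)⁻¹ ≤ (a ^ 2)⁻¹ * (1 / ((N : ℝ) + 1)) := by
      have h7 : 1 / ((j : ℝ) + 1) ≤ 1 / ((N : ℝ) + 1) :=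
        one_div_le_one_div_of_le (by positivity) (by linarith)
      calc ((j : ℝ) + 1) * ((ω j : ℝ) ^ 2)⁻¹
          ≤ ((j : ℝ) + 1) * (a ^ 2 * ((j : ℝ) + 1) ^ 2)⁻¹ := by gcongr
        _ = (a ^ 2)⁻¹ * (1 / ((j : ℝ) + 1)) := by field_simp
        _ ≤ _ := by gcongr
    have := mul_le_mul_of_nonneg_left h6 (mul_nonneg (wt_pos s j).le (abs_nonneg (u j)))
    linarith

/-- The equation together with the derived data used to solve it. -/
structure Model (s : ℝ) (ω : ℕ → ℕ) (D : ℕ → ℕ → ℕ → ℝ) (C : ℕ → ℕ → ℕ → ℕ → ℝ) where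
  /-- the lower growth constant -/
  a : ℝ
  /-- the upper growth constant -/
  b : ℝ
  growth : Growth ω a b
  /-- the Diophantine constant -/
  α : ℝ
  α_pos : 0 < α
  α_le : α ≤ 1
  summable : ∀ (u v : ellW s) (m : ℕ), Summable fun p : ℕ × ℕ => D p.1 p.2 m * u p.1 * v p.2
  /-- the bilinear map of the quadratic term -/
  B : ellW s →L[ℝ] ellW s →L[ℝ] ellW s
  B_apply : ∀ u v m, B u v m = -3 * ∑' p : ℕ × ℕ, D p.1 p.2 m * u p.1 * v p.2
  B_symm : ∀ u v, B u v = B v u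
  /-- the cubic map -/
  F : ellW s → ellW s
  cubic : IsCubicMap C F
  nonres : ∀ ξ : ellW (s + 1),
    (cosFlow ω le_rfl).mean (bilinX B ((cosFlow ω (le_add_one_self s)).orbit ξ)
      ((cosFlow ω (le_add_one_self s)).orbit ξ)) = 0

theorem exists_model {s : ℝ} {ω : ℕ → ℕ} (hωpos : ∀ j, 0 < ω j)
    (hω : (fun j : ℕ => (ω j : ℝ)) =Θ[atTop] (fun j : ℕ => (j : ℝ)))
    {D : ℕ → ℕ → ℕ → ℝ} {C : ℕ → ℕ → ℕ → ℕ → ℝ} (hDsymm : ∀ i j m, D i j m = D j i m)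
    (hDsum : ∀ (u : ellW s) (m : ℕ), Summable fun p : ℕ × ℕ => D p.1 p.2 m * u p.1 * u p.2)
    (hf2 : IsC11On s (quadTerm D)) (hf3 : IsC11On s (cubicTerm C))
    (hnonres : ∀ x : ellW (s + 3), flowAverage ω (quadTerm D) x = 0)
    {α : ℝ} (hα0 : 0 < α) (hα : α ≤ 1) : ∃ P : Model s ω D C, P.α = α := by
  obtain ⟨a, b, G⟩ := exists_growth hωpos hω
  obtain ⟨B, hB, hBs⟩ := exists_bilinear hDsymm hDsum hf2
  obtain ⟨F, hF⟩ := exists_isCubicMap hf3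
  exact ⟨⟨a, b, G, α, hα0, hα, summable_bilinear hDsum, B, hB, hBs, F, hF,
    mean_bilin_eq_zero hB hnonres⟩, rfl⟩

namespace Model

variable {s : ℝ} {ω : ℕ → ℕ} {D : ℕ → ℕ → ℕ → ℝ} {C : ℕ → ℕ → ℕ → ℕ → ℝ} (P : Model s ω D C)

/-- The orbits of the linear flow. -/
def Φ (_ : Model s ω D C) : ellW (s + 1) →L[ℝ] (ℝ →ᵇ ellW s) :=
  (cosFlow ω (le_add_one_self s)).orbit

theorem norm_Φ_le (ξ : ellW (s + 1)) : ‖P.Φ ξ‖ ≤ ‖ξ‖ := by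
  have := (cosFlow ω (le_add_one_self s)).norm_orbit_apply_le ξ
  rwa [cosFlow, one_mul] at this

theorem isReg_Φ (ξ : ellW (s + 1)) : IsReg (P.b * ‖ξ‖) (P.Φ ξ) := IsReg.orbit_cosFlow P.growth ξ

/-- The average along the linear flow. -/
def avg (_ : Model s ω D C) : (ℝ →ᵇ ellW s) →L[ℝ] ellW s := (cosFlow ω le_rfl).mean

theorem avg_apply (g : ℝ →ᵇ ellW s) (m : ℕ) : P.avg g m = cosCoeff (fun t => g t m) (ω m) :=
  cosFlow_mean_apply ω g m

/-- The bound of the inverses on the range. -/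
def κ : ℝ := (32 + 2 / P.α) * peakMass

theorem κ_nonneg : 0 ≤ P.κ := by
  have := P.α_pos
  have := peakMass_nonneg
  unfold κ
  positivity

theorem adm : Admissible ω P.α 1 := admissible_one P.growth.pos P.α_pos P.α_le

/-- The inverse on the range at the frequency `w`. -/
def inv (_ : Model s ω D C) {α w : ℝ} (h : Admissible ω α w) : (ℝ →ᵇ ellW s) →L[ℝ] (ℝ →ᵇ ellW s) :=
  (greenKernel s h).conv

theorem norm_inv_apply_le {w : ℝ} (h : Admissible ω P.α w) (g : ℝ →ᵇ ellW s) :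
    ‖P.inv h g‖ ≤ P.κ * ‖g‖ :=
  (greenKernel s h).norm_conv_apply_le g

theorem isReg_inv {w : ℝ} (h : Admissible ω P.α w) {L : ℝ} {g : ℝ →ᵇ ellW s} (hg : IsReg L g) :
    IsReg (P.κ * L) (P.inv h g) := hg.conv_greenKernel h

/-- The operator `-σ A⁻¹ ⟨·⟩`. -/
def proj (σ : ℝ) : (ℝ →ᵇ ellW s) →L[ℝ] ellW (s + 1) :=
  (-σ) • ((invOp P.growth (by linarith : s + 1 ≤ s + 2)).op univ).comp P.avg

theorem proj_apply (σ : ℝ) (g : ℝ →ᵇ ellW s) (m : ℕ) :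
    P.proj σ g m = -σ * (((ω m : ℝ) ^ 2)⁻¹ * P.avg g m) := by
  change -σ * ((invOp P.growth (by linarith : s + 1 ≤ s + 2)).op univ (P.avg g)) m = _
  rw [invOp_univ_apply]

/-- The data of the Lyapunov–Schmidt decomposition. -/
def bifData (σ : ℝ) (ξ₀ : ellW (s + 1)) : Bifurcation (ellW (s + 1)) (ℝ →ᵇ ellW s) where
  Φ := P.Φ
  B := bilinX P.B
  F := P.cubic.superpos
  A := P.proj σ
  R₁ := P.inv P.adm
  DF := P.cubic.diffX (P.Φ ξ₀)
  ξ₀ := ξ₀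
  -- The summand `4 κ ‖B‖ b` is the constant in `isClose_inv`; the others serve the bounds required
  -- by the structure.
  M := 1 + ‖ξ₀‖ + ‖P.B‖ + P.κ + ‖P.cubic.diffX (P.Φ ξ₀)‖ + 4 * P.κ * ‖P.B‖ * P.b
  one_le_M := by
    have := P.κ_nonneg
    have := P.growth.b_pos
    have : 0 ≤ ‖ξ₀‖ + ‖P.B‖ + P.κ + ‖P.cubic.diffX (P.Φ ξ₀)‖ + 4 * P.κ * ‖P.B‖ * P.b := by
      positivity
    linarith
  Φ_le x := by
    have := P.κ_nonneg
    have := P.growth.b_pos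
    refine (P.norm_Φ_le x).trans (le_mul_of_one_le_left (norm_nonneg x) ?_)
    have : 0 ≤ ‖ξ₀‖ + ‖P.B‖ + P.κ + ‖P.cubic.diffX (P.Φ ξ₀)‖ + 4 * P.κ * ‖P.B‖ * P.b := by
      positivity
    linarith
  B_le x y := by
    have := P.κ_nonneg
    have := P.growth.b_pos
    refine (norm_bilinX_le P.B x y).trans ?_
    rw [mul_assoc, mul_assoc]
    refine mul_le_mul_of_nonneg_right ?_ (by positivity)
    have : 0 ≤ 1 + ‖ξ₀‖ + P.κ + ‖P.cubic.diffX (P.Φ ξ₀)‖ + 4 * P.κ * ‖P.B‖ * P.b := by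
      positivity
    linarith
  R₁_le x := by
    have := P.κ_nonneg
    have := P.growth.b_pos
    refine (P.norm_inv_apply_le P.adm x).trans (mul_le_mul_of_nonneg_right ?_ (norm_nonneg x))
    have : 0 ≤ 1 + ‖ξ₀‖ + ‖P.B‖ + ‖P.cubic.diffX (P.Φ ξ₀)‖ + 4 * P.κ * ‖P.B‖ * P.b := by
      positivity
    linarith
  DF_le x := by
    have := P.κ_nonneg
    have := P.growth.b_pos
    refine (ContinuousLinearMap.le_opNorm _ x).trans
      (mul_le_mul_of_nonneg_right ?_ (norm_nonneg x))
    have : 0 ≤ 1 + ‖ξ₀‖ + ‖P.B‖ + P.κ + 4 * P.κ * ‖P.B‖ * P.b := by positivity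
    linarith
  ξ₀_le := by
    have := P.κ_nonneg
    have := P.growth.b_pos
    have : 0 ≤ ‖P.B‖ + P.κ + ‖P.cubic.diffX (P.Φ ξ₀)‖ + 4 * P.κ * ‖P.B‖ * P.b := by
      positivity
    linarith
  B_symm x y := by
    ext t : 1
    exact P.B_symm _ _
  F_lip ρ₀ := P.cubic.superpos_sub_le (P.Φ ξ₀) ρ₀

theorem kappa_add_le_M (σ : ℝ) (ξ₀ : ellW (s + 1)) :
    P.κ + 4 * P.κ * ‖P.B‖ * P.b ≤ (P.bifData σ ξ₀).M := by
  change _ ≤ 1 + ‖ξ₀‖ + ‖P.B‖ + P.κ + ‖P.cubic.diffX (P.Φ ξ₀)‖ + 4 * P.κ * ‖P.B‖ * P.b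
  have : 0 ≤ 1 + ‖ξ₀‖ + ‖P.B‖ + ‖P.cubic.diffX (P.Φ ξ₀)‖ := by positivity
  linarith

/-- A product `B(Φx, Φy)` has a time derivative bounded by `2 ‖B‖ b ‖x‖ ‖y‖` when `x` and `y` are in
`l²_{s+1}`, so the frequency dependence of the inverse costs only the factor `|w² - 1| ≤ 2 ε² ≤ 2
ε`. -/
theorem isClose_inv (σ : ℝ) (ξ₀ : ellW (s + 1)) {w ε : ℝ} (h : Admissible ω P.α w) (hε0 : 0 ≤ ε)
    (hε1 : ε ≤ 1) (hw : |w ^ 2 - 1| ≤ 2 * ε ^ 2) : (P.bifData σ ξ₀).IsClose (P.inv h) ε := by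
  have hM := P.kappa_add_le_M σ ξ₀
  have hκ := P.κ_nonneg
  have hb := P.growth.b_pos
  constructor
  · intro x
    refine (P.norm_inv_apply_le h x).trans (mul_le_mul_of_nonneg_right ?_ (norm_nonneg x))
    have : 0 ≤ 4 * P.κ * ‖P.B‖ * P.b := by positivity
    linarith
  · intro x y
    set V := (velFlow P.growth s).orbit
    have hV : ∀ x, ‖V x‖ ≤ P.b * ‖x‖ := (velFlow P.growth s).norm_orbit_apply_le
    set g' := bilinX P.B (P.Φ x) (V y) + bilinX P.B (V x) (P.Φ y) with hg'
    have hd : ∀ t, HasDerivAt (bilinX P.B (P.Φ x) (P.Φ y)) (g' t) t := fun t =>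
      P.B.hasFDerivAt_of_bilinear (hasDerivAt_cosFlow P.growth x t).hasFDerivAt
        (hasDerivAt_cosFlow P.growth y t).hasFDerivAt |>.hasDerivAt.congr_deriv (by
          simp [hg', V, Φ])
    have hg'le : ‖g'‖ ≤ 2 * (‖P.B‖ * P.b * ‖x‖ * ‖y‖) := by
      have h1 : ‖bilinX P.B (P.Φ x) (V y)‖ ≤ ‖P.B‖ * ‖x‖ * (P.b * ‖y‖) :=
        (norm_bilinX_le _ _ _).trans (by gcongr; exacts [P.norm_Φ_le x, hV y])
      have h2 : ‖bilinX P.B (V x) (P.Φ y)‖ ≤ ‖P.B‖ * (P.b * ‖x‖) * ‖y‖ :=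
        (norm_bilinX_le _ _ _).trans (by gcongr; exacts [hV x, P.norm_Φ_le y])
      refine (norm_add_le _ _).trans ((add_le_add h1 h2).trans (le_of_eq ?_))
      ring
    have hε2 : |w ^ 2 - 1| ≤ 2 * ε := hw.trans (by nlinarith)
    refine (norm_greenKernel_conv_sub_le h P.adm P.α_le hd).trans ?_
    change |w ^ 2 - 1| * P.κ * ‖g'‖ ≤ _
    calc |w ^ 2 - 1| * P.κ * ‖g'‖ ≤ 2 * ε * P.κ * (2 * (‖P.B‖ * P.b * ‖x‖ * ‖y‖)) := by gcongr
      _ = (4 * P.κ * ‖P.B‖ * P.b) * (ε * ‖x‖ * ‖y‖) := by ring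
      _ ≤ (P.bifData σ ξ₀).M * (ε * ‖x‖ * ‖y‖) := by
        refine mul_le_mul_of_nonneg_right ?_ (by positivity)
        linarith
      _ = _ := by ring

/-- A bound for the Lipschitz constants of the nonlinearity. -/
theorem exists_isReg_nonlin (σ : ℝ) (ξ₀ : ellW (s + 1)) : ∃ L, 0 ≤ L ∧ ∀ (w ε : ℝ)
    (h : Admissible ω P.α w) (ξ : ellW (s + 1)) (v : ℝ →ᵇ ellW s), 0 ≤ ε → ε ≤ 1 →
      ‖ξ - ξ₀‖ ≤ 1 → ‖v‖ ≤ 1 → IsReg 1 v →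
      IsReg L ((P.bifData σ ξ₀).nonlin (P.inv h) ε ξ v) := by
  have hκ := P.κ_nonneg
  have hb := P.growth.b_pos
  set r := ‖ξ₀‖ + 1 with hr
  set β := ‖P.B‖ with hβ
  set L₁ := P.κ * (β * (P.b * r * r + r * (P.b * r))) + 1 with hL₁
  set N₁ := P.κ * (β * r * r) + 1 with hN₁
  obtain ⟨K, hK0, hK⟩ := IsReg.superpos P.cubic (r + N₁)
  refine ⟨2 * (β * (P.b * r * N₁ + r * L₁)) + β * (L₁ * N₁ + N₁ * L₁) + K * (P.b * r + L₁),
    by positivity, fun w ε h ξ v hε0 hε1 hξ hv hvr => ?_⟩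
  have hξr : ‖ξ‖ ≤ r := by
    have := norm_add_le (ξ - ξ₀) ξ₀
    rw [sub_add_cancel] at this
    linarith
  have hΦr := (P.norm_Φ_le ξ).trans hξr
  have hΦ : IsReg (P.b * r) (P.Φ ξ) := (P.isReg_Φ ξ).mono (by gcongr)
  have hs : IsReg L₁ ((P.bifData σ ξ₀).second (P.inv h) ξ + v) := by
    refine IsReg.add (P.isReg_inv h ((hΦ.bilin P.B hΦ).mono ?_)) hvr
    gcongr
  have hsn : ‖(P.bifData σ ξ₀).second (P.inv h) ξ + v‖ ≤ N₁ := by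
    refine (norm_add_le _ _).trans (add_le_add ((P.norm_inv_apply_le h _).trans ?_) hv)
    refine mul_le_mul_of_nonneg_left ((norm_bilinX_le _ _ _).trans ?_) hκ
    gcongr <;> exact hΦr
  have hεabs : |ε| ≤ 1 := by rwa [abs_of_nonneg hε0]
  refine IsReg.add (IsReg.add ?_ ?_) ?_
  · refine ((hΦ.bilin P.B hs).smul 2).mono ?_
    rw [abs_of_pos (two_pos)]
    have := hs.nonneg
    have := hΦ.nonneg
    gcongr
  · refine ((hs.bilin P.B hs).smul ε).mono ?_
    have := hs.nonneg
    refine (mul_le_of_le_one_left (by positivity) hεabs).trans ?_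
    gcongr
  · have h1 : IsReg (P.b * r + L₁) (P.Φ ξ + ε • ((P.bifData σ ξ₀).second (P.inv h) ξ + v)) :=
      hΦ.add ((hs.smul ε).mono (mul_le_of_le_one_left hs.nonneg hεabs))
    refine hK _ _ ?_ h1
    refine (norm_add_le _ _).trans (add_le_add hΦr ?_)
    rw [norm_smul, Real.norm_eq_abs]
    exact (mul_le_of_le_one_left (norm_nonneg _) hεabs).trans hsn

theorem exists_isReg_lin (σ : ℝ) (ξ₀ h : ellW (s + 1)) : ∃ L, IsReg L ((P.bifData σ ξ₀).lin h) := by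
  obtain ⟨K, hK⟩ := IsReg.diffX P.cubic (P.isReg_Φ ξ₀) (P.isReg_Φ h)
  rw [Bifurcation.lin_apply]
  exact ⟨_, ((((P.isReg_Φ h).bilin P.B (P.isReg_inv P.adm
    ((P.isReg_Φ ξ₀).bilin P.B (P.isReg_Φ ξ₀)))).smul 2).add
    (((P.isReg_Φ ξ₀).bilin P.B (P.isReg_inv P.adm
    ((P.isReg_Φ ξ₀).bilin P.B (P.isReg_Φ h)))).smul 4)).add hK⟩

/-! ### Invertibility of the linearization -/

theorem isCompactOperator_proj (σ : ℝ) : IsCompactOperator (P.proj σ) :=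
  ((isCompactOperator_invOp P.growth s).comp_clm P.avg).smul (-σ)

/-- The projection of a regular function lies in `l²_{s+3}`. -/
theorem memW_proj {σ : ℝ} {L : ℝ} {g : ℝ →ᵇ ellW s} (hg : IsReg L g) :
    MemW (s + 3) (P.proj σ g) := by
  have h1 : MemW (s + 1) (P.avg g) := hg.memW_mean P.growth
  have h2 := ((-σ) • (invOp P.growth (by linarith : s + 3 ≤ s + 1 + 2)).op univ
    ⟨P.avg g, h1⟩).2
  have e : ((-σ) • (invOp P.growth (by linarith : s + 3 ≤ s + 1 + 2)).op univ
    ⟨P.avg g, h1⟩ : ellW (s + 3)).1 = (P.proj σ g).1 := by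
    funext m
    refine Eq.trans ?_ (P.proj_apply σ g m).symm
    exact congrArg (-σ * ·) (invOp_univ_apply P.growth (by linarith : s + 3 ≤ s + 1 + 2) _ m)
  rw [← e]
  exact h2

/-- The Fredholm alternative at the value `1` for the compact operator `A⁻¹ ⟨lin ·⟩`, up to sign. -/
theorem exists_equiv {σ : ℝ} {ξ₀ : ellW (s + 1)}
    (hker : ∀ h : ellW (s + 1), h = P.proj σ ((P.bifData σ ξ₀).lin h) → h = 0) :
    ∃ e : ellW (s + 1) ≃L[ℝ] ellW (s + 1), ∀ y, e y = y - P.proj σ ((P.bifData σ ξ₀).lin y) := by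
  set T : ellW (s + 1) →L[ℝ] ellW (s + 1) := (P.proj σ).comp (P.bifData σ ξ₀).lin with hT
  have hc : IsCompactOperator T := (P.isCompactOperator_proj σ).comp_clm _
  rcases hc.hasEigenvalue_or_mem_resolventSet (μ := 1) one_ne_zero with h | h
  · obtain ⟨v, hv⟩ := h.exists_hasEigenvector
    refine absurd (hker v ?_) hv.2
    have := hv.apply_eq_smul
    rw [one_smul] at this
    exact this.symm
  · rw [spectrum.mem_resolventSet_iff, map_one] at h
    refine ⟨ContinuousLinearEquiv.unitsEquiv ℝ _ h.unit, fun y => rfl⟩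

end Model

/-! ### The averaged equation -/

/-- The product is a quarter of the sum of the cosines of the four frequencies `l ± ω κ ± ω m`, and
each has mean `1` or `0` according to whether its frequency vanishes. This is how the counting
function enters the averaged operator. -/
theorem integral_cos_mul_cos_mul_cos (ω : ℕ → ℕ) (l : ℤ) (κ m : ℕ) :
    (2 * π)⁻¹ * ∫ t in (0 : ℝ)..(2 * π),
      Real.cos (l * t) * (Real.cos (ω m * t) * Real.cos (ω κ * t)) = resCount ω l κ m / 4 := by
  have h : ∀ t : ℝ, Real.cos (l * t) * (Real.cos (ω m * t) * Real.cos (ω κ * t))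
      = (1 / 4) * (Real.cos ((l + ω κ + ω m : ℤ) * t) + Real.cos ((l + ω κ - ω m : ℤ) * t)
        + Real.cos ((l - ω κ + ω m : ℤ) * t) + Real.cos ((l - ω κ - ω m : ℤ) * t)) := fun t => by
    push_cast
    simp only [add_mul, sub_mul, Real.cos_add, Real.cos_sub, Real.sin_add, Real.sin_sub]
    ring
  have i : ∀ k : ℤ, IntervalIntegrable (fun t : ℝ => Real.cos (k * t)) volume 0 (2 * π) :=
    fun k => (continuous_cos_int_mul k).intervalIntegrable _ _
  simp_rw [h]
  rw [intervalIntegral.integral_const_mul, intervalIntegral.integral_add (((i _).add (i _)).add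
    (i _)) (i _), intervalIntegral.integral_add ((i _).add (i _)) (i _),
    intervalIntegral.integral_add (i _) (i _), mul_left_comm, mul_add (2 * π)⁻¹,
    mul_add (2 * π)⁻¹, mul_add (2 * π)⁻¹,
    integral_cos_int_mul, integral_cos_int_mul, integral_cos_int_mul, integral_cos_int_mul]
  have hne : (1 : ℤ) ∉ ({-1} : Finset ℤ) := by decide
  simp only [resCount, Finset.sum_insert hne, Finset.sum_singleton, one_mul, neg_one_mul,
    ← sub_eq_add_neg]
  ring

/-- Convolution of an even kernel with a cosine. -/
theorem conv_cos {m : ℤ → ℝ} (hm : Summable m) (hsymm : ∀ l, m (-l) = m l) (k : ℤ) (t : ℝ) :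
    (2 * π)⁻¹ * ∫ τ in (0 : ℝ)..(2 * π), Real.cos (k * (t - τ)) * ∑' l : ℤ, m l * Real.cos (l * τ)
      = m k * Real.cos (k * t) := by
  set K : ℝ → ℝ := fun τ => ∑' l : ℤ, m l * Real.cos (l * τ) with hK
  have hKc : Continuous K :=
    continuous_tsum_mul hm continuous_cos_int_mul fun _ _ => Real.abs_cos_le_one _
  have hKe : ∀ τ, K (-τ) = K τ := fun τ => by simp only [hK, mul_neg, Real.cos_neg]
  have hKp : Function.Periodic K (2 * π) := fun τ => by
    simp only [hK]
    congr 1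
    funext l
    have := cos_int_mul_periodic l τ
    simp only at this
    rw [this]
  have e : ∀ τ : ℝ, Real.cos (k * (t - τ)) * K τ = Real.cos (k * t) * (Real.cos (k * τ) * K τ)
      + Real.sin (k * t) * (Real.sin (k * τ) * K τ) := fun τ => by
    rw [mul_sub, Real.cos_sub]
    ring
  have h0 : ∫ τ in (0 : ℝ)..(2 * π), Real.sin (k * τ) * K τ = 0 :=
    integral_eq_zero_of_odd_of_periodic
      (fun τ => by rw [hKe, mul_neg, Real.sin_neg, neg_mul]) ((sin_int_mul_periodic k).mul hKp)
  have h1 := cosCoeff_tsum hm hsymm k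
  rw [cosCoeff] at h1
  change (2 * π)⁻¹ * ∫ τ in (0 : ℝ)..(2 * π), Real.cos (k * (t - τ)) * K τ = _
  simp_rw [e]
  rw [intervalIntegral.integral_add (Continuous.intervalIntegrable (by fun_prop) _ _)
    (Continuous.intervalIntegrable (by fun_prop) _ _), intervalIntegral.integral_const_mul,
    intervalIntegral.integral_const_mul, h0, mul_zero, add_zero, mul_left_comm, h1, mul_comm]

theorem nonresInv_neg (ω : ℕ → ℕ) (ν : ℕ) (l : ℤ) : nonresInv ω ν (-l) = nonresInv ω ν l := by
  have h1 : (-l ≠ (ω ν : ℤ) ∧ -l ≠ -(ω ν : ℤ)) ↔ (l ≠ (ω ν : ℤ) ∧ l ≠ -(ω ν : ℤ)) := by omega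
  simp only [nonresInv, h1]
  push_cast
  simp

namespace Model

variable {s : ℝ} {ω : ℕ → ℕ} {D : ℕ → ℕ → ℕ → ℝ} {C : ℕ → ℕ → ℕ → ℕ → ℝ} (P : Model s ω D C)

theorem summable_nonresInv (P : Model s ω D C) (ν : ℕ) : Summable (nonresInv ω ν) := by
  have := P.adm.summable_rangeInv ν
  simp only [funext fun l => rangeInv_one ω ν l] at this
  exact this

/-- The inverse on the range, applied to a series of cosines. -/
theorem inv_apply_of_series {g : ℝ →ᵇ ellW s} {ν : ℕ} {c : ℕ × ℕ → ℝ} (hc : Summable c)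
    (θ : ℕ × ℕ → ℤ) (hg : ∀ t, g t ν = ∑' p, c p * Real.cos (θ p * t)) (t : ℝ) :
    P.inv P.adm g t ν = ∑' p, c p * nonresInv ω ν (θ p) * Real.cos (θ p * t) := by
  have hm := P.summable_nonresInv ν
  have hk : ∀ τ, (greenKernel s P.adm).coef τ ν = ∑' l : ℤ, nonresInv ω ν l * Real.cos (l * τ) :=
    fun τ => by
      rw [greenKernel_coef]
      simp only [rangeInv_one]
  have h := (hasSum_intervalIntegral_mul hc (φ := fun p τ => Real.cos (θ p * (t - τ)))
    (fun p => by fun_prop) (fun _ _ => Real.abs_cos_le_one _)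
    (continuous_tsum_mul hm continuous_cos_int_mul fun _ _ => Real.abs_cos_le_one _) 0
    (2 * π)).mul_left ((2 * π)⁻¹)
  simp_rw [← hg, mul_left_comm (2 * π)⁻¹, conv_cos hm (nonresInv_neg ω ν), ← mul_assoc] at h
  rw [h.tsum_eq]
  refine (DiagKernel.conv_apply _ g t ν).trans ?_
  congr 2
  funext τ
  rw [hk, mul_comm]

/-- The range inverse is dominated by a fixed element of the space. -/
theorem exists_abs_inv_le (g : ℝ →ᵇ ellW s) (hper : Function.Periodic g (2 * π)) :
    ∃ v : ellW s, ∀ t ν, |P.inv P.adm g t ν| ≤ v ν := by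
  have hgc : Continuous fun τ => (g τ).absVal := ellW.continuous_absVal.comp g.continuous
  refine ⟨(P.κ * (2 * π)⁻¹) • ∫ τ in (0 : ℝ)..(2 * π), (g τ).absVal, fun t ν => ?_⟩
  rw [ellW.smul_apply, ellW.intervalIntegral_apply hgc]
  have h1 : P.inv P.adm g t ν
      = (2 * π)⁻¹ * ∫ τ in (0 : ℝ)..(2 * π), (greenKernel s P.adm).coef τ ν * g (t - τ) ν :=
    DiagKernel.conv_apply _ g t ν
  have hk : ∀ τ, |(greenKernel s P.adm).coef τ ν| ≤ P.κ := fun τ =>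
    le_of_mul_le_mul_right ((greenKernel s P.adm).le_bd τ ν) (wt_pos s ν)
  have hgν : Continuous fun τ => g τ ν := ellW.continuous_apply g.continuous ν
  have h2 : |∫ τ in (0 : ℝ)..(2 * π), (greenKernel s P.adm).coef τ ν * g (t - τ) ν|
      ≤ ∫ τ in (0 : ℝ)..(2 * π), P.κ * |g (t - τ) ν| := by
    have hgt : Continuous fun τ => g (t - τ) ν := hgν.comp (by fun_prop)
    rw [← Real.norm_eq_abs]
    refine intervalIntegral.norm_integral_le_of_norm_le (μ := volume) Real.two_pi_pos.le
      (Eventually.of_forall fun τ _ => ?_)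
      ((continuous_const.mul hgt.abs).intervalIntegrable _ _)
    rw [Real.norm_eq_abs, abs_mul]
    exact mul_le_mul_of_nonneg_right (hk τ) (abs_nonneg _)
  have h3 : ∫ τ in (0 : ℝ)..(2 * π), |g (t - τ) ν| = ∫ τ in (0 : ℝ)..(2 * π), |g τ ν| := by
    rw [intervalIntegral.integral_comp_sub_left (fun τ => |g τ ν|) t, sub_zero]
    have hp : Function.Periodic (fun τ => |g τ ν|) (2 * π) := fun τ => by simp only [hper τ]
    have h4 := hp.intervalIntegral_add_eq (t - 2 * π) 0
    rwa [sub_add_cancel, zero_add] at h4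
  rw [intervalIntegral.integral_const_mul, h3] at h2
  have h5 := mul_le_mul_of_nonneg_left h2 (by positivity : 0 ≤ (2 * π)⁻¹)
  rw [h1, abs_mul, abs_of_pos (by positivity : 0 < (2 * π)⁻¹)]
  refine h5.trans (le_of_eq ?_)
  simp only [ellW.absVal_apply]
  ring

/-- The constant `9 / 4` is `2 · (-3) · (-3 / 2) · (1 / 4)`: the factor in front of the average, the
coefficient of `B`, that of the series of `g`, and the product formula for cosines. -/
theorem avg_bilin_inv_of_series (ξ : ellW (s + 1)) {g : ℝ →ᵇ ellW s}
    (hper : Function.Periodic g (2 * π)) (θ : ℕ × ℕ → ℤ)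
    (hg : ∀ t ν, g t ν = ∑' p : ℕ × ℕ, -(3 / 2) * (D p.1 p.2 ν * ξ p.1 * ξ p.2)
      * Real.cos (θ p * t)) (m : ℕ) :
    2 * P.avg (bilinX P.B (P.Φ ξ) (P.inv P.adm g)) m
      = 9 / 4 * ∑' q : ℕ × ℕ, D q.1 q.2 m * ∑' p : ℕ × ℕ,
        D p.1 p.2 q.2 * nonresInv ω q.2 (θ p) * ξ p.1 * ξ p.2 * ξ q.1 * resCount ω (θ p) q.1 m := by
  set w := P.inv P.adm g with hw
  set x : ellW s := inclL (le_add_one_self s) ξ with hx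
  have hc : ∀ ν, Summable fun p : ℕ × ℕ => -(3 / 2) * (D p.1 p.2 ν * ξ p.1 * ξ p.2) := fun ν =>
    (P.summable x x ν).mul_left _
  have hw1 : ∀ ν t, w t ν = ∑' p : ℕ × ℕ, -(3 / 2) * (D p.1 p.2 ν * ξ p.1 * ξ p.2)
      * nonresInv ω ν (θ p) * Real.cos (θ p * t) := fun ν t =>
    P.inv_apply_of_series (hc ν) θ (fun t => hg t ν) t
  obtain ⟨v, hv⟩ := P.exists_abs_inv_le g hper
  have hcn : ∀ ν, Summable fun p : ℕ × ℕ => -(3 / 2) * (D p.1 p.2 ν * ξ p.1 * ξ p.2)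
      * nonresInv ω ν (θ p) := fun ν => by
    have h1 := (P.summable_nonresInv ν).abs
    refine Summable.of_norm_bounded ((hc ν).abs.mul_right (∑' l, |nonresInv ω ν l|)) fun p => ?_
    rw [Real.norm_eq_abs, abs_mul]
    exact mul_le_mul_of_nonneg_left (h1.le_tsum (θ p) fun l _ => abs_nonneg _) (abs_nonneg _)
  have hwc : ∀ ν, Continuous fun t => w t ν := fun ν => ellW.continuous_apply w.continuous ν
  have hinner : ∀ q : ℕ × ℕ, (2 * π)⁻¹ * ∫ t in (0 : ℝ)..(2 * π),
      Real.cos (ω m * t) * (D q.1 q.2 m * (Real.cos (ω q.1 * t) * ξ q.1) * w t q.2)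
      = -(3 / 8) * (D q.1 q.2 m * ∑' p : ℕ × ℕ,
        D p.1 p.2 q.2 * nonresInv ω q.2 (θ p) * ξ p.1 * ξ p.2 * ξ q.1
          * resCount ω (θ p) q.1 m) := by
    intro q
    have h := (hasSum_intervalIntegral_mul (hcn q.2) (φ := fun p t => Real.cos (θ p * t))
      (fun p => by fun_prop) (fun _ _ => Real.abs_cos_le_one _)
      (ψ := fun t => Real.cos (ω m * t) * Real.cos (ω q.1 * t)) (by fun_prop) 0
      (2 * π)).mul_left ((2 * π)⁻¹)
    simp_rw [← hw1, mul_left_comm (2 * π)⁻¹, integral_cos_mul_cos_mul_cos] at h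
    have e : ∀ t : ℝ, Real.cos (ω m * t) * (D q.1 q.2 m * (Real.cos (ω q.1 * t) * ξ q.1) * w t q.2)
        = (D q.1 q.2 m * ξ q.1) * (w t q.2 * (Real.cos (ω m * t) * Real.cos (ω q.1 * t))) :=
      fun t => by ring
    simp_rw [e]
    rw [intervalIntegral.integral_const_mul, mul_left_comm, ← h.tsum_eq, mul_assoc,
      mul_left_comm (-(3 / 8)), ← tsum_mul_left (a := ξ q.1), ← tsum_mul_left (a := -(3 / 8))]
    congr 2
    funext p
    ring
  -- Exchanging the outer sum with the integral needs a majorant independent of `t`. The double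
  -- series is known to converge absolutely only for elements of `l²_s`, so the majorant is built
  -- from the vector `v` of `exists_abs_inv_le`.
  have houter : HasSum (fun q : ℕ × ℕ => ∫ t in (0 : ℝ)..(2 * π),
      Real.cos (ω m * t) * (D q.1 q.2 m * (Real.cos (ω q.1 * t) * ξ q.1) * w t q.2))
      (∫ t in (0 : ℝ)..(2 * π), Real.cos (ω m * t) * ∑' q : ℕ × ℕ,
        D q.1 q.2 m * (Real.cos (ω q.1 * t) * ξ q.1) * w t q.2) := by
    have hb : Summable fun q : ℕ × ℕ => |D q.1 q.2 m * x.absVal q.1 * v q.2| :=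
      (P.summable x.absVal v m).abs
    refine intervalIntegral.hasSum_integral_of_dominated_convergence
      (fun q _ => |D q.1 q.2 m * x.absVal q.1 * v q.2|) (fun q => ?_) (fun q => ?_) ?_ ?_ ?_
    · have := hwc q.2
      exact Continuous.aestronglyMeasurable (by fun_prop)
    · refine Eventually.of_forall fun t _ => ?_
      rw [Real.norm_eq_abs, abs_mul, abs_mul, abs_mul, abs_mul, abs_mul, abs_mul,
        ellW.absVal_apply, abs_abs]
      have h1 := (hv t q.2).trans (le_abs_self _)
      have h2 := Real.abs_cos_le_one (ω m * t)
      have h3 := Real.abs_cos_le_one (ω q.1 * t)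
      refine (mul_le_of_le_one_left (by positivity) h2).trans ?_
      refine mul_le_mul (mul_le_mul_of_nonneg_left ?_ (abs_nonneg _)) h1 (abs_nonneg _)
        (by positivity)
      exact mul_le_of_le_one_left (abs_nonneg _) h3
    · exact Eventually.of_forall fun t _ => hb
    · exact continuous_const.intervalIntegrable _ _
    · refine Eventually.of_forall fun t _ => ?_
      exact (P.summable (P.Φ ξ t) (w t) m).hasSum.mul_left _
  have h1 : P.avg (bilinX P.B (P.Φ ξ) w) m = (2 * π)⁻¹ * ∫ t in (0 : ℝ)..(2 * π),
      Real.cos (ω m * t) * (-3 * ∑' q : ℕ × ℕ,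
        D q.1 q.2 m * (Real.cos (ω q.1 * t) * ξ q.1) * w t q.2) := by
    refine (DiagKernel.mean_apply _ _ m).trans ?_
    congr 2
    funext t
    refine congrArg (Real.cos (ω m * t) * ·) ?_
    exact P.B_apply (P.Φ ξ t) (w t) m
  have h2 := houter.mul_left ((2 * π)⁻¹)
  simp_rw [hinner] at h2
  have h3 := h2.tsum_eq
  rw [tsum_mul_left] at h3
  rw [h1]
  simp_rw [mul_left_comm _ (-3 : ℝ)]
  rw [intervalIntegral.integral_const_mul, mul_left_comm _ (-3 : ℝ), ← h3]
  ring

/-- The orbits of the sine flow. -/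
def Ψ (_ : Model s ω D C) : ellW (s + 1) →L[ℝ] (ℝ →ᵇ ellW s) :=
  (sinFlow ω (le_add_one_self s)).orbit

theorem periodic_bilin_Ψ (ξ : ellW (s + 1)) :
    Function.Periodic (bilinX P.B (P.Ψ ξ) (P.Ψ ξ)) (2 * π) := fun t => by
  have h : P.Ψ ξ (t + 2 * π) = P.Ψ ξ t := ellW.ext fun j => by
    have := sin_int_mul_periodic (ω j) t
    simp only [Int.cast_natCast] at this
    change Real.sin _ * ξ j = Real.sin _ * ξ j
    rw [this]
  rw [bilinX_apply, h, bilinX_apply]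

/-- The sine orbit separates the two frequencies `ω_i ∓ ω_j`: `cos cos ± sin sin` is the cosine of
the difference or of the sum. Each half of `B(Φξ, Φξ)` is then itself a function in the space, to
which the inverse on the range applies. -/
theorem backreaction_eq (ξ : ellW (s + 1)) (m : ℕ) :
    backreaction ω D ξ m
      = 2 * P.avg (bilinX P.B (P.Φ ξ) (P.inv P.adm (bilinX P.B (P.Φ ξ) (P.Φ ξ)))) m := by
  set g := bilinX P.B (P.Φ ξ) (P.Φ ξ) with hg
  set k := bilinX P.B (P.Ψ ξ) (P.Ψ ξ) with hk
  have hgp : Function.Periodic g (2 * π) := ((P.isReg_Φ ξ).bilin P.B (P.isReg_Φ ξ)).per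
  have hkp : Function.Periodic k (2 * π) := P.periodic_bilin_Ψ ξ
  have h1 := fun t ν => P.B_apply (P.Φ ξ t) (P.Φ ξ t) ν
  have h2 := fun t ν => P.B_apply (P.Ψ ξ t) (P.Ψ ξ t) ν
  have s1 := fun t ν => P.summable (P.Φ ξ t) (P.Φ ξ t) ν
  have s2 := fun t ν => P.summable (P.Ψ ξ t) (P.Ψ ξ t) ν
  have hminus := P.avg_bilin_inv_of_series ξ (g := (1 / 2 : ℝ) • (g + k))
    (fun t => congrArg ((1 / 2 : ℝ) • ·) ((hgp.add hkp) t)) (fun p => (ω p.1 : ℤ) - ω p.2)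
    (fun t ν => by
      change 1 / 2 * (P.B (P.Φ ξ t) (P.Φ ξ t) ν + P.B (P.Ψ ξ t) (P.Ψ ξ t) ν) = _
      rw [h1, h2, ← mul_add, ← (s1 t ν).tsum_add (s2 t ν), ← mul_assoc, ← tsum_mul_left]
      congr 1
      funext p
      change 1 / 2 * -3 * (D p.1 p.2 ν * (Real.cos (ω p.1 * t) * ξ p.1)
        * (Real.cos (ω p.2 * t) * ξ p.2) + D p.1 p.2 ν * (Real.sin (ω p.1 * t) * ξ p.1)
        * (Real.sin (ω p.2 * t) * ξ p.2)) = _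
      push_cast
      rw [sub_mul, Real.cos_sub]
      ring) m
  have hplus := P.avg_bilin_inv_of_series ξ (g := (1 / 2 : ℝ) • (g - k))
    (fun t => congrArg ((1 / 2 : ℝ) • ·) ((hgp.sub hkp) t)) (fun p => (ω p.1 : ℤ) + ω p.2)
    (fun t ν => by
      change 1 / 2 * (P.B (P.Φ ξ t) (P.Φ ξ t) ν - P.B (P.Ψ ξ t) (P.Ψ ξ t) ν) = _
      rw [h1, h2, ← mul_sub, ← (s1 t ν).tsum_sub (s2 t ν), ← mul_assoc, ← tsum_mul_left]
      congr 1
      funext p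
      change 1 / 2 * -3 * (D p.1 p.2 ν * (Real.cos (ω p.1 * t) * ξ p.1)
        * (Real.cos (ω p.2 * t) * ξ p.2) - D p.1 p.2 ν * (Real.sin (ω p.1 * t) * ξ p.1)
        * (Real.sin (ω p.2 * t) * ξ p.2)) = _
      push_cast
      rw [add_mul, Real.cos_add]
      ring) m
  have e : g = (1 / 2 : ℝ) • (g + k) + (1 / 2 : ℝ) • (g - k) := by
    rw [← smul_add, add_add_sub_cancel, ← two_smul ℝ g, smul_smul]
    norm_num
  rw [backreaction, ← hminus, ← hplus, ← mul_add]
  congr 1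
  conv_rhs => rw [e]
  simp only [map_add, ellW.add_apply]

theorem modOp_eq (σ : ℝ) (ξ₀ ξ : ellW (s + 1)) (m : ℕ) :
    modOp ω D C σ ξ m = σ * ((ω m : ℝ) ^ 2 * ξ m)
      + P.avg ((P.bifData σ ξ₀).nonlin (P.inv P.adm) 0 ξ 0) m := by
  have e : (P.bifData σ ξ₀).nonlin (P.inv P.adm) 0 ξ 0
      = (2 : ℝ) • bilinX P.B (P.Φ ξ) (P.inv P.adm (bilinX P.B (P.Φ ξ) (P.Φ ξ)))
        + P.cubic.superpos (P.Φ ξ) := by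
    simp only [Bifurcation.nonlin, add_zero, zero_smul]
    rfl
  have h1 : flowAverage ω (cubicTerm C) ξ m = P.avg (P.cubic.superpos (P.Φ ξ)) m := by
    refine Eq.trans ?_ (DiagKernel.mean_apply _ _ m).symm
    rw [flowAverage]
    congr 2
    funext t
    exact congrArg (Real.cos (ω m * t) * ·) (P.cubic.apply (P.Φ ξ t) m).symm
  rw [e, map_add, map_smul, ellW.add_apply, ellW.smul_apply, ← P.backreaction_eq, ← h1]
  simp only [modOp, Pi.add_apply, Pi.smul_apply, smul_eq_mul, mulOp]
  ring

end Model

/-! ### The differential of the limit equation -/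

/-- The estimate `norm_nonlin_sub_le` with `R = R₁` and `ε = 0`, comparing a point with `ξ₀`: the
factor `r` is then the distance to `ξ₀`. -/
theorem Bifurcation.hasFDerivAt_nonlin {Y X : Type*} [NormedAddCommGroup Y] [NormedSpace ℝ Y]
    [NormedAddCommGroup X] [NormedSpace ℝ X] (b : Bifurcation Y X) :
    HasFDerivAt (fun ξ => b.nonlin b.R₁ 0 ξ 0) b.lin b.ξ₀ := by
  obtain ⟨C, hC0, hC⟩ := b.norm_nonlin_sub_le
  rw [hasFDerivAt_iff_isLittleO, Asymptotics.isLittleO_iff]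
  intro c hc
  have hδ : 0 < min 1 (c / (C + 1)) := lt_min one_pos (by positivity)
  filter_upwards [Metric.ball_mem_nhds b.ξ₀ hδ] with x hx
  rw [Metric.mem_ball, dist_eq_norm] at hx
  have h := hC b.R₁ 0 ‖x - b.ξ₀‖ x b.ξ₀ 0 0 b.isClose_self le_rfl zero_le_one
    (hx.le.trans (min_le_left _ _)) le_rfl (by simp) (by simp) (by simp)
  refine h.trans ?_
  rw [sub_zero, norm_zero, add_zero, add_zero, ← mul_assoc]
  refine mul_le_mul_of_nonneg_right ?_ (norm_nonneg _)
  have h1 := hx.le.trans (min_le_right _ _)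
  rw [le_div_iff₀ (by positivity)] at h1
  nlinarith [norm_nonneg (x - b.ξ₀)]

theorem le_add_three_of_add_one (s : ℝ) : s + 1 ≤ s + 3 := by linarith

namespace Model

variable {s : ℝ} {ω : ℕ → ℕ} {D : ℕ → ℕ → ℕ → ℝ} {C : ℕ → ℕ → ℕ → ℕ → ℝ} (P : Model s ω D C)

theorem hasFDerivAt_modOp (σ : ℝ) (ξ₀ : ellW (s + 3)) (m : ℕ) :
    HasFDerivAt (fun x : ellW (s + 3) => modOp ω D C σ x m)
      (σ • (((ω m : ℝ) ^ 2) • coordL (s + 3) m) + ((coordL s m).comp P.avg).comp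
        ((P.bifData σ (inclL (le_add_three_of_add_one s) ξ₀)).lin.comp
          (inclL (le_add_three_of_add_one s)))) ξ₀ := by
  set i := inclL (le_add_three_of_add_one s)
  have h0 : HasFDerivAt (fun ξ => (P.bifData σ (i ξ₀)).nonlin (P.inv P.adm) 0 ξ 0)
      (P.bifData σ (i ξ₀)).lin (i ξ₀) := (P.bifData σ (i ξ₀)).hasFDerivAt_nonlin
  have h1 := h0.comp ξ₀ i.hasFDerivAt
  have h2 := (((coordL (s + 3) m).hasFDerivAt (x := ξ₀)).const_mul ((ω m : ℝ) ^ 2)).const_mul σ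
  have h3 := ((coordL s m).comp P.avg).hasFDerivAt.comp ξ₀ h1
  refine (h2.add h3).congr_of_eventuallyEq (Eventually.of_forall fun x => ?_)
  exact Eq.mp (congrArg (fun y : ℕ → ℝ => modOp ω D C σ y m = σ * ((ω m : ℝ) ^ 2 * y m)
    + P.avg ((P.bifData σ (i ξ₀)).nonlin (P.inv P.adm) 0 (i x) 0) m) (inclL_coe _ x))
    (P.modOp_eq σ (i ξ₀) (i x) m)

theorem modOpDiff_eq (σ : ℝ) (ξ₀ h : ellW (s + 3)) (m : ℕ) :
    modOpDiff ω D C σ ξ₀ h m = σ * ((ω m : ℝ) ^ 2 * h m)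
      + P.avg ((P.bifData σ (inclL (le_add_three_of_add_one s) ξ₀)).lin
        (inclL (le_add_three_of_add_one s) h)) m := by
  rw [modOpDiff, (P.hasFDerivAt_modOp σ ξ₀ m).fderiv]
  rfl

/-- The kernel hypothesis lives in `l²_{s+3}`, the linearized equation in `l²_{s+1}`, and regularity
bridges the gap. For `h` in `l²_{s+1}` the function `lin h` is Lipschitz in time, so its average
gains one derivative and `A⁻¹` two more, which puts `h` into `l²_{s+3}`. -/
theorem eq_zero_of_eq_proj {σ : ℝ} (hσ : σ = 1 ∨ σ = -1) {ξ₀ : ellW (s + 3)}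
    (hker : ∀ h : ellW (s + 3), modOpDiff ω D C σ ξ₀ h = 0 → h = 0) (h : ellW (s + 1))
    (hh : h = P.proj σ ((P.bifData σ (inclL (le_add_three_of_add_one s) ξ₀)).lin h)) : h = 0 := by
  obtain ⟨L, hL⟩ := P.exists_isReg_lin σ (inclL (le_add_three_of_add_one s) ξ₀) h
  have h1 := P.memW_proj (σ := σ) hL
  rw [← hh] at h1
  have hσ2 : σ * σ = 1 := by rcases hσ with rfl | rfl <;> norm_num
  have h2 : (⟨h, h1⟩ : ellW (s + 3)) = 0 := by
    refine hker _ (funext fun m => ?_)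
    have hω : (ω m : ℝ) ≠ 0 := by exact_mod_cast (P.growth.pos m).ne'
    have e : inclL (le_add_three_of_add_one s) (⟨h, h1⟩ : ellW (s + 3)) = h :=
      ellW.ext fun j => inclL_apply _ _ j
    refine (P.modOpDiff_eq σ ξ₀ ⟨h, h1⟩ m).trans ?_
    rw [e]
    have h3 := P.proj_apply σ ((P.bifData σ (inclL (le_add_three_of_add_one s) ξ₀)).lin h) m
    rw [← hh] at h3
    change σ * ((ω m : ℝ) ^ 2 * h m) + _ = 0
    rw [h3]
    field_simp
    linear_combination -(P.avg ((P.bifData σ (inclL (le_add_three_of_add_one s) ξ₀)).lin h) m) * hσ2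
  refine ellW.ext fun j => ?_
  exact congrArg (fun u : ellW (s + 3) => u j) h2

theorem eq_proj_of_modOp_eq_zero {σ : ℝ} (hσ : σ = 1 ∨ σ = -1) {ξ₀ : ellW (s + 3)}
    (hzero : modOp ω D C σ ξ₀ = 0) :
    inclL (le_add_three_of_add_one s) ξ₀
      = P.proj σ ((P.bifData σ (inclL (le_add_three_of_add_one s) ξ₀)).nonlin (P.inv P.adm) 0
        (inclL (le_add_three_of_add_one s) ξ₀) 0) := by
  refine ellW.ext fun m => ?_
  have hω : (ω m : ℝ) ≠ 0 := by exact_mod_cast (P.growth.pos m).ne'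
  have hσ2 : σ * σ = 1 := by rcases hσ with rfl | rfl <;> norm_num
  have h1 := P.modOp_eq σ (inclL (le_add_three_of_add_one s) ξ₀)
    (inclL (le_add_three_of_add_one s) ξ₀) m
  have h2 : modOp ω D C σ (inclL (le_add_three_of_add_one s) ξ₀) m = 0 :=
    (congrArg (fun y : ℕ → ℝ => modOp ω D C σ y m) (inclL_coe _ ξ₀)).trans (congrFun hzero m)
  rw [h2] at h1
  rw [P.proj_apply]
  generalize P.avg ((P.bifData σ (inclL (le_add_three_of_add_one s) ξ₀)).nonlin (P.inv P.adm) 0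
        (inclL (le_add_three_of_add_one s) ξ₀) 0) m = c at h1 ⊢
  generalize (inclL (le_add_three_of_add_one s) ξ₀) m = x at h1 ⊢
  field_simp
  linear_combination -σ * h1 - (ω m : ℝ) ^ 2 * x * hσ2

end Model

/-! ### Lipschitz functions with differentiable coordinates -/

/-- Difference quotients bound every finite part of the coordinatewise derivative by `L`, so this
derivative takes values in `l²_s`. It is strongly measurable as a pointwise limit of its continuous
truncations, and the fundamental theorem holds coordinate by coordinate. -/
theorem memH1_of_lipschitz {s L : ℝ} {u : ℝ → ellW s} (hL : 0 ≤ L)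
    (hlip : ∀ t t', ‖u t - u t'‖ ≤ L * |t - t'|) {u' : ℝ → ℕ → ℝ}
    (hu : ∀ t j, HasDerivAt (fun t => u t j) (u' t j) t) (hu' : ∀ j, Continuous fun t => u' t j)
    (a b : ℝ) : MemH1 u a b := by
  have hfin : ∀ t, ∀ S : Finset ℕ, ∑ j ∈ S, (wt s j * u' t j) ^ 2 ≤ L ^ 2 := by
    intro t S
    refine le_of_tendsto (f := fun x : ℝ => ∑ j ∈ S, (wt s j * slope (fun t => u t j) t x) ^ 2)
      (x := 𝓝[≠] t) (tendsto_finsetSum _ fun j _ => ((hu t j).tendsto_slope.const_mul _).pow 2)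
      (eventually_nhdsWithin_of_forall fun x hx => ?_)
    have hx' : x - t ≠ 0 := sub_ne_zero.2 hx
    have h1 := pow_le_pow_left₀ (norm_nonneg _) (hlip x t) 2
    rw [ellW.norm_sq, mul_pow, sq_abs] at h1
    have h2 := ((u x - u t).2.sum_le_tsum S fun j _ => sq_nonneg _).trans h1
    have h3 : ∀ j, (wt s j * slope (fun t => u t j) t x) ^ 2
        = (wt s j * (u x - u t) j) ^ 2 / (x - t) ^ 2 := fun j => by
      rw [slope_def_field, ellW.sub_apply]
      field_simp
    simp_rw [h3]
    rw [← Finset.sum_div, div_le_iff₀ (by positivity)]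
    exact h2
  have hmem : ∀ t, MemW s (u' t) := fun t =>
    summable_of_sum_le (fun j => sq_nonneg _) (hfin t)
  set v : ℝ → ellW s := fun t => ⟨u' t, hmem t⟩ with hv
  have hvn : ∀ t, ‖v t‖ ≤ L := fun t => by
    rw [← abs_of_nonneg (norm_nonneg (v t)), ← abs_of_nonneg hL, ← sq_le_sq, ellW.norm_sq]
    exact (hmem t).tsum_le_of_sum_le (hfin t)
  have hvm : StronglyMeasurable v := by
    refine stronglyMeasurable_of_tendsto atTop
      (f := fun (N : ℕ) t => (restrictOp s).op (Iio N) (v t)) (fun N => ?_)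
      (tendsto_pi_nhds.2 fun t => tendsto_restrictOp s (v t))
    simp_rw [restrictOp_eq_ofFin]
    exact ((ofFin s N).continuous.comp (continuous_pi fun i => hu' i)).stronglyMeasurable
  have hint : ∀ c d, IntervalIntegrable v volume c d := fun c d => by
    rw [intervalIntegrable_iff]
    exact Measure.integrableOn_of_bounded (M := L) (by simp) hvm.aestronglyMeasurable
      (Eventually.of_forall hvn)
  refine ⟨v, MemLp.of_bound hvm.aestronglyMeasurable L (Eventually.of_forall hvn),
    fun t _ => ellW.ext fun j => ?_⟩
  have h1 : (∫ τ in a..t, v τ) j = ∫ τ in a..t, v τ j :=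
    ((coordL s j).intervalIntegral_comp_comm (hint a t)).symm
  rw [ellW.add_apply, h1, intervalIntegral.integral_eq_sub_of_hasDerivAt
    (f := fun t => u t j) (f' := fun τ => v τ j) (fun τ _ => hu τ j)
    ((hu' j).intervalIntegrable _ _), add_sub_cancel]

/-! ### The periodic solutions -/

theorem contDiff_two_of_hasDerivAt {f f' f'' : ℝ → ℝ} (h1 : ∀ t, HasDerivAt f (f' t) t)
    (h2 : ∀ t, HasDerivAt f' (f'' t) t) (hc : Continuous f'') :
    ContDiff ℝ 2 f ∧ iteratedDeriv 2 f = f'' := by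
  have d1 : deriv f = f' := funext fun t => (h1 t).deriv
  have d2 : deriv f' = f'' := funext fun t => (h2 t).deriv
  constructor
  · have e : (2 : WithTop ℕ∞) = 1 + 1 := by norm_num
    rw [e, contDiff_succ_iff_deriv]
    refine ⟨fun t => (h1 t).differentiableAt, by simp, ?_⟩
    rw [d1, contDiff_one_iff_deriv, d2]
    exact ⟨fun t => (h2 t).differentiableAt, hc⟩
  · rw [iteratedDeriv_succ, iteratedDeriv_one, d1, d2]

namespace Model

variable {s : ℝ} {ω : ℕ → ℕ} {D : ℕ → ℕ → ℕ → ℝ} {C : ℕ → ℕ → ℕ → ℕ → ℝ} (P : Model s ω D C)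

/-- A solution of the functional equation gives a periodic solution of the differential equation. -/
theorem periodic_solution {σ : ℝ} (hσ : σ = 1 ∨ σ = -1) {ξ₀ ξ : ellW (s + 1)} {ε w : ℝ}
    (h : Admissible ω P.α w) (hw : w ^ 2 = 1 + 2 * σ * ε ^ 2) {v n : ℝ →ᵇ ellW s} {L : ℝ}
    (hvr : IsReg 1 v) (hn : n = (P.bifData σ ξ₀).nonlin (P.inv h) ε ξ v) (hnr : IsReg L n)
    (hξ : ξ = P.proj σ n) (hv : v = ε • P.inv h n) {u : ℝ → ellW s}
    (hu : ∀ t, u t = ε • (P.Φ ξ (w * t)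
      + ε • ((P.bifData σ ξ₀).second (P.inv h) ξ + v) (w * t))) :
    IsSolution ω D C u ∧ Function.Periodic u (2 * π / w) ∧ MemH1 u 0 (2 * π / w) := by
  have hw0 : 0 < w := by linarith [h.half_le]
  have hσ2 : σ * σ = 1 := by rcases hσ with rfl | rfl <;> norm_num
  set B₂ := bilinX P.B (P.Φ ξ) (P.Φ ξ) with hB₂
  set W := (P.bifData σ ξ₀).second (P.inv h) ξ + v with hW
  -- This is the right side `B(p, p) + ε F(p)` of the equation for `W`, as shown in `hgp`.
  set g := B₂ + ε • n with hg
  set p := P.Φ ξ + ε • W with hp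
  have hΦr := P.isReg_Φ ξ
  have hB₂r : IsReg _ B₂ := hΦr.bilin P.B hΦr
  have hgr : IsReg _ g := hB₂r.add (hnr.smul ε)
  have hWg : W = P.inv h g := by
    rw [hW, hg, map_add, map_smul, ← hv]
    rfl
  have hWr : IsReg _ W := (P.isReg_inv h hB₂r).add hvr
  have hpr : IsReg _ p := hΦr.add (hWr.smul ε)
  have hgp : ∀ t, g t = P.B (p t) (p t) + ε • P.F (p t) := by
    intro t
    have e1 : n t = (2 : ℝ) • P.B (P.Φ ξ t) (W t) + ε • P.B (W t) (W t) + P.F (p t) := by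
      rw [hn]
      rfl
    have e2 : g t = P.B (P.Φ ξ t) (P.Φ ξ t) + ε • n t := rfl
    have e3 : p t = P.Φ ξ t + ε • W t := rfl
    rw [e2, e1]
    generalize P.F (p t) = f
    rw [e3]
    simp only [map_add, map_smul, add_apply, smul_apply, P.B_symm (W t) (P.Φ ξ t)]
    module
  -- The kernel equation: the inverse on the range leaves out twice this coefficient times `cos (ω_j
  -- t)`, and the value found is the one that cancels the detuning term `(w² - 1) A Φξ = 2 σ ε² A
  -- Φξ`. Non-resonance removes the contribution of `B₂`, which has no factor `ε`.
  have hcoef : ∀ j, cosCoeff (fun t => g t j) (ω j) = -(ε * σ * ((ω j : ℝ) ^ 2 * ξ j)) := by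
    intro j
    have hω : (ω j : ℝ) ≠ 0 := by exact_mod_cast (P.growth.pos j).ne'
    have h1 : P.avg g = ε • P.avg n := by
      rw [hg, map_add, map_smul]
      have : P.avg B₂ = 0 := P.nonres ξ
      rw [this, zero_add]
    rw [← P.avg_apply g j, h1, ellW.smul_apply]
    have h2 := P.proj_apply σ n j
    rw [← hξ] at h2
    rw [h2]
    field_simp
    linear_combination -(ε * P.avg n j) * hσ2
  have hderiv : ∀ j, ∃ u' u'' : ℝ → ℝ, Continuous u'' ∧
      (∀ t, HasDerivAt (fun t => u t j) (u' t) t) ∧ (∀ t, HasDerivAt u' (u'' t) t) ∧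
      ∀ t, u'' t + (ω j : ℝ) ^ 2 * u t j = ε ^ 2 * g (w * t) j := by
    intro j
    obtain ⟨W', H, hHc, hW', hH, heq⟩ := greenKernel_conv_hasDerivAt h hgr.per hgr.even j
    have hWc : ∀ t, (greenKernel s h).conv g t j = W t j := fun t => by
      rw [hWg]
      rfl
    simp only [hWc] at hW' heq
    have hut : ∀ t, u t j = ε * (Real.cos (ω j * (w * t)) * ξ j + ε * W (w * t) j) := fun t => by
      rw [hu t]
      rfl
    have hlin : ∀ t : ℝ, HasDerivAt (fun t => w * t) w t := fun t => by
      simpa using (hasDerivAt_id t).const_mul w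
    have hlin2 : ∀ t : ℝ, HasDerivAt (fun t => (ω j : ℝ) * (w * t)) (ω j * w) t := fun t =>
      (hlin t).const_mul _
    refine ⟨fun t => ε * (-Real.sin (ω j * (w * t)) * (ω j * w) * ξ j + ε * (W' (w * t) * w)),
      fun t => ε * (-(Real.cos (ω j * (w * t)) * (ω j * w)) * (ω j * w) * ξ j
        + ε * (H (w * t) * w * w)), by fun_prop, fun t => ?_, fun t => ?_, fun t => ?_⟩
    · simp only [hut]
      exact (((hlin2 t).cos.mul_const (ξ j)).add
        (((hW' (w * t)).comp t (hlin t)).const_mul ε)).const_mul ε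
    · exact (((((hlin2 t).sin.neg).mul_const (ω j * w : ℝ)).mul_const (ξ j)).add
        ((((hH (w * t)).comp t (hlin t)).mul_const w).const_mul ε)).const_mul ε
    · have h1 := heq (w * t)
      rw [hcoef] at h1
      simp only [hut]
      linear_combination ε ^ 2 * h1
        - ε * (ω j : ℝ) ^ 2 * Real.cos (ω j * (w * t)) * ξ j * hw
  choose u' u'' huc hu1 hu2 hu3 using hderiv
  have hut : ∀ t, u t = ε • p (w * t) := hu
  refine ⟨fun j => ?_, fun t => ?_, ?_⟩
  · obtain ⟨c1, c2⟩ := contDiff_two_of_hasDerivAt (hu1 j) (hu2 j) (huc j)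
    refine ⟨c1, fun t => ?_⟩
    have e1 : quadTerm D (u t) j = P.B (u t) (u t) j := (P.B_apply _ _ j).symm
    have e2 : cubicTerm C (u t) j = P.F (u t) j := (P.cubic.apply _ j).symm
    have e3 : P.B (u t) (u t) + P.F (u t) = ε ^ 2 • g (w * t) := by
      rw [hut, P.cubic.smul, hgp]
      simp only [map_smul, smul_apply]
      module
    rw [c2, e1, e2]
    refine (hu3 j t).trans ?_
    exact (congrArg (fun x : ellW s => x j) e3).symm
  · rw [hut, hut]
    have e : w * (t + 2 * π / w) = w * t + 2 * π := by field_simp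
    rw [e, hpr.per]
  · have hq := hpr.smul ε
    refine memH1_of_lipschitz (L := |ε| * _ * w) (u' := fun t j => u' j t)
      (mul_nonneg hq.nonneg hw0.le) (fun t t' => ?_) (fun t j => hu1 j t)
      (fun j => continuous_iff_continuousAt.2 fun t => (hu2 j t).continuousAt) _ _
    have h1 := hq.lip (w * t) (w * t')
    rw [← mul_sub, abs_mul, abs_of_pos hw0, ← mul_assoc] at h1
    rw [hut, hut]
    exact h1

end Model

namespace Model

variable {s : ℝ} {ω : ℕ → ℕ} {D : ℕ → ℕ → ℕ → ℝ} {C : ℕ → ℕ → ℕ → ℕ → ℝ} (P : Model s ω D C)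

/-- Small admissible amplitudes give periodic solutions. -/
theorem exists_periodic_solution {σ : ℝ} (hσ : σ = 1 ∨ σ = -1) {ξ₀ : ellW (s + 3)}
    (hzero : modOp ω D C σ ξ₀ = 0)
    (hker : ∀ h : ellW (s + 3), modOpDiff ω D C σ ξ₀ h = 0 → h = 0) :
    ∃ δ > 0, ∃ K, ∀ ε w, 0 < ε → ε < δ → Admissible ω P.α w → w ^ 2 = 1 + 2 * σ * ε ^ 2 →
      ∃ u : ℝ → ellW s, IsSolution ω D C u ∧ Function.Periodic u (2 * π / w) ∧
        MemH1 u 0 (2 * π / w) ∧ ∀ t, ‖u t - ellW.flow ω (t * w)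
          (ellW.incl (le_add_of_nonneg_right zero_le_three) (ε • ξ₀))‖ ≤ K * ε ^ 2 := by
  set y₀ := inclL (le_add_three_of_add_one s) ξ₀ with hy₀
  obtain ⟨e, he⟩ := P.exists_equiv (P.eq_zero_of_eq_proj hσ hker)
  obtain ⟨δ, hδ, K, hsol⟩ := (P.bifData σ y₀).exists_solution e he
    (P.eq_proj_of_modOp_eq_zero hσ hzero)
  obtain ⟨L, hL0, hL⟩ := P.exists_isReg_nonlin σ y₀
  have hκ := P.κ_nonneg
  -- The last bound on `ε` gives `ε κ L ≤ 1`, so the range component keeps the Lipschitz constant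
  -- `1`. In the final constant, `K` measures `ξ - ξ₀` and the rest bounds the second order term
  -- `W`.
  refine ⟨min δ (min 1 (1 / (P.κ * L + 1))), lt_min hδ (lt_min one_pos (by positivity)),
    K + (P.κ * (‖P.B‖ * (‖y₀‖ + 1) * (‖y₀‖ + 1)) + 1), fun ε w hε0 hε h hw => ?_⟩
  have hε1 : ε ≤ 1 := hε.le.trans ((min_le_right _ _).trans (min_le_left _ _))
  have hε2 := hε.le.trans ((min_le_right _ _).trans (min_le_right _ _))
  rw [le_div_iff₀ (by positivity)] at hε2
  have hw2 : |w ^ 2 - 1| ≤ 2 * ε ^ 2 := by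
    rw [hw, add_sub_cancel_left, abs_mul, abs_mul, abs_two, abs_of_nonneg (sq_nonneg ε)]
    rcases hσ with rfl | rfl <;> simp
  obtain ⟨ξ, v, hvS, hv1, hξ1, hξK, hξ, hv⟩ := hsol ε hε0 (hε.trans_le (min_le_left _ _))
    (P.inv h) (P.isClose_inv σ y₀ h hε0.le hε1 hw2) {g | IsReg 1 g} (IsReg.isClosed 1)
    (IsReg.zero.mono zero_le_one) fun ξ v hξ hv hvr => by
      refine ((P.isReg_inv h (hL w ε h ξ v hε0.le hε1 hξ hv hvr)).smul ε).mono ?_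
      rw [abs_of_pos hε0]
      linarith
  refine ⟨fun t => ε • (P.Φ ξ (w * t)
    + ε • ((P.bifData σ y₀).second (P.inv h) ξ + v) (w * t)), ?_⟩
  obtain ⟨h1, h2, h3⟩ := P.periodic_solution hσ h hw hvS rfl (hL w ε h ξ v hε0.le hε1 hξ1 hv1 hvS)
    hξ hv (fun t => rfl)
  refine ⟨h1, h2, h3, fun t => ?_⟩
  set W := (P.bifData σ y₀).second (P.inv h) ξ + v with hW
  have hξr : ‖ξ‖ ≤ ‖y₀‖ + 1 := by
    have := norm_add_le (ξ - y₀) y₀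
    rw [sub_add_cancel] at this
    have h4 : ‖ξ - y₀‖ ≤ 1 := hξ1
    linarith
  have hWn : ‖W‖ ≤ P.κ * (‖P.B‖ * (‖y₀‖ + 1) * (‖y₀‖ + 1)) + 1 := by
    refine (norm_add_le _ _).trans (add_le_add ((P.norm_inv_apply_le h _).trans ?_) hv1)
    refine mul_le_mul_of_nonneg_left ((norm_bilinX_le _ _ _).trans ?_) hκ
    have := (P.norm_Φ_le ξ).trans hξr
    gcongr <;> exact this
  have e1 : ellW.flow ω (t * w) (ellW.incl (le_add_of_nonneg_right zero_le_three) (ε • ξ₀))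
      = ε • P.Φ y₀ (w * t) := ellW.ext fun j => by
    change Real.cos (ω j * (t * w)) * (ε * ξ₀ j) = ε * (Real.cos (ω j * (w * t)) * y₀ j)
    rw [hy₀, inclL_apply, mul_comm t w]
    ring
  have e2 : ε • (P.Φ ξ (w * t) + ε • W (w * t)) - ε • P.Φ y₀ (w * t)
      = ε • (P.Φ (ξ - y₀) (w * t) + ε • W (w * t)) := by
    rw [map_sub, BoundedContinuousFunction.sub_apply]
    module
  rw [e1, e2, norm_smul, Real.norm_of_nonneg hε0.le]
  have h5 : ‖P.Φ (ξ - y₀) (w * t)‖ ≤ K * ε :=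
    (((P.Φ (ξ - y₀)).norm_coe_le_norm _).trans (P.norm_Φ_le _)).trans hξK
  have h6 : ‖ε • W (w * t)‖ ≤ ε * (P.κ * (‖P.B‖ * (‖y₀‖ + 1) * (‖y₀‖ + 1)) + 1) := by
    rw [norm_smul, Real.norm_of_nonneg hε0.le]
    exact mul_le_mul_of_nonneg_left ((W.norm_coe_le_norm _).trans hWn) hε0.le
  have h7 := mul_le_mul_of_nonneg_left ((norm_add_le (P.Φ (ξ - y₀) (w * t)) (ε • W (w * t))).trans
    (add_le_add h5 h6)) hε0.le
  refine h7.trans (le_of_eq ?_)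
  ring

end Model

end SeqPDE

end

/-! ### Assembly of the family of periodic solutions. -/

theorem mainTheorem2 (s : ℝ) (hs : 0 ≤ s) (ω : ℕ → ℕ) (hωpos : ∀ j, 0 < ω j)
    (hω : (fun j : ℕ => (ω j : ℝ)) =Θ[Filter.atTop] (fun j : ℕ => (j : ℝ)))
    (D : ℕ → ℕ → ℕ → ℝ) (C : ℕ → ℕ → ℕ → ℕ → ℝ)
    (hDsymm : ∀ i j m, D i j m = D j i m)
    (hDsum : ∀ (u : SeqPDE.ellW s) (m : ℕ),
      Summable fun p : ℕ × ℕ => D p.1 p.2 m * u p.1 * u p.2)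
    (hCsum : ∀ (u : SeqPDE.ellW s) (m : ℕ),
      Summable fun p : ℕ × ℕ × ℕ => C p.1 p.2.1 p.2.2 m * u p.1 * u p.2.1 * u p.2.2)
    (hf2 : SeqPDE.IsC11On s (SeqPDE.quadTerm D))
    (hf3 : SeqPDE.IsC11On s (SeqPDE.cubicTerm C))
    (hnonres : ∀ x : SeqPDE.ellW (s + 3),
      SeqPDE.flowAverage ω (SeqPDE.quadTerm D) x = 0)
    (σ : ℝ) (hσ : σ = 1 ∨ σ = -1)
    (ξ₀ : SeqPDE.ellW (s + 3))
    (hzero : SeqPDE.modOp ω D C σ ξ₀ = 0)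
    (hker : ∀ h : SeqPDE.ellW (s + 3), SeqPDE.modOpDiff ω D C σ ξ₀ h = 0 → h = 0)
    (α : ℝ) (hα0 : 0 < α) (hα : α < 1 / 3) :
    ∃ (E : Set ℝ) (freq : ℝ → ℝ) (u : ℝ → ℝ → SeqPDE.ellW s) (wstar K : ℝ),
      E ⊆ Set.Ioi 0 ∧
      (∀ δ : ℝ, 0 < δ → ¬ (E ∩ Set.Ioo 0 δ).Countable) ∧
      0 < wstar ∧ wstar < 1 ∧
      (∀ ε ∈ E, freq ε ∈ SeqPDE.diophantine ω α) ∧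
      (σ = 1 → (∀ ε ∈ E, freq ε ∈ Set.Ico 1 (1 + wstar)) ∧ StrictMonoOn freq E) ∧
      (σ = -1 → (∀ ε ∈ E, freq ε ∈ Set.Ioc (1 - wstar) 1) ∧ StrictAntiOn freq E) ∧
      ∀ ε ∈ E,
        |1 - freq ε| ≤ K * ε ∧
        SeqPDE.IsSolution ω D C (u ε) ∧
        Function.Periodic (u ε) (2 * Real.pi / freq ε) ∧
        SeqPDE.MemH1 (u ε) 0 (2 * Real.pi / freq ε) ∧
        ∀ t : ℝ, ‖u ε t - SeqPDE.ellW.flow ω (t * freq ε)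
            (SeqPDE.ellW.incl (le_add_of_nonneg_right zero_le_three) (ε • ξ₀))‖ ≤ K * ε ^ 2 := by
  obtain ⟨P, rfl⟩ := SeqPDE.exists_model hωpos hω hDsymm hDsum hf2 hf3 hnonres hα0
    (by linarith : α ≤ 1)
  obtain ⟨δ, hδ, K, hsol⟩ := P.exists_periodic_solution hσ hzero hker
  set r := min δ (1 / 2) with hr
  have hr0 : 0 < r := lt_min hδ (by norm_num)
  set freq : ℝ → ℝ := fun ε => √(1 + 2 * σ * ε ^ 2) with hfreq
  -- The cut at `1 / 2` contained in `r` keeps `freq ε` between `1 / 2` and `3 / 2`, as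
  -- admissibility and the choice `wstar = 1 / 2` require.
  set E : Set ℝ := {ε | freq ε ∈ SeqPDE.diophantine ω P.α} ∩ Ioo 0 r with hE
  have hhalf : ∀ ε ∈ E, ε < 1 / 2 := fun ε hε => hε.2.2.trans_le (min_le_right _ _)
  have hsq4 : ∀ ε ∈ E, ε ^ 2 < 1 / 4 := fun ε hε => by
    have h1 := hhalf ε hε
    have h2 : 0 < ε := hε.2.1
    nlinarith
  have hbase : ∀ ε ∈ E, 1 / 2 ≤ 1 + 2 * σ * ε ^ 2 ∧ 1 + 2 * σ * ε ^ 2 ≤ 3 / 2 := fun ε hε => by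
    have h1 := hsq4 ε hε
    have h2 := sq_nonneg ε
    rcases hσ with rfl | rfl <;> constructor <;> linarith
  have hsq : ∀ ε ∈ E, freq ε ^ 2 = 1 + 2 * σ * ε ^ 2 := fun ε hε =>
    Real.sq_sqrt (by linarith [(hbase ε hε).1])
  have hnn : ∀ ε, 0 ≤ freq ε := fun ε => Real.sqrt_nonneg _
  have hlow : ∀ ε ∈ E, 1 / 2 < freq ε := fun ε hε => by
    have h1 := hsq ε hε
    have h2 := (hbase ε hε).1
    nlinarith [hnn ε]
  have hupp : ∀ ε ∈ E, freq ε < 3 / 2 := fun ε hε => by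
    have h1 := hsq ε hε
    have h2 := (hbase ε hε).2
    nlinarith [hnn ε]
  have hadm : ∀ ε ∈ E, SeqPDE.Admissible ω P.α (freq ε) := fun ε hε =>
    ⟨hωpos, P.α_pos, (hlow ε hε).le, by linarith [hupp ε hε], hε.1⟩
  have hex : ∀ ε, ∃ u : ℝ → SeqPDE.ellW s, ε ∈ E → SeqPDE.IsSolution ω D C u ∧
      Function.Periodic u (2 * π / freq ε) ∧ SeqPDE.MemH1 u 0 (2 * π / freq ε) ∧
      ∀ t, ‖u t - SeqPDE.ellW.flow ω (t * freq ε)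
        (SeqPDE.ellW.incl (le_add_of_nonneg_right zero_le_three) (ε • ξ₀))‖ ≤ K * ε ^ 2 :=
    fun ε => by
      by_cases hε : ε ∈ E
      · obtain ⟨u, hu⟩ := hsol ε (freq ε) hε.2.1 (hε.2.2.trans_le (min_le_left _ _))
          (hadm ε hε) (hsq ε hε)
        exact ⟨u, fun _ => hu⟩
      · exact ⟨0, fun h => absurd h hε⟩
  choose u hu using hex
  refine ⟨E, freq, u, 1 / 2, max K 2, fun ε hε => hε.2.1, fun δ' hδ' hcount => ?_, by norm_num,
    by norm_num, fun ε hε => hε.1, fun h1 => ⟨fun ε hε => ⟨?_, by linarith [hupp ε hε]⟩, ?_⟩,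
    fun h1 => ⟨fun ε hε => ⟨by linarith [hlow ε hε], ?_⟩, ?_⟩, fun ε hε => ?_⟩
  · refine SeqPDE.not_countable_amplitudes ω hα0 hα hσ (lt_min hr0 hδ') (hcount.mono ?_)
    rintro ε ⟨h1, h2, h3⟩
    exact ⟨⟨h1, h2, h3.trans_le (min_le_left _ _)⟩, h2, h3.trans_le (min_le_right _ _)⟩
  · have h2 := hsq ε hε
    rw [h1] at h2
    nlinarith [hnn ε, sq_nonneg ε]
  · intro x hx y hy hxy
    have h2 : x ^ 2 < y ^ 2 := pow_lt_pow_left₀ hxy hx.2.1.le two_ne_zero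
    refine Real.sqrt_lt_sqrt (by linarith [(hbase x hx).1]) ?_
    rw [h1]
    linarith
  · have h2 := hsq ε hε
    rw [h1] at h2
    nlinarith [hnn ε, sq_nonneg ε]
  · intro x hx y hy hxy
    have h2 : x ^ 2 < y ^ 2 := pow_lt_pow_left₀ hxy hx.2.1.le two_ne_zero
    refine Real.sqrt_lt_sqrt (by linarith [(hbase y hy).1]) ?_
    rw [h1]
    linarith
  · obtain ⟨h1, h2, h3, h4⟩ := hu ε hε
    refine ⟨?_, h1, h2, h3, fun t => (h4 t).trans
      (mul_le_mul_of_nonneg_right (le_max_left _ _) (sq_nonneg ε))⟩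
    have hε0 : 0 < ε := hε.2.1
    refine le_trans ?_ (mul_le_mul_of_nonneg_right (le_max_right K 2) hε0.le)
    have h5 := hsq ε hε
    -- Hence `|1 - freq ε| ≤ 2 ε²`, which is more than the linear bound that is claimed.
    have h6 : |1 - freq ε| * (1 + freq ε) = 2 * ε ^ 2 := by
      rw [← abs_of_nonneg (by linarith [hnn ε] : 0 ≤ 1 + freq ε), ← abs_mul]
      have e : (1 - freq ε) * (1 + freq ε) = -(2 * σ * ε ^ 2) := by linear_combination -h5
      rw [e, abs_neg, abs_mul, abs_mul, abs_two, abs_of_nonneg (sq_nonneg ε)]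
      rcases hσ with rfl | rfl <;> simp
    have h7 : |1 - freq ε| ≤ 2 * ε ^ 2 := by
      nlinarith [abs_nonneg (1 - freq ε), hnn ε]
    nlinarith [hhalf ε hε]
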